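/- Let $M$ be a Riemann surface and let $F:M\to\mathbb R^4$ be a proper conformal harmonic immersion (a properly immersed oriented minimal surface $\Sigma$), injective outside $F^{-1}(\mathbb B(0,R_0))$ for some $R_0$. Suppose that $\Sigma$ has exactly $k$ ends $E_1,\dots,E_k$, in the following sense. Each end is parametrized by an injective holomorphic map $E_i:\{|z|>\rho_i\}\to M$, the images are pairwise disjoint, and for $r>\max_i\rho_i$ the set $M\setminus\bigcup_iE_i(\{|z|>r\})$ is compact. The end $E_i$ has order $N_i\ge1$ and oriented tangent plane at infinity $P_i$: in suitable orthonormal coordinates of $\mathbb R^4\cong\mathbb C\times\mathbb C$, the first of which parametrizes $P_i$, $$F(E_i(z))=\bigl(z^{N_i}+o(|z|^{N_i}),\,o(|z|^{N_i})\bigr)\qquad(z\to\infty).$$ (A properly immersed minimal surface of finite total curvature has such ends.) For large $R$ the intersection $L_R=\Sigma\cap\mathbb S(0,R)$ is a link with one component for each end, oriented as the boundary of $\Sigma\cap\mathbb B(0,R)$. The writhe at infinity $w_\infty(\Sigma)$ is the linking number $lk(L_R,\hat L_R)$ in $\mathbb S(0,R)$ (oriented as the boundary of the ball), where $\hat L_R$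 is obtained by pushing each component of $L_R$, inside the sphere, slightly in the direction of a nonzero vector $X_i$ orthogonal to $P_i$. The writhe $w_\infty(E_i)$ of one end is defined in the same way from the component of $L_R$ that lies on $E_i$. Suppose that the planes $P_i$ are pairwise transverse. Then these numbers are well defined, i.e. for all large $R$ the linking numbers depend neither on $R$, nor on the vectors $X_i$, nor on the (sufficiently small) size of the push, and $$w_\infty(\Sigma)=\sum_{i=1}^k w_\infty(E_i)+2\sum_{1\le i<j\le k}N_iN_j\,\sigma(i,j),$$ where $\sigma(i,j)=1$ (resp. $-1$) if $P_i$ and $P_j$ intersect positively (resp. negatively), i.e. if an oriented basis of $P_i$ followed by one of $P_j$ is a positive (resp. negative) basis of $\mathbb R^4$. -/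

import Mathlib

open Set Filter Topology
open scoped Manifold ContDiff

/-- Euclidean four-space. -/
abbrev R4 : Type := EuclideanSpace ℝ (Fin 4)

/-- The determinant of four vectors of `ℝ⁴` (the standard volume form). -/
noncomputable def det4 (a b c d : R4) : ℝ :=
  Matrix.det (Matrix.of fun i j : Fin 4 => (![a, b, c, d] i) j)

/-- The sign of the intersection of two oriented planes of `ℝ⁴`, with oriented bases `(u, v)` and
`(u', v')`: it is `1` if `(u, v, u', v')` is a positive basis of `ℝ⁴`, `-1` if it is a negative
one (and `0` if the planes are not transverse). -/
noncomputable def intersectionSign (u v u' v' : R4) : ℝ :=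
  Real.sign (det4 u v u' v')

/-! ### Minimal surfaces and their ends -/

/-- `F : M → ℝ⁴` is a minimal immersion of the Riemann surface `M`: read in the holomorphic charts
it is harmonic, and conformal (so that its differential is injective everywhere). The orientation
of the surface is the one of `M`. -/
def IsMinimalImmersion {M : Type*} [TopologicalSpace M] [ChartedSpace ℂ M] (F : M → R4) : Prop :=
  ∀ e ∈ atlas ℂ M,
    InnerProductSpace.HarmonicOnNhd (F ∘ e.symm) e.target ∧
      ∀ z ∈ e.target, ConformalAt (F ∘ e.symm) z

/-- `F` is injective outside some ball: with `F` a proper immersion, the surface is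
embedded outside that ball. -/
def EmbeddedOutsideBall {M : Type*} (F : M → R4) : Prop :=
  ∃ R₀ : ℝ, InjOn F {x | R₀ ≤ ‖F x‖}

/-- The exterior domain `{|z| > ρ}`. -/
def annulus (ρ : ℝ) : Set ℂ := {z | ρ < ‖z‖}

/-- `E : {|z| > ρ} → M` parametrizes (holomorphically and injectively) an end of the surface
`F : M → ℝ⁴`, of order `N`, whose tangent plane at infinity is the plane with oriented orthonormal
basis `(u, v)`: in an orthonormal frame beginning with `(u, v)`,
`F (E z) = (z ^ N + o(|z| ^ N), o(|z| ^ N))`. -/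
structure IsEnd {M : Type*} [TopologicalSpace M] [ChartedSpace ℂ M] (F : M → R4)
    (E : ℂ → M) (ρ : ℝ) (N : ℕ) (u v : R4) : Prop where
  radius_pos : 0 < ρ
  order_pos : 1 ≤ N
  holomorphic : MDifferentiableOn 𝓘(ℂ) 𝓘(ℂ) E (annulus ρ)
  injective : InjOn E (annulus ρ)
  orthonormal : Orthonormal ℝ ![u, v]
  asymptotic :
    (fun z : ℂ => F (E z) - ((z ^ N).re • u + (z ^ N).im • v))
      =o[Bornology.cobounded ℂ] fun z => ‖z‖ ^ N

/-- The surface `F : M → ℝ⁴` has exactly the ends `E i`, of orders `N i` and with tangent planes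
at infinity `(u i, v i)`: the ends are disjoint and what remains of `M` when the regions
`{|z| > r}` are removed from all of them is compact. -/
structure HasEnds {M : Type*} [TopologicalSpace M] [ChartedSpace ℂ M] (F : M → R4)
    {k : ℕ} (E : Fin k → ℂ → M) (ρ : Fin k → ℝ) (N : Fin k → ℕ) (u v : Fin k → R4) : Prop where
  isEnd : ∀ i, IsEnd F (E i) (ρ i) (N i) (u i) (v i)
  disjoint : ∀ i j, i ≠ j → Disjoint (E i '' annulus (ρ i)) (E j '' annulus (ρ j))
  compact : ∀ r : ℝ, (∀ i, ρ i < r) → IsCompact (⋃ i, E i '' annulus r)ᶜ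

/-- The (non-oriented) plane spanned by `u` and `v`. -/
def plane (u v : R4) : Submodule ℝ R4 := Submodule.span ℝ {u, v}

/-! ### Linking numbers in a round three-sphere centred at the origin -/

/-- The kernel `∫₀^∞ r dr / |a - r b|⁴` of the Gauss linking integral of the three-sphere. -/
noncomputable def linkingKernel (a b : R4) : ℝ :=
  ∫ r in Ioi (0 : ℝ), r / ‖a - r • b‖ ^ 4

/-- The linking number of two disjoint smooth `2π`-periodic closed curves `α`, `β` of a sphere
`S(0, R)` of `ℝ⁴` (oriented as the boundary of the ball), as the Gauss linking integral of the
three-sphere: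
`1/(2π²) ∫∫ det (α, α', β, β') (∫₀^∞ r dr / |α - r β|⁴) ds dt`.
Up to the choice of orientation, this is the degree of `(s, t, r) ↦ (α s - r β t) / |α s - r β t|`
from the join of the two circles to `S³`; here `2π²` is the volume of `S³`. The orientation is such
that the boundaries of the unit discs of two planes which meet positively have linking number `1`;
for instance the curves `(exp (i s), 0)` and `(0, exp (i t))` of `ℂ² = ℝ⁴`. -/
noncomputable def linkingNumber (α β : ℝ → R4) : ℝ :=
  1 / (2 * Real.pi ^ 2) *
    ∫ s in (0 : ℝ)..(2 * Real.pi), ∫ t in (0 : ℝ)..(2 * Real.pi),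
      det4 (α s) (deriv α s) (β t) (deriv β t) * linkingKernel (α s) (β t)

/-- The linking number of two links, given by their oriented components, is the sum of the linking
numbers of the components of the first with the components of the second. -/
noncomputable def linkLinkingNumber {ι : Type} [Fintype ι] (L L' : ι → ℝ → R4) : ℝ :=
  ∑ i, ∑ j, linkingNumber (L i) (L' j)

/-! ### The writhe at infinity -/

/-- The curve `t ↦ G (r(t) exp (i t))` on an end `G : {|z| > ρ} → ℝ⁴`. -/
noncomputable def endCurve (G : ℂ → R4) (r : ℝ → ℝ) (t : ℝ) : R4 :=
  G (r t * Complex.exp (t * Complex.I))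

/-- The components of `S ∩ S(0, R)`, where `S` is a surface with ends `G i : {|z| > ρ i} → ℝ⁴`,
one for each end, are parametrized by the argument of the parameter `z` of the end, thus
oriented as the boundary of `S ∩ B(0, R)`. -/
structure ParametrizesLink (S : Set R4) {ι : Type} (G : ι → ℂ → R4) (ρ : ι → ℝ)
    (R : ℝ) (r : ι → ℝ → ℝ) : Prop where
  smooth : ∀ i, ContDiff ℝ ∞ (r i)
  periodic : ∀ i, Function.Periodic (r i) (2 * Real.pi)
  radius_lt : ∀ i t, ρ i < r i t
  link_eq : S ∩ Metric.sphere (0 : R4) R = ⋃ i, range (endCurve (G i) (r i))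

/-- The curve `c` of the sphere `S(0, R)` pushed by `ε` in the direction of the vector `X`, inside
the sphere: `c + ε X`, projected radially to the sphere. To first order in `ε` the displacement is
the orthogonal projection of `ε X` to the tangent space of the sphere. -/
noncomputable def pushOff (R ε : ℝ) (X : R4) (c : ℝ → R4) (t : ℝ) : R4 :=
  (R / ‖c t + ε • X‖) • (c t + ε • X)

/-- `w` is the writhe at infinity of the surface `S`, with ends `G i : {|z| > ρ i} → ℝ⁴` and
tangent planes at infinity `P i`. For all large `R`, the set `S ∩ S(0, R)` is a
link `L` with one component for each end, and for all nonzero vectors `X i` orthogonal to `P i`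
the link `L'` obtained by pushing the `i`-th component of `L` slightly in the direction `X i` is
disjoint from `L` and satisfies `lk (L, L') = w`. -/
def HasWritheAtInfinity (S : Set R4) {ι : Type} [Fintype ι] (G : ι → ℂ → R4) (ρ : ι → ℝ)
    (P : ι → Submodule ℝ R4) (w : ℝ) : Prop :=
  ∀ᶠ R : ℝ in atTop,
    (∃ r : ι → ℝ → ℝ, ParametrizesLink S G ρ R r) ∧
    ∀ r : ι → ℝ → ℝ, ParametrizesLink S G ρ R r →
      ∀ X : ι → R4, (∀ i, X i ≠ 0 ∧ X i ∈ (P i)ᗮ) →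
        ∀ᶠ ε : ℝ in 𝓝[>] 0,
          (∀ i j s t, endCurve (G i) (r i) s ≠ pushOff R ε (X j) (endCurve (G j) (r j)) t) ∧
          linkLinkingNumber (fun i => endCurve (G i) (r i))
            (fun j => pushOff R ε (X j) (endCurve (G j) (r j))) = w

/-- `w` is the writhe at infinity of the whole surface `F : M → ℝ⁴` with the ends `E i`. -/
def HasSurfaceWrithe {M : Type*} (F : M → R4) {k : ℕ} (E : Fin k → ℂ → M) (ρ : Fin k → ℝ)
    (u v : Fin k → R4) (w : ℝ) : Prop :=
  HasWritheAtInfinity (range F) (fun i => F ∘ E i) ρ (fun i => plane (u i) (v i)) w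

/-- `w` is the writhe at infinity of the single end `E` of the surface `F : M → ℝ⁴`. -/
def HasEndWrithe {M : Type*} (F : M → R4) (E : ℂ → M) (ρ : ℝ) (u v : R4) (w : ℝ) : Prop :=
  HasWritheAtInfinity (F '' (E '' annulus ρ)) (fun _ : Unit => F ∘ E) (fun _ => ρ)
    (fun _ => plane u v) w

/-! ### The determinant of four vectors -/

/-! The Gauss integral is, up to sign and the factor `1 / (2π²)`, the integral of the pull-back of
the 3-form `ι_x vol / ‖x‖ ^ 4`, closed on `ℝ⁴ ∖ {0}`, under the join map `(s, t, u) ↦ (1 - u) α(s) -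
u β(t)`. Stokes' theorem on a box with one more variable, the time of a homotopy, shows that it does
not change as long as neither curve meets the cone over the other (`RayDisjoint`). It is therefore
locally constant in continuous families of loops (`eventually_linkingNumber_eq`), and integrality is
never needed. Working with cones instead of a fixed sphere allows straight-line homotopies in `ℝ⁴`
and makes the radial projection in the push-off harmless.

On an end the coordinates are harmonic, so a gradient estimate carries the asymptotics `z ^ N +
o(|z| ^ N)` over to the first derivatives. Hence `‖G‖` increases strictly along far rays, a large
sphere cuts each ray once beyond a fixed radius, and the curve cut out, divided by `R`, is
`C¹`-close to the `N`-fold unit circle of the plane at infinity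
(`IsEndWithRadius.eventually_close`).

Diagonal terms (`exists_writhe`): a small push-off `c + Y` with `Y` orthogonal to the plane misses
the cone over `c`. For nearby parameters this holds because the projection of `c` to the plane turns
monotonically, for distant ones because the end is embedded. The admissible `Y` form a punctured
disc of a 2-plane, which is connected, and so is the range of `R`; the linking number is thus a
constant, the writhe of the end.

Off-diagonal terms (`eventually_linkingNumber`): two ends with transverse planes cut out curves
close to `R` times circles that are disjoint as rays. The linking number is that of the circles,
`N_i N_j σ(i, j)`, computed after a Gram–Schmidt deformation to orthogonal planes. Summing over
ordered pairs gives the formula, each unordered pair being counted twice. -/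

lemma det4_eq (a b c d : R4) : det4 a b c d =
    a 0 * (b 1 * (c 2 * d 3 - c 3 * d 2) - b 2 * (c 1 * d 3 - c 3 * d 1)
      + b 3 * (c 1 * d 2 - c 2 * d 1))
    - a 1 * (b 0 * (c 2 * d 3 - c 3 * d 2) - b 2 * (c 0 * d 3 - c 3 * d 0)
      + b 3 * (c 0 * d 2 - c 2 * d 0))
    + a 2 * (b 0 * (c 1 * d 3 - c 3 * d 1) - b 1 * (c 0 * d 3 - c 3 * d 0)
      + b 3 * (c 0 * d 1 - c 1 * d 0))
    - a 3 * (b 0 * (c 1 * d 2 - c 2 * d 1) - b 1 * (c 0 * d 2 - c 2 * d 0)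
      + b 2 * (c 0 * d 1 - c 1 * d 0)) := by
  simp [det4, Matrix.det_succ_row_zero, Fin.sum_univ_succ, Fin.succAbove]
  ring

lemma norm_sq_eq_coord (x : R4) : ‖x‖ ^ 2 = x 0 ^ 2 + x 1 ^ 2 + x 2 ^ 2 + x 3 ^ 2 := by
  rw [EuclideanSpace.norm_sq_eq]
  simp [Fin.sum_univ_four]

lemma inner_eq_coord (x y : R4) :
    inner ℝ x y = x 0 * y 0 + x 1 * y 1 + x 2 * y 2 + x 3 * y 3 := by
  simp [PiLp.inner_apply, Fin.sum_univ_four, mul_comm]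

lemma HasDerivAt.r4_apply {f : ℝ → R4} {f' : R4} {x : ℝ} (hf : HasDerivAt f f' x) (i : Fin 4) :
    HasDerivAt (fun t => f t i) (f' i) x := by
  exact (EuclideanSpace.proj (𝕜 := ℝ) i : R4 →L[ℝ] ℝ).hasFDerivAt.comp_hasDerivAt x hf

lemma HasDerivAt.det4 {a b c d : ℝ → R4} {a' b' c' d' : R4} {x : ℝ}
    (ha : HasDerivAt a a' x) (hb : HasDerivAt b b' x) (hc : HasDerivAt c c' x)
    (hd : HasDerivAt d d' x) :
    HasDerivAt (fun t => det4 (a t) (b t) (c t) (d t))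
      (det4 a' (b x) (c x) (d x) + det4 (a x) b' (c x) (d x) + det4 (a x) (b x) c' (d x)
        + det4 (a x) (b x) (c x) d') x := by
  have A := ha.r4_apply
  have B := hb.r4_apply
  have C := hc.r4_apply
  have D := hd.r4_apply
  have minor : ∀ i j, HasDerivAt (fun t => c t i * d t j - c t j * d t i)
      (c' i * d x j + c x i * d' j - (c' j * d x i + c x j * d' i)) x := fun i j =>
    ((C i).mul (D j)).sub ((C j).mul (D i))
  have minor3 : ∀ i j k, HasDerivAt (fun t => b t i * (c t j * d t k - c t k * d t j)
      - b t j * (c t i * d t k - c t k * d t i) + b t k * (c t i * d t j - c t j * d t i)) _ x :=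
    fun i j k => (((B i).mul (minor j k)).sub ((B j).mul (minor i k))).add
      ((B k).mul (minor i j))
  have := ((((A 0).mul (minor3 1 2 3)).sub ((A 1).mul (minor3 0 2 3))).add
    ((A 2).mul (minor3 0 1 3))).sub ((A 3).mul (minor3 0 1 2))
  simp only [det4_eq]
  refine this.congr_deriv ?_
  ring

lemma ContDiff.r4_apply {X : Type*} [NormedAddCommGroup X] [NormedSpace ℝ X] {n : WithTop ℕ∞}
    {f : X → R4} (hf : ContDiff ℝ n f) (i : Fin 4) : ContDiff ℝ n fun x => f x i :=
  (EuclideanSpace.proj (𝕜 := ℝ) i : R4 →L[ℝ] ℝ).contDiff.comp hf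

lemma ContDiff.det4 {X : Type*} [NormedAddCommGroup X] [NormedSpace ℝ X] {n : WithTop ℕ∞}
    {a b c d : X → R4} (ha : ContDiff ℝ n a) (hb : ContDiff ℝ n b) (hc : ContDiff ℝ n c)
    (hd : ContDiff ℝ n d) : ContDiff ℝ n fun x => det4 (a x) (b x) (c x) (d x) := by
  have A := ha.r4_apply
  have B := hb.r4_apply
  have C := hc.r4_apply
  have D := hd.r4_apply
  simp only [det4_eq]
  fun_prop

/-- Cramer's rule: the expansion of a vector in a basis, paired with the vector itself. -/
lemma inner_det4_cramer (y p q r w : R4) :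
    inner ℝ y p * det4 y q r w - inner ℝ y q * det4 y p r w + inner ℝ y r * det4 y p q w
      - inner ℝ y w * det4 y p q r = ‖y‖ ^ 2 * det4 p q r w := by
  rw [norm_sq_eq_coord]
  simp only [inner_eq_coord, det4_eq]
  ring

/-! ### The kernel as an integral over a compact interval -/

lemma linkingKernel_eq (a b : R4) :
    linkingKernel a b = ∫ u in (0 : ℝ)..1, u * (1 - u) / ‖(1 - u) • a - u • b‖ ^ 4 := by
  rw [linkingKernel, intervalIntegral.integral_of_le zero_le_one,
    MeasureTheory.integral_Ioc_eq_integral_Ioo]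
  have himg : (fun u : ℝ => u / (1 - u)) '' Ioo 0 1 = Ioi 0 := by
    ext r
    constructor
    · rintro ⟨u, ⟨h0, h1⟩, rfl⟩
      exact div_pos h0 (by linarith)
    · intro hr
      have hr' : (0 : ℝ) < r := hr
      refine ⟨r / (1 + r), ⟨by positivity, by rw [div_lt_one (by linarith)]; linarith⟩, ?_⟩
      have : 1 - r / (1 + r) = 1 / (1 + r) := by field_simp; ring
      simp only [this]
      field_simp
  -- The substitution is `r = u / (1 - u)`, with derivative `1 / (1 - u) ^ 2`.
  rw [← himg, MeasureTheory.integral_image_eq_integral_abs_deriv_smul (f' := fun u => 1 / (1 - u) ^ 2)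
    measurableSet_Ioo]
  · refine MeasureTheory.setIntegral_congr_fun measurableSet_Ioo fun u hu => ?_
    have h1 : 0 < 1 - u := by linarith [hu.2]
    have : a - (u / (1 - u)) • b = (1 / (1 - u)) • ((1 - u) • a - u • b) := by
      rw [smul_sub, smul_smul, smul_smul, one_div, inv_mul_cancel₀ h1.ne', one_smul]
      congr 2
      field_simp
    simp only [this, norm_smul, Real.norm_eq_abs, abs_of_pos (one_div_pos.2 h1), smul_eq_mul]
    rw [abs_of_pos (by positivity)]
    -- Where the denominator vanishes both sides are `0` by the convention for division, so the
    -- identity holds for all `a` and `b`.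
    by_cases h : ‖(1 - u) • a - u • b‖ = 0
    · simp [h]
    · field_simp
  · intro u hu
    have h1 : 1 - u ≠ 0 := by linarith [hu.2]
    refine HasDerivAt.hasDerivWithinAt ?_
    refine ((hasDerivAt_id u).div ((hasDerivAt_id u).const_sub 1) h1).congr_deriv ?_
    simp
  · intro u hu w hw h
    have h1 : 1 - u ≠ 0 := by linarith [hu.2]
    have h2 : 1 - w ≠ 0 := by linarith [hw.2]
    simp only at h
    rw [div_eq_div_iff h1 h2] at h
    linarith

lemma linkingKernel_comm (a b : R4) : linkingKernel a b = linkingKernel b a := by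
  rw [linkingKernel_eq, linkingKernel_eq]
  have := intervalIntegral.integral_comp_sub_left (a := 0) (b := 1)
    (fun u : ℝ => u * (1 - u) / ‖(1 - u) • a - u • b‖ ^ 4) 1
  rw [sub_self, sub_zero] at this
  rw [← this]
  congr 1
  ext u
  have h1 : (1 - (1 - u)) • a - (1 - u) • b = -((1 - u) • b - u • a) := by module
  rw [h1, norm_neg, sub_sub_cancel, mul_comm]

/-! ### Stokes' theorem for the pull-back of the closed form `x / ‖x‖ ^ 4` of `ℝ⁴` -/

/-- The partial derivative of a map on `ℝ⁴`. -/
noncomputable def pderiv4 (y : (Fin 4 → ℝ) → R4) (i : Fin 4) (x : Fin 4 → ℝ) : R4 :=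
  fderiv ℝ y x (Pi.single i 1)

lemma ContDiff.pderiv4 {y : (Fin 4 → ℝ) → R4} (hy : ContDiff ℝ 2 y) (i : Fin 4) :
    ContDiff ℝ 1 (pderiv4 y i) :=
  (hy.fderiv_right (m := 1) (by norm_num)).clm_apply contDiff_const

lemma pderiv4_comm {y : (Fin 4 → ℝ) → R4} (hy : ContDiff ℝ 2 y) (i j : Fin 4) (x : Fin 4 → ℝ) :
    fderiv ℝ (pderiv4 y i) x (Pi.single j 1) = fderiv ℝ (pderiv4 y j) x (Pi.single i 1) := by
  have hd : DifferentiableAt ℝ (fderiv ℝ y) x :=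
    ((hy.fderiv_right (m := 1) (by norm_num)).differentiable one_ne_zero) x
  have key : ∀ i j : Fin 4, fderiv ℝ (pderiv4 y i) x (Pi.single j 1)
      = fderiv ℝ (fderiv ℝ y) x (Pi.single j 1) (Pi.single i 1) := fun i j => by
    have := (hd.hasFDerivAt.clm_apply (hasFDerivAt_const (Pi.single i (1 : ℝ)) x)).fderiv
    change fderiv ℝ (fun z => fderiv ℝ y z (Pi.single i 1)) x (Pi.single j 1) = _
    rw [this]
    simp
  rw [key, key]
  exact hy.contDiffAt.isSymmSndFDerivAt (by simp) _ _

lemma hasDerivAt_comp_update {E : Type*} [NormedAddCommGroup E] [NormedSpace ℝ E]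
    {f : (Fin 4 → ℝ) → E} {x : Fin 4 → ℝ} (hf : DifferentiableAt ℝ f x) (i : Fin 4) :
    HasDerivAt (fun t => f (Function.update x i t)) (fderiv ℝ f x (Pi.single i 1)) (x i) := by
  have h : HasFDerivAt f (fderiv ℝ f x) (Function.update x i (x i)) := by
    rw [Function.update_eq_self]; exact hf.hasFDerivAt
  exact h.comp_hasDerivAt (x i) (hasDerivAt_update x i (x i))

/-- The components of the pull-back by `y` of the contraction of the volume form of `ℝ⁴` with the
field `x / ‖x‖ ^ 4`, as a vector field. -/
noncomputable def pullbackField (y : (Fin 4 → ℝ) → R4) (i : Fin 4) (x : Fin 4 → ℝ) : ℝ :=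
  ((‖y x‖ ^ 2) ^ 2)⁻¹ * ((-1) ^ (i : ℕ) * det4 (y x) (pderiv4 y (i.succAbove 0) x)
    (pderiv4 y (i.succAbove 1) x) (pderiv4 y (i.succAbove 2) x))

lemma differentiableAt_pullbackField {y : (Fin 4 → ℝ) → R4} (hy : ContDiff ℝ 2 y) (i : Fin 4)
    {x : Fin 4 → ℝ} (hx : y x ≠ 0) : DifferentiableAt ℝ (pullbackField y i) x := by
  have h1 : ContDiff ℝ 1 y := hy.of_le (by norm_num)
  have hdet := h1.det4 (hy.pderiv4 (i.succAbove 0)) (hy.pderiv4 (i.succAbove 1))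
    (hy.pderiv4 (i.succAbove 2))
  have hd := (hdet.differentiable one_ne_zero) x
  have hn : DifferentiableAt ℝ (fun x => ‖y x‖ ^ 2) x :=
    (h1.norm_sq ℝ).differentiable one_ne_zero x
  exact ((hn.pow 2).inv (pow_ne_zero 2 (pow_ne_zero 2 (norm_ne_zero_iff.2 hx)))).mul
    (hd.const_mul _)

lemma fderiv_pullbackField {y : (Fin 4 → ℝ) → R4} (hy : ContDiff ℝ 2 y) (i : Fin 4)
    {x : Fin 4 → ℝ} (hx : y x ≠ 0) :
    fderiv ℝ (pullbackField y i) x (Pi.single i 1) = (-1) ^ (i : ℕ) *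
      (((‖y x‖ ^ 2) ^ 2)⁻¹ *
      (det4 (pderiv4 y i x) (pderiv4 y (i.succAbove 0) x) (pderiv4 y (i.succAbove 1) x)
          (pderiv4 y (i.succAbove 2) x)
        + det4 (y x) (fderiv ℝ (pderiv4 y (i.succAbove 0)) x (Pi.single i 1))
          (pderiv4 y (i.succAbove 1) x) (pderiv4 y (i.succAbove 2) x)
        + det4 (y x) (pderiv4 y (i.succAbove 0) x)
          (fderiv ℝ (pderiv4 y (i.succAbove 1)) x (Pi.single i 1)) (pderiv4 y (i.succAbove 2) x)
        + det4 (y x) (pderiv4 y (i.succAbove 0) x) (pderiv4 y (i.succAbove 1) x)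
          (fderiv ℝ (pderiv4 y (i.succAbove 2)) x (Pi.single i 1)))
      - 4 * ((‖y x‖ ^ 2) ^ 3)⁻¹ * (inner ℝ (y x) (pderiv4 y i x)
        * det4 (y x) (pderiv4 y (i.succAbove 0) x) (pderiv4 y (i.succAbove 1) x)
          (pderiv4 y (i.succAbove 2) x))) := by
  have hP := fun j => hasDerivAt_comp_update
    ((hy.pderiv4 (i.succAbove j)).differentiable one_ne_zero x) i
  have hY : HasDerivAt (fun t => y (Function.update x i t)) (pderiv4 y i x) (x i) :=
    hasDerivAt_comp_update (hy.differentiable two_ne_zero x) i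
  have hdet := hY.det4 (hP 0) (hP 1) (hP 2)
  have hn := hY.norm_sq
  have hne : (‖y (Function.update x i (x i))‖ ^ 2) ^ 2 ≠ 0 := by
    rw [Function.update_eq_self]; positivity
  have h := ((hn.pow 2).inv hne).mul (hdet.const_mul ((-1 : ℝ) ^ (i : ℕ)))
  have h' := hasDerivAt_comp_update (differentiableAt_pullbackField hy i hx) i
  rw [h'.unique h]
  simp only [Function.update_eq_self, Pi.pow_apply, Pi.inv_apply]
  have : ‖y x‖ ≠ 0 := by positivity
  field_simp
  push_cast
  ring

/-- This is `d (y^* ω) = 0`. Each mixed second derivative of `y` occurs twice, with opposite signs.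
What is left is `4 ‖y‖⁻⁴ det (∂₀y, ∂₁y, ∂₂y, ∂₃y)` from differentiating `y` itself, and Cramer's
identity shows that the derivative of `‖y‖⁻⁴` contributes exactly its negative. -/
lemma sum_fderiv_pullbackField {y : (Fin 4 → ℝ) → R4} (hy : ContDiff ℝ 2 y)
    {x : Fin 4 → ℝ} (hx : y x ≠ 0) :
    ∑ i, fderiv ℝ (pullbackField y i) x (Pi.single i 1) = 0 := by
  have hc := inner_det4_cramer (y x) (pderiv4 y 0 x) (pderiv4 y 1 x) (pderiv4 y 2 x)
    (pderiv4 y 3 x)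
  have hne : ‖y x‖ ^ 2 ≠ 0 := by positivity
  simp only [Fin.sum_univ_four, fderiv_pullbackField hy _ hx]
  have e : ∀ i j : Fin 4, j < i → fderiv ℝ (pderiv4 y i) x (Pi.single j 1) =
    fderiv ℝ (pderiv4 y j) x (Pi.single i 1) := fun i j _ => pderiv4_comm hy i j x
  have s00 : (0 : Fin 4).succAbove 0 = 1 := rfl
  have s01 : (0 : Fin 4).succAbove 1 = 2 := rfl
  have s02 : (0 : Fin 4).succAbove 2 = 3 := rfl
  have s10 : (1 : Fin 4).succAbove 0 = 0 := rfl
  have s11 : (1 : Fin 4).succAbove 1 = 2 := rfl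
  have s12 : (1 : Fin 4).succAbove 2 = 3 := rfl
  have s20 : (2 : Fin 4).succAbove 0 = 0 := rfl
  have s21 : (2 : Fin 4).succAbove 1 = 1 := rfl
  have s22 : (2 : Fin 4).succAbove 2 = 3 := rfl
  have s30 : (3 : Fin 4).succAbove 0 = 0 := rfl
  have s31 : (3 : Fin 4).succAbove 1 = 1 := rfl
  have s32 : (3 : Fin 4).succAbove 2 = 2 := rfl
  rw [s00, s01, s02, s10, s11, s12, s20, s21, s22, s30, s31, s32]
  rw [e 1 0 (by decide), e 2 0 (by decide), e 3 0 (by decide), e 2 1 (by decide),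
    e 3 1 (by decide), e 3 2 (by decide)]
  generalize fderiv ℝ (pderiv4 y 0) x (Pi.single 1 1) = q01
  generalize fderiv ℝ (pderiv4 y 0) x (Pi.single 2 1) = q02
  generalize fderiv ℝ (pderiv4 y 0) x (Pi.single 3 1) = q03
  generalize fderiv ℝ (pderiv4 y 1) x (Pi.single 2 1) = q12
  generalize fderiv ℝ (pderiv4 y 1) x (Pi.single 3 1) = q13
  generalize fderiv ℝ (pderiv4 y 2) x (Pi.single 3 1) = q23
  generalize pderiv4 y 0 x = p0 at *
  generalize pderiv4 y 1 x = p1 at *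
  generalize pderiv4 y 2 x = p2 at *
  generalize pderiv4 y 3 x = p3 at *
  generalize y x = v at *
  -- Reordering the columns gives the two occurrences of each mixed derivative the same determinant
  -- and sorts the determinants of the four first derivatives.
  have t1 : det4 v p1 q02 p3 = - det4 v q02 p1 p3 := by simp only [det4_eq]; ring
  have t2 : det4 v p1 p2 q03 = det4 v q03 p1 p2 := by simp only [det4_eq]; ring
  have t3 : det4 v p0 p2 q13 = - det4 v p0 q13 p2 := by simp only [det4_eq]; ring
  have t4 : det4 v q01 p2 p3 = det4 v q01 p2 p3 := by simp only [det4_eq]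
  have t5 : det4 p1 p0 p2 p3 = - det4 p0 p1 p2 p3 := by simp only [det4_eq]; ring
  have t6 : det4 p2 p0 p1 p3 = det4 p0 p1 p2 p3 := by simp only [det4_eq]; ring
  have t7 : det4 p3 p0 p1 p2 = - det4 p0 p1 p2 p3 := by simp only [det4_eq]; ring
  rw [t1, t2, t3, t5, t6, t7]
  have hc' : ((‖v‖ ^ 2) ^ 3)⁻¹ * (‖v‖ ^ 2 * det4 p0 p1 p2 p3) =
      ((‖v‖ ^ 2) ^ 2)⁻¹ * det4 p0 p1 p2 p3 := by
    have : ‖v‖ ≠ 0 := fun h => hne (by rw [h]; simp)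
    field_simp
  rw [← hc] at hc'
  norm_num
  linear_combination (-4) * hc'

lemma integral_faces_pullbackField {y : (Fin 4 → ℝ) → R4} (hy : ContDiff ℝ 2 y)
    {a b : Fin 4 → ℝ} (hab : a ≤ b) (h0 : ∀ x ∈ Icc a b, y x ≠ 0) :
    ∑ i : Fin 4, ((∫ x in Icc (a ∘ i.succAbove) (b ∘ i.succAbove),
        pullbackField y i (i.insertNth (b i) x)) -
      ∫ x in Icc (a ∘ i.succAbove) (b ∘ i.succAbove),
        pullbackField y i (i.insertNth (a i) x)) = 0 := by
  have hz : ∀ x ∈ Icc a b, ∑ i, fderiv ℝ (pullbackField y i) x (Pi.single i 1) = 0 :=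
    fun x hx => sum_fderiv_pullbackField hy (h0 x hx)
  rw [← MeasureTheory.integral_divergence_of_hasFDerivAt_off_countable' a b hab (pullbackField y)
    (fun i x => fderiv ℝ (pullbackField y i) x) ∅ countable_empty]
  · rw [MeasureTheory.setIntegral_congr_fun measurableSet_Icc hz]
    simp
  · exact fun i x hx =>
      (differentiableAt_pullbackField hy i (h0 x hx)).continuousAt.continuousWithinAt
  · intro x hx i
    refine (differentiableAt_pullbackField hy i (h0 x ?_)).hasFDerivAt
    exact ⟨fun j => (hx.1 j trivial).1.le, fun j => (hx.1 j trivial).2.le⟩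
  · refine MeasureTheory.IntegrableOn.congr_fun (f := fun _ => (0 : ℝ)) ?_ (fun x hx => (hz x hx).symm)
      measurableSet_Icc
    exact MeasureTheory.integrableOn_zero

/-! ### Homotopy invariance of the linking integral -/

/-- The curve `a` does not meet the cone over the curve `b` (and neither curve passes through the
origin). -/
def RayDisjoint (a b : ℝ → R4) : Prop :=
  ∀ s t : ℝ, ∀ u ∈ Icc (0 : ℝ) 1, (1 - u) • a s ≠ u • b t

lemma RayDisjoint.symm {a b : ℝ → R4} (h : RayDisjoint a b) : RayDisjoint b a := by
  intro s t u hu he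
  refine h t s (1 - u) ⟨by linarith [hu.2], by linarith [hu.1]⟩ ?_
  rw [sub_sub_cancel, he]

/-- A closed curve of class `C²`, of period `2π`. -/
structure IsLoop (a : ℝ → R4) : Prop where
  contDiff : ContDiff ℝ 2 a
  periodic : Function.Periodic a (2 * Real.pi)

lemma IsLoop.hasDerivAt {a : ℝ → R4} (h : IsLoop a) (t : ℝ) : HasDerivAt a (deriv a t) t :=
  (h.contDiff.differentiable two_ne_zero t).hasDerivAt

lemma IsLoop.continuous_deriv {a : ℝ → R4} (h : IsLoop a) : Continuous (deriv a) :=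
  h.contDiff.continuous_deriv (by norm_num)

/-- The join of the curves `a + τ h` and `-b`. -/
noncomputable def joinMap (a h b : ℝ → R4) (x : Fin 4 → ℝ) : R4 :=
  (1 - x 3) • (a (x 1) + x 0 • h (x 1)) - x 3 • b (x 2)

lemma contDiff_joinMap {a h b : ℝ → R4} (ha : IsLoop a) (hh : IsLoop h) (hb : IsLoop b) :
    ContDiff ℝ 2 (joinMap a h b) := by
  have p : ∀ i : Fin 4, ContDiff ℝ 2 fun x : Fin 4 → ℝ => x i := fun i => contDiff_apply ℝ ℝ i
  exact ((contDiff_const.sub (p 3)).smul ((ha.contDiff.comp (p 1)).add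
    ((p 0).smul (hh.contDiff.comp (p 1))))).sub ((p 3).smul (hb.contDiff.comp (p 2)))

lemma pderiv4_eq_of_hasDerivAt {y : (Fin 4 → ℝ) → R4} (hy : ContDiff ℝ 2 y) {i : Fin 4}
    {x : Fin 4 → ℝ} {v : R4} (h : HasDerivAt (fun t => y (Function.update x i t)) v (x i)) :
    pderiv4 y i x = v :=
  (hasDerivAt_comp_update (hy.differentiable two_ne_zero x) i).unique h

lemma pderiv4_joinMap_zero {a h b : ℝ → R4} (ha : IsLoop a) (hh : IsLoop h) (hb : IsLoop b)
    (x : Fin 4 → ℝ) : pderiv4 (joinMap a h b) 0 x = (1 - x 3) • h (x 1) := by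
  apply pderiv4_eq_of_hasDerivAt (contDiff_joinMap ha hh hb)
  have := ((((hasDerivAt_id (x 0)).smul_const (h (x 1))).const_add (a (x 1))).const_smul
    (1 - x 3)).sub_const (x 3 • b (x 2))
  simpa [joinMap] using this

lemma pderiv4_joinMap_one {a h b : ℝ → R4} (ha : IsLoop a) (hh : IsLoop h) (hb : IsLoop b)
    (x : Fin 4 → ℝ) : pderiv4 (joinMap a h b) 1 x =
    (1 - x 3) • (deriv a (x 1) + x 0 • deriv h (x 1)) := by
  apply pderiv4_eq_of_hasDerivAt (contDiff_joinMap ha hh hb)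
  have := ((((ha.hasDerivAt (x 1)).add ((hh.hasDerivAt (x 1)).const_smul (x 0)))).const_smul
    (1 - x 3)).sub_const (x 3 • b (x 2))
  simpa [joinMap] using this

lemma pderiv4_joinMap_two {a h b : ℝ → R4} (ha : IsLoop a) (hh : IsLoop h) (hb : IsLoop b)
    (x : Fin 4 → ℝ) : pderiv4 (joinMap a h b) 2 x = - (x 3 • deriv b (x 2)) := by
  apply pderiv4_eq_of_hasDerivAt (contDiff_joinMap ha hh hb)
  have := ((hb.hasDerivAt (x 2)).const_smul (x 3)).const_sub
    ((1 - x 3) • (a (x 1) + x 0 • h (x 1)))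
  simpa [joinMap] using this

lemma pderiv4_joinMap_three {a h b : ℝ → R4} (ha : IsLoop a) (hh : IsLoop h) (hb : IsLoop b)
    (x : Fin 4 → ℝ) : pderiv4 (joinMap a h b) 3 x =
    - (a (x 1) + x 0 • h (x 1)) - b (x 2) := by
  apply pderiv4_eq_of_hasDerivAt (contDiff_joinMap ha hh hb)
  have := (((hasDerivAt_id (x 3)).const_sub 1).smul_const (a (x 1) + x 0 • h (x 1))).sub
    ((hasDerivAt_id (x 3)).smul_const (b (x 2)))
  refine this.congr_deriv ?_ |>.congr_of_eventuallyEq (Eventually.of_forall fun t => ?_)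
  · simp [add_comm]
  · simp [joinMap]

/-- The integrand of the linking integral over the join. -/
noncomputable def joinIntegrand (a b : ℝ → R4) (x : Fin 3 → ℝ) : ℝ :=
  det4 (a (x 0)) (deriv a (x 0)) (b (x 1)) (deriv b (x 1)) *
    (x 2 * (1 - x 2) / ‖(1 - x 2) • a (x 0) - x 2 • b (x 1)‖ ^ 4)

/-- Stokes on the box of points `(τ, s, t, u)`: the `s`- and `t`-faces cancel by periodicity, the
`u`-faces contribute nothing, and the two `τ`-faces are the two integrals to be compared. -/
lemma setIntegral_joinIntegrand_add {a h b : ℝ → R4} (ha : IsLoop a) (hh : IsLoop h)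
    (hb : IsLoop b) (hab : ∀ τ ∈ Icc (0 : ℝ) 1, RayDisjoint (fun s => a s + τ • h s) b) :
    ∫ x in Icc (0 : Fin 3 → ℝ) ![2 * Real.pi, 2 * Real.pi, 1],
        joinIntegrand (fun s => a s + h s) b x =
      ∫ x in Icc (0 : Fin 3 → ℝ) ![2 * Real.pi, 2 * Real.pi, 1], joinIntegrand a b x := by
  have hpi := Real.pi_pos
  have hle : (0 : Fin 4 → ℝ) ≤ ![1, 2 * Real.pi, 2 * Real.pi, 1] := by
    intro i
    fin_cases i <;> simp <;> positivity
  have key := integral_faces_pullbackField (contDiff_joinMap ha hh hb) hle (fun x hx => by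
    have h0 := hx.1 0; have h1 := hx.2 0; have h2 := hx.1 3; have h3 := hx.2 3
    simp at h0 h1 h2 h3
    exact sub_ne_zero.2 (hab (x 0) ⟨h0, h1⟩ (x 1) (x 2) (x 3) ⟨h2, h3⟩))
  have p0 := pderiv4_joinMap_zero ha hh hb
  have p1 := pderiv4_joinMap_one ha hh hb
  have p2 := pderiv4_joinMap_two ha hh hb
  have p3 := pderiv4_joinMap_three ha hh hb
  have s00 : (0 : Fin 4).succAbove 0 = 1 := rfl
  have s01 : (0 : Fin 4).succAbove 1 = 2 := rfl
  have s02 : (0 : Fin 4).succAbove 2 = 3 := rfl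
  have s10 : (1 : Fin 4).succAbove 0 = 0 := rfl
  have s11 : (1 : Fin 4).succAbove 1 = 2 := rfl
  have s12 : (1 : Fin 4).succAbove 2 = 3 := rfl
  have s20 : (2 : Fin 4).succAbove 0 = 0 := rfl
  have s21 : (2 : Fin 4).succAbove 1 = 1 := rfl
  have s22 : (2 : Fin 4).succAbove 2 = 3 := rfl
  have s30 : (3 : Fin 4).succAbove 0 = 0 := rfl
  have s31 : (3 : Fin 4).succAbove 1 = 1 := rfl
  have s32 : (3 : Fin 4).succAbove 2 = 2 := rfl
  have hper : ∀ {f : ℝ → R4}, Function.Periodic f (2 * Real.pi) → f (2 * Real.pi) = f 0 :=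
    fun hf => by simpa using hf 0
  have i1 : ∀ c : ℝ, ∀ x : Fin 3 → ℝ, (1 : Fin 4).insertNth (α := fun _ => ℝ) c x =
      ![x 0, c, x 1, x 2] := by
    intro c x; ext j; fin_cases j <;> rfl
  have i2 : ∀ c : ℝ, ∀ x : Fin 3 → ℝ, (2 : Fin 4).insertNth (α := fun _ => ℝ) c x =
      ![x 0, x 1, c, x 2] := by
    intro c x; ext j; fin_cases j <;> rfl
  have i3 : ∀ c : ℝ, ∀ x : Fin 3 → ℝ, (3 : Fin 4).insertNth (α := fun _ => ℝ) c x =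
      ![x 0, x 1, x 2, c] := by
    intro c x; ext j; fin_cases j <;> rfl
  have i0 : ∀ c : ℝ, ∀ x : Fin 3 → ℝ, (0 : Fin 4).insertNth (α := fun _ => ℝ) c x =
      ![c, x 0, x 1, x 2] := by
    intro c x; ext j; fin_cases j <;> rfl
  -- Only derivatives in the other variables occur on a face, so the periodicity of the curves is
  -- enough and that of their derivatives is not needed.
  have f1 : ∀ x : Fin 3 → ℝ, pullbackField (joinMap a h b) 1 ![x 0, 2 * Real.pi, x 1, x 2] =
      pullbackField (joinMap a h b) 1 ![x 0, 0, x 1, x 2] := by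
    intro x
    simp [pullbackField, s10, s11, s12, p0, p2, p3, joinMap, hper ha.periodic,
      hper hh.periodic]
  have f2 : ∀ x : Fin 3 → ℝ, pullbackField (joinMap a h b) 2 ![x 0, x 1, 2 * Real.pi, x 2] =
      pullbackField (joinMap a h b) 2 ![x 0, x 1, 0, x 2] := by
    intro x
    simp [pullbackField, s20, s21, s22, p0, p1, p3, joinMap, hper hb.periodic]
  -- The join degenerates at its ends: the `τ`-derivative vanishes at `u = 1` and the `t`-derivative
  -- at `u = 0`.
  have f3 : ∀ x : Fin 3 → ℝ, pullbackField (joinMap a h b) 3 ![x 0, x 1, x 2, 1] =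
      pullbackField (joinMap a h b) 3 ![x 0, x 1, x 2, 0] := by
    intro x
    have z1 : ∀ v w z, det4 v 0 w z = 0 := fun v w z => by simp [det4_eq]
    have z2 : ∀ v w z, det4 v w z 0 = 0 := fun v w z => by simp [det4_eq]
    simp [pullbackField, s30, s31, s32, p0, p1, p2, z1, z2]
  have f0 : ∀ (τ : ℝ) (x : Fin 3 → ℝ), pullbackField (joinMap a h b) 0 ![τ, x 0, x 1, x 2] =
      - joinIntegrand (fun s => a s + τ • h s) b x := by
    intro τ x
    have hd : deriv (fun s => a s + τ • h s) (x 0) = deriv a (x 0) + τ • deriv h (x 0) :=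
      ((ha.hasDerivAt _).add ((hh.hasDerivAt _).const_smul τ)).deriv
    simp only [pullbackField, s00, s01, s02, p1, p2, p3, joinMap, joinIntegrand, hd]
    simp only [Fin.isValue, Matrix.cons_val, Matrix.cons_val_zero, Matrix.cons_val_one]
    generalize a (x 0) + τ • h (x 0) = A
    generalize deriv a (x 0) + τ • deriv h (x 0) = A'
    -- Expanding gives two nonzero terms, with coefficients `-u (1 - u) (1 - u)` and `-u (1 - u) u`,
    -- whose sum is `-u (1 - u)`.
    have : det4 ((1 - x 2) • A - x 2 • b (x 1)) ((1 - x 2) • A') (-(x 2 • deriv b (x 1)))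
        (-A - b (x 1)) = - (x 2 * (1 - x 2)) * det4 A A' (b (x 1)) (deriv b (x 1)) := by
      simp only [det4_eq, PiLp.sub_apply, PiLp.smul_apply, PiLp.neg_apply, smul_eq_mul]
      ring
    rw [this]
    simp only [Fin.val_zero, pow_zero]
    rw [div_eq_mul_inv, ← pow_mul]
    ring
  simp only [Fin.sum_univ_four, i0, i1, i2, i3] at key
  simp only [Matrix.cons_val_zero, Matrix.cons_val_one, Matrix.cons_val, Pi.zero_apply,
    f1, f2, f3, f0, sub_self, add_zero, MeasureTheory.integral_neg, one_smul, zero_smul] at key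
  have e1 : (0 : Fin 4 → ℝ) ∘ Fin.succAbove 0 = 0 := rfl
  have e2 : (![1, 2 * Real.pi, 2 * Real.pi, 1] : Fin 4 → ℝ) ∘ Fin.succAbove 0 =
      ![2 * Real.pi, 2 * Real.pi, 1] := by
    ext j; fin_cases j <;> rfl
  rw [e1, e2] at key
  linarith

/-! ### The Gauss integral as an integral over a box -/

lemma setIntegral_Icc_fin_succ {n : ℕ} (a b : Fin (n + 1) → ℝ) (f : (Fin (n + 1) → ℝ) → ℝ)
    (hf : MeasureTheory.IntegrableOn f (Icc a b)) :
    ∫ x in Icc a b, f x = ∫ t in Icc (a 0) (b 0),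
      ∫ x in Icc (fun i : Fin n => a i.succ) (fun i => b i.succ), f (Fin.cons t x) := by
  have hm := (MeasureTheory.volume_preserving_piFinSuccAbove (fun _ : Fin (n + 1) => ℝ) 0).symm
  have hpre : (MeasurableEquiv.piFinSuccAbove (fun _ : Fin (n + 1) => ℝ) 0).symm ⁻¹' Icc a b =
      Icc (a 0) (b 0) ×ˢ Icc (fun i : Fin n => a i.succ) (fun i => b i.succ) := by
    ext ⟨t, x⟩
    simp [MeasurableEquiv.piFinSuccAbove, Pi.le_def, Fin.forall_fin_succ]
  rw [← hm.setIntegral_preimage_emb (MeasurableEquiv.measurableEmbedding _), hpre]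
  have hf' := (hm.integrableOn_comp_preimage (MeasurableEquiv.measurableEmbedding _)
    (f := f) (s := Icc a b)).2 hf
  rw [hpre] at hf'
  rw [MeasureTheory.Measure.volume_eq_prod, MeasureTheory.setIntegral_prod]
  · simp [MeasurableEquiv.piFinSuccAbove, Fin.insertNthEquiv]
  · exact hf'

lemma setIntegral_Icc_fin_three (b : Fin 3 → ℝ) (hb : 0 ≤ b) (f : (Fin 3 → ℝ) → ℝ)
    (hf : ContinuousOn f (Icc 0 b)) :
    ∫ x in Icc 0 b, f x = ∫ s in (0 : ℝ)..(b 0), ∫ t in (0 : ℝ)..(b 1), ∫ u in (0 : ℝ)..(b 2),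
      f ![s, t, u] := by
  have h0 := hb 0
  have h1 := hb 1
  have h2 := hb 2
  simp only [Pi.zero_apply] at h0 h1 h2
  rw [setIntegral_Icc_fin_succ _ _ _ (hf.integrableOn_compact isCompact_Icc),
    intervalIntegral.integral_of_le h0, MeasureTheory.integral_Icc_eq_integral_Ioc]
  refine MeasureTheory.setIntegral_congr_fun measurableSet_Ioc fun s hs => ?_
  have hs' : 0 ≤ s ∧ s ≤ b 0 := ⟨hs.1.le, hs.2⟩
  have c1 : ContinuousOn (fun x : Fin 2 → ℝ => f (Fin.cons s x))
      (Icc (fun i => (0 : Fin 3 → ℝ) i.succ) (fun i => b i.succ)) := by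
    refine hf.comp (by fun_prop) fun x hx => ?_
    simp only [mem_Icc, Pi.le_def, Fin.forall_fin_succ (n := 2), Fin.cons_zero, Fin.cons_succ,
      Pi.zero_apply]
    exact ⟨⟨hs'.1, hx.1⟩, ⟨hs'.2, hx.2⟩⟩
  rw [setIntegral_Icc_fin_succ _ _ _ (c1.integrableOn_compact isCompact_Icc),
    intervalIntegral.integral_of_le h1]
  refine MeasureTheory.integral_Icc_eq_integral_Ioc.trans ?_
  refine MeasureTheory.setIntegral_congr_fun measurableSet_Ioc fun t ht => ?_
  have ht' : 0 ≤ t ∧ t ≤ b 1 := ⟨ht.1.le, ht.2⟩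
  have c2 : ContinuousOn (fun x : Fin 1 → ℝ => f (Fin.cons s (Fin.cons t x)))
      (Icc (fun i : Fin 1 => (0 : Fin 3 → ℝ) i.succ.succ) (fun i => b i.succ.succ)) := by
    refine c1.comp (by fun_prop) fun x hx => ?_
    simp only [mem_Icc, Pi.le_def, Fin.forall_fin_succ (n := 1), Fin.cons_zero, Fin.cons_succ,
      Pi.zero_apply]
    exact ⟨⟨ht'.1, hx.1⟩, ⟨ht'.2, hx.2⟩⟩
  rw [setIntegral_Icc_fin_succ _ _ _ (c2.integrableOn_compact isCompact_Icc),
    intervalIntegral.integral_of_le h2]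
  refine MeasureTheory.integral_Icc_eq_integral_Ioc.trans ?_
  refine MeasureTheory.setIntegral_congr_fun measurableSet_Ioc fun u hu => ?_
  have hIcc : Icc (fun i : Fin 0 => (0 : Fin 3 → ℝ) i.succ.succ.succ)
      (fun i => b i.succ.succ.succ) = univ := by
    ext x
    simp
  rw [hIcc, MeasureTheory.Measure.restrict_univ,
    MeasureTheory.Measure.volume_pi_eq_dirac (x := Fin.elim0), MeasureTheory.integral_dirac]
  congr 1

lemma continuousOn_joinIntegrand {a b : ℝ → R4} (ha : IsLoop a) (hb : IsLoop b)
    (hab : RayDisjoint a b) (c : Fin 3 → ℝ) (hc : c 2 = 1) :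
    ContinuousOn (joinIntegrand a b) (Icc 0 c) := by
  have ca := ha.contDiff.continuous
  have cb := hb.contDiff.continuous
  have hdet : Continuous fun x : Fin 3 → ℝ =>
      det4 (a (x 0)) (deriv a (x 0)) (b (x 1)) (deriv b (x 1)) := by
    have ca' := ha.continuous_deriv
    have cb' := hb.continuous_deriv
    simp only [det4_eq]
    fun_prop
  refine hdet.continuousOn.mul (ContinuousOn.div (by fun_prop) (by fun_prop) fun x hx => ?_)
  have h1 := hx.2 2
  rw [hc] at h1
  exact pow_ne_zero 4 (norm_ne_zero_iff.2 (sub_ne_zero.2 (hab _ _ _ ⟨hx.1 2, h1⟩)))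

lemma linkingNumber_eq {a b : ℝ → R4} (ha : IsLoop a) (hb : IsLoop b) (hab : RayDisjoint a b) :
    linkingNumber a b = 1 / (2 * Real.pi ^ 2) *
      ∫ x in Icc (0 : Fin 3 → ℝ) ![2 * Real.pi, 2 * Real.pi, 1], joinIntegrand a b x := by
  have hpi := Real.pi_pos
  have hle : (0 : Fin 3 → ℝ) ≤ ![2 * Real.pi, 2 * Real.pi, 1] := by
    intro i
    fin_cases i <;> simp <;> positivity
  rw [setIntegral_Icc_fin_three _ hle _ (continuousOn_joinIntegrand ha hb hab _ rfl)]
  simp only [linkingNumber, linkingKernel_eq, joinIntegrand, intervalIntegral.integral_const_mul,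
    Matrix.cons_val_zero, Matrix.cons_val_one, Matrix.cons_val]

/-- Homotopy invariance of the linking number, for straight-line homotopies. -/
theorem linkingNumber_add_left {a h b : ℝ → R4} (ha : IsLoop a) (hh : IsLoop h) (hb : IsLoop b)
    (hab : ∀ τ ∈ Icc (0 : ℝ) 1, RayDisjoint (fun s => a s + τ • h s) b) :
    linkingNumber (fun s => a s + h s) b = linkingNumber a b := by
  have h0 := hab 0 (by simp)
  have h1 := hab 1 (by simp)
  simp only [zero_smul, add_zero, one_smul] at h0 h1
  have hah : IsLoop (fun s => a s + h s) :=
    ⟨ha.contDiff.add hh.contDiff, ha.periodic.add hh.periodic⟩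
  rw [linkingNumber_eq ha hb h0, linkingNumber_eq hah hb h1,
    setIntegral_joinIntegrand_add ha hh hb hab]

lemma RayDisjoint.continuous_linkingKernel {a b : ℝ → R4} (ha : Continuous a) (hb : Continuous b)
    (hab : RayDisjoint a b) : Continuous fun p : ℝ × ℝ => linkingKernel (a p.1) (b p.2) := by
  -- Clamping `u` to `[0, 1]` makes the integrand continuous on all of `ℝ`, since ray-disjointness
  -- controls the denominator only on that interval.
  obtain ⟨c, hcc, hcI, hc⟩ : ∃ c : ℝ → ℝ, Continuous c ∧ (∀ u, c u ∈ Icc (0 : ℝ) 1) ∧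
      ∀ u ∈ Icc (0 : ℝ) 1, c u = u :=
    ⟨fun u => max 0 (min 1 u), by fun_prop,
      fun u => ⟨le_max_left _ _, max_le zero_le_one (min_le_left _ _)⟩,
      fun u hu => by simp [hu.1, hu.2]⟩
  have h : Continuous (Function.uncurry fun (p : ℝ × ℝ) (u : ℝ) => c u * (1 - c u) /
      ‖(1 - c u) • a p.1 - c u • b p.2‖ ^ 4) := by
    refine Continuous.div (f := fun q : (ℝ × ℝ) × ℝ => c q.2 * (1 - c q.2))
      (g := fun q => ‖(1 - c q.2) • a q.1.1 - c q.2 • b q.1.2‖ ^ 4)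
      (by fun_prop) (by fun_prop) fun q => ?_
    exact pow_ne_zero 4 (norm_ne_zero_iff.2 (sub_ne_zero.2 (hab _ _ _ (hcI _))))
  have h2 := intervalIntegral.continuous_parametric_intervalIntegral_of_continuous'
    (μ := MeasureTheory.volume) h 0 1
  convert h2 using 2 with p
  rw [linkingKernel_eq]
  refine intervalIntegral.integral_congr fun u hu => ?_
  rw [uIcc_of_le zero_le_one] at hu
  simp only [hc u hu]

/-- Exchanging the two pairs of columns is an even permutation and the kernel is symmetric, so
Fubini suffices; ray-disjointness provides the integrability. -/
lemma linkingNumber_comm {a b : ℝ → R4} (ha : IsLoop a) (hb : IsLoop b) (hab : RayDisjoint a b) :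
    linkingNumber a b = linkingNumber b a := by
  have hk := hab.continuous_linkingKernel ha.contDiff.continuous hb.contDiff.continuous
  have ca := ha.contDiff.continuous
  have cb := hb.contDiff.continuous
  have ca' := ha.continuous_deriv
  have cb' := hb.continuous_deriv
  have hdet : Continuous fun x : ℝ × ℝ =>
      det4 (a x.1) (deriv a x.1) (b x.2) (deriv b x.2) := by
    simp only [det4_eq]
    fun_prop
  unfold linkingNumber
  congr 1
  rw [MeasureTheory.intervalIntegral_intervalIntegral_swap]
  swap
  · exact (hdet.mul hk).continuousOn.integrableOn_compact (isCompact_uIcc.prod isCompact_uIcc)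
      |>.mono_set (prod_mono uIoc_subset_uIcc uIoc_subset_uIcc)
  have hd : ∀ s t, det4 (a s) (deriv a s) (b t) (deriv b t) =
      det4 (b t) (deriv b t) (a s) (deriv a s) := fun s t => by simp only [det4_eq]; ring
  simp only [hd, fun s t => linkingKernel_comm (a s) (b t)]

theorem linkingNumber_add_right {a h b : ℝ → R4} (ha : IsLoop a) (hh : IsLoop h) (hb : IsLoop b)
    (hab : ∀ τ ∈ Icc (0 : ℝ) 1, RayDisjoint b (fun s => a s + τ • h s)) :
    linkingNumber b (fun s => a s + h s) = linkingNumber b a := by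
  have h0 := hab 0 (by simp)
  have h1 := hab 1 (by simp)
  simp only [zero_smul, add_zero, one_smul] at h0 h1
  have hah : IsLoop (fun s => a s + h s) :=
    ⟨ha.contDiff.add hh.contDiff, ha.periodic.add hh.periodic⟩
  rw [linkingNumber_comm hb ha h0, linkingNumber_comm hb hah h1]
  exact linkingNumber_add_left ha hh hb fun τ hτ => (hab τ hτ).symm

/-! ### Local constancy of the linking number -/

lemma IsLoop.add {a b : ℝ → R4} (ha : IsLoop a) (hb : IsLoop b) : IsLoop fun t => a t + b t :=
  ⟨ha.contDiff.add hb.contDiff, ha.periodic.add hb.periodic⟩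

lemma IsLoop.sub {a b : ℝ → R4} (ha : IsLoop a) (hb : IsLoop b) : IsLoop fun t => a t - b t :=
  ⟨ha.contDiff.sub hb.contDiff, ha.periodic.sub hb.periodic⟩

lemma IsLoop.smul {a : ℝ → R4} (ha : IsLoop a) {l : ℝ → ℝ} (hl : ContDiff ℝ 2 l)
    (hp : Function.Periodic l (2 * Real.pi)) : IsLoop fun t => l t • a t :=
  ⟨hl.smul ha.contDiff, fun t => by simp only [hp t, ha.periodic t]⟩

lemma isLoop_const (x : R4) : IsLoop fun _ => x := ⟨contDiff_const, fun _ => rfl⟩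

/-- A positive rescaling of a curve does not change its cone: the weights `(1 - u) l` and `u` only
have to be renormalized to sum `1`. -/
lemma RayDisjoint.smul_left {a b : ℝ → R4} (h : RayDisjoint a b) {l : ℝ → ℝ}
    (hl : ∀ t, 0 < l t) : RayDisjoint (fun t => l t • a t) b := by
  intro s t u hu he
  have hls := hl s
  have hm : 0 < (1 - u) * l s + u := by
    rcases eq_or_lt_of_le hu.1 with h0 | h0
    · rw [← h0]; simpa using hls
    · have : 0 ≤ (1 - u) * l s := mul_nonneg (by linarith [hu.2]) hls.le
      linarith
  refine h s t (u / ((1 - u) * l s + u)) ⟨div_nonneg hu.1 hm.le, ?_⟩ ?_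
  · rw [div_le_one hm]
    have : 0 ≤ (1 - u) * l s := mul_nonneg (by linarith [hu.2]) hls.le
    linarith
  · have h1 : 1 - u / ((1 - u) * l s + u) = ((1 - u) * l s + u)⁻¹ * ((1 - u) * l s) := by
      field_simp; ring
    rw [h1, div_eq_inv_mul, mul_smul, mul_smul, mul_smul, ← he]

lemma RayDisjoint.smul_right {a b : ℝ → R4} (h : RayDisjoint a b) {l : ℝ → ℝ}
    (hl : ∀ t, 0 < l t) : RayDisjoint a (fun t => l t • b t) :=
  (h.symm.smul_left hl).symm

lemma linkingNumber_eq_of_segment_left {a a' b : ℝ → R4} (ha : IsLoop a) (ha' : IsLoop a')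
    (hb : IsLoop b) (hab : ∀ τ ∈ Icc (0 : ℝ) 1, RayDisjoint (fun s => a s + τ • (a' s - a s)) b) :
    linkingNumber a' b = linkingNumber a b := by
  simpa using linkingNumber_add_left ha (ha'.sub ha) hb hab

lemma linkingNumber_eq_of_segment_right {a a' b : ℝ → R4} (ha : IsLoop a) (ha' : IsLoop a')
    (hb : IsLoop b) (hab : ∀ τ ∈ Icc (0 : ℝ) 1, RayDisjoint b (fun s => a s + τ • (a' s - a s))) :
    linkingNumber b a' = linkingNumber b a := by
  simpa using linkingNumber_add_right ha (ha'.sub ha) hb hab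

lemma linkingNumber_smul_right {a b : ℝ → R4} (ha : IsLoop a) (hb : IsLoop b)
    (h : RayDisjoint a b) {l : ℝ → ℝ} (hl : ContDiff ℝ 2 l)
    (hp : Function.Periodic l (2 * Real.pi)) (hpos : ∀ t, 0 < l t) :
    linkingNumber a (fun t => l t • b t) = linkingNumber a b := by
  refine linkingNumber_eq_of_segment_right hb (hb.smul hl hp) ha fun τ hτ => ?_
  have : (fun s => b s + τ • (l s • b s - b s)) = fun s => ((1 - τ) + τ * l s) • b s := by
    ext1 s; module
  rw [this]
  refine h.smul_right fun t => ?_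
  have := hpos t
  rcases eq_or_lt_of_le hτ.1 with h0 | h0
  · rw [← h0]; simp
  · have := mul_pos h0 this
    linarith [hτ.2]

lemma linkingNumber_smul_left {a b : ℝ → R4} (ha : IsLoop a) (hb : IsLoop b)
    (h : RayDisjoint a b) {l : ℝ → ℝ} (hl : ContDiff ℝ 2 l)
    (hp : Function.Periodic l (2 * Real.pi)) (hpos : ∀ t, 0 < l t) :
    linkingNumber (fun t => l t • a t) b = linkingNumber a b := by
  rw [linkingNumber_comm (ha.smul hl hp) hb (h.smul_left hpos), linkingNumber_comm ha hb h]
  exact linkingNumber_smul_right hb ha h.symm hl hp hpos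

/-- A convex combination of two displacements of size less than `κ` cannot close a gap of size `κ`.
Hence both curves can be moved along segments, one after the other. -/
lemma linkingNumber_eq_of_close {a b a' b' : ℝ → R4} (ha : IsLoop a) (hb : IsLoop b)
    (ha' : IsLoop a') (hb' : IsLoop b') {κ : ℝ}
    (hκ : ∀ s t : ℝ, ∀ u ∈ Icc (0 : ℝ) 1, κ ≤ ‖(1 - u) • a s - u • b t‖)
    (hca : ∀ s, ‖a' s - a s‖ < κ) (hcb : ∀ t, ‖b' t - b t‖ < κ) :
    RayDisjoint a' b' ∧ linkingNumber a' b' = linkingNumber a b := by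
  have key : ∀ τ ∈ Icc (0 : ℝ) 1, ∀ σ ∈ Icc (0 : ℝ) 1,
      RayDisjoint (fun s => a s + τ • (a' s - a s)) (fun s => b s + σ • (b' s - b s)) := by
    intro τ hτ σ hσ s t u hu he
    have h1 := hκ s t u hu
    have h2 : (1 - u) • a s - u • b t =
        u • σ • (b' t - b t) - (1 - u) • τ • (a' s - a s) := by
      have := sub_eq_zero.2 he
      rw [← sub_eq_zero, ← this]
      module
    rw [h2] at h1
    have hA : ‖τ • (a' s - a s)‖ < κ := by
      rw [norm_smul, Real.norm_of_nonneg hτ.1]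
      exact (mul_le_of_le_one_left (norm_nonneg _) hτ.2).trans_lt (hca s)
    have hB : ‖σ • (b' t - b t)‖ < κ := by
      rw [norm_smul, Real.norm_of_nonneg hσ.1]
      exact (mul_le_of_le_one_left (norm_nonneg _) hσ.2).trans_lt (hcb t)
    have h3 := norm_sub_le (u • σ • (b' t - b t)) ((1 - u) • τ • (a' s - a s))
    rw [norm_smul u, norm_smul (1 - u), Real.norm_of_nonneg hu.1,
      Real.norm_of_nonneg (sub_nonneg.2 hu.2)] at h3
    -- For `u = 0` the strict inequality comes from the displacement of `a`, otherwise from that of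
    -- `b`.
    rcases eq_or_lt_of_le hu.1 with h0 | h0
    · rw [← h0] at h3 h1
      simp only [zero_mul, sub_zero, one_mul, zero_add] at h1 h3
      linarith
    · have := mul_lt_mul_of_pos_left hB h0
      have := mul_le_mul_of_nonneg_left hA.le (sub_nonneg.2 hu.2)
      linarith
  have h11 := key 1 (by simp) 1 (by simp)
  simp only [one_smul, add_sub_cancel] at h11
  refine ⟨h11, ?_⟩
  have e1 : linkingNumber a' b' = linkingNumber a' b :=
    linkingNumber_eq_of_segment_right hb hb' ha' fun σ hσ => by
      simpa using key 1 (by simp) σ hσ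
  rw [e1]
  exact linkingNumber_eq_of_segment_left ha ha' hb fun τ hτ => by
    simpa using key τ hτ 0 (by simp)

lemma RayDisjoint.exists_bound {a b : ℝ → R4} (ha : IsLoop a) (hb : IsLoop b)
    (h : RayDisjoint a b) :
    ∃ κ > 0, ∀ s t : ℝ, ∀ u ∈ Icc (0 : ℝ) 1, κ ≤ ‖(1 - u) • a s - u • b t‖ := by
  have ca := ha.contDiff.continuous
  have cb := hb.contDiff.continuous
  have hK : IsCompact (Icc (0 : ℝ) (2 * Real.pi) ×ˢ Icc (0 : ℝ) (2 * Real.pi) ×ˢ Icc (0 : ℝ) 1) :=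
    isCompact_Icc.prod (isCompact_Icc.prod isCompact_Icc)
  have hc : Continuous fun p : ℝ × ℝ × ℝ => ‖(1 - p.2.2) • a p.1 - p.2.2 • b p.2.1‖ := by
    fun_prop
  obtain ⟨p, hp, hmin⟩ := hK.exists_isMinOn
    ⟨(0, 0, 0), by simp [Real.pi_pos.le]⟩ hc.continuousOn
  refine ⟨_, norm_pos_iff.2 (sub_ne_zero.2 (h p.1 p.2.1 p.2.2 hp.2.2)), fun s t u hu => ?_⟩
  obtain ⟨s', hs', hse⟩ := ha.periodic.exists_mem_Ico₀ (by positivity) s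
  obtain ⟨t', ht', hte⟩ := hb.periodic.exists_mem_Ico₀ (by positivity) t
  rw [hse, hte]
  exact hmin (a := (s', t', u)) ⟨Ico_subset_Icc_self hs', Ico_subset_Icc_self ht', hu⟩

lemma eventually_forall_norm_sub_lt {X : Type*} [TopologicalSpace X] {A : X → ℝ → R4} {x₀ : X}
    (hA : ∀ s, ContinuousAt (Function.uncurry A) (x₀, s))
    (hl : ∀ᶠ x in 𝓝 x₀, IsLoop (A x)) {κ : ℝ} (hκ : 0 < κ) :
    ∀ᶠ x in 𝓝 x₀, ∀ s, ‖A x s - A x₀ s‖ < κ := by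
  have hx₀ : IsLoop (A x₀) := hl.self_of_nhds
  have h1 : ∀ᶠ x in 𝓝 x₀, ∀ s ∈ Icc (0 : ℝ) (2 * Real.pi), ‖A x s - A x₀ s‖ < κ := by
    refine isCompact_Icc.eventually_forall_of_forall_eventually fun s _ => ?_
    have c1 : ContinuousAt (fun p : X × ℝ => ‖A p.1 p.2 - A x₀ p.2‖) (x₀, s) :=
      ((hA s).sub (hx₀.contDiff.continuous.continuousAt.comp continuousAt_snd)).norm
    exact c1.eventually_lt continuousAt_const (by simpa using hκ)
  filter_upwards [h1, hl] with x hx hlx s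
  obtain ⟨s', hs', hse⟩ := (hlx.sub hx₀).periodic.exists_mem_Ico₀ (by positivity) s
  rw [hse]
  exact hx s' (Ico_subset_Icc_self hs')

/-- The linking number is locally constant in continuous families of loops. -/
theorem eventually_linkingNumber_eq {X : Type*} [TopologicalSpace X] {A B : X → ℝ → R4} {x₀ : X}
    (hA : ∀ s, ContinuousAt (Function.uncurry A) (x₀, s))
    (hB : ∀ s, ContinuousAt (Function.uncurry B) (x₀, s))
    (hAl : ∀ᶠ x in 𝓝 x₀, IsLoop (A x)) (hBl : ∀ᶠ x in 𝓝 x₀, IsLoop (B x))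
    (h : RayDisjoint (A x₀) (B x₀)) :
    ∀ᶠ x in 𝓝 x₀, linkingNumber (A x) (B x) = linkingNumber (A x₀) (B x₀) := by
  obtain ⟨κ, hκ, hb⟩ := h.exists_bound hAl.self_of_nhds hBl.self_of_nhds
  filter_upwards [hAl, hBl, eventually_forall_norm_sub_lt hA hAl hκ,
    eventually_forall_norm_sub_lt hB hBl hκ] with x h1 h2 h3 h4
  exact (linkingNumber_eq_of_close hAl.self_of_nhds hBl.self_of_nhds h1 h2 hb h3 h4).2

lemma IsPreconnected.eq_of_eventually_eq {X Y : Type*} [TopologicalSpace X] {s : Set X}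
    (hs : IsPreconnected s) {f : X → Y} (hf : ∀ x ∈ s, ∀ᶠ y in 𝓝 x, f y = f x) {x y : X}
    (hx : x ∈ s) (hy : y ∈ s) : f x = f y :=
  hs.induction₂ (fun x y => f x = f y)
    (fun x hx => ((hf x hx).filter_mono nhdsWithin_le_nhds).mono fun _ h => h.symm)
    (fun _ _ _ _ _ _ h1 h2 => h1.trans h2) (fun _ _ _ _ h => h.symm) hx hy

/-! ### The linking number of circles in transverse planes -/

/-- The unit circle of the plane with orthonormal basis `(u, v)`, covered `N` times. -/
noncomputable def planeCircle (N : ℕ) (u v : R4) (t : ℝ) : R4 :=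
  Real.cos (N * t) • u + Real.sin (N * t) • v

lemma isLoop_planeCircle (N : ℕ) (u v : R4) : IsLoop (planeCircle N u v) := by
  constructor
  · unfold planeCircle
    fun_prop
  · intro t
    have h : (N : ℝ) * (t + 2 * Real.pi) = N * t + N * (2 * Real.pi) := by ring
    simp only [planeCircle, h, Real.cos_add_nat_mul_two_pi, Real.sin_add_nat_mul_two_pi]

lemma hasDerivAt_planeCircle (N : ℕ) (u v : R4) (t : ℝ) :
    HasDerivAt (planeCircle N u v)
      ((-(N * Real.sin (N * t))) • u + (N * Real.cos (N * t)) • v) t := by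
  have h : HasDerivAt (fun t : ℝ => (N : ℝ) * t) N t := by
    simpa using (hasDerivAt_id t).const_mul (N : ℝ)
  have := (h.cos.smul_const u).add (h.sin.smul_const v)
  refine this.congr_deriv ?_
  congr 2 <;> ring

/-- Cramer's rule: replacing a column by the vanishing combination multiplies the determinant by the
coefficient of that column. -/
lemma eq_zero_of_det4_ne_zero {u v u' v' : R4} (h : det4 u v u' v' ≠ 0) {α β γ δ : ℝ}
    (he : α • u + β • v = γ • u' + δ • v') : α = 0 ∧ β = 0 ∧ γ = 0 ∧ δ = 0 := by
  have h0 : α • u + β • v - γ • u' - δ • v' = 0 := by rw [he]; module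
  have hc : ∀ i, α * u i + β * v i - γ * u' i - δ * v' i = 0 := fun i => by
    have := congrArg (fun x : R4 => x i) h0
    simpa using this
  have d1 : α * det4 u v u' v' = det4 (α • u + β • v - γ • u' - δ • v') v u' v' := by
    simp only [det4_eq, PiLp.sub_apply, PiLp.add_apply, PiLp.smul_apply, smul_eq_mul]; ring
  have d2 : β * det4 u v u' v' = det4 u (α • u + β • v - γ • u' - δ • v') u' v' := by
    simp only [det4_eq, PiLp.sub_apply, PiLp.add_apply, PiLp.smul_apply, smul_eq_mul]; ring
  have d3 : -γ * det4 u v u' v' = det4 u v (α • u + β • v - γ • u' - δ • v') v' := by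
    simp only [det4_eq, PiLp.sub_apply, PiLp.add_apply, PiLp.smul_apply, smul_eq_mul]; ring
  have d4 : -δ * det4 u v u' v' = det4 u v u' (α • u + β • v - γ • u' - δ • v') := by
    simp only [det4_eq, PiLp.sub_apply, PiLp.add_apply, PiLp.smul_apply, smul_eq_mul]; ring
  rw [h0] at d1 d2 d3 d4
  have z1 : det4 0 v u' v' = 0 := by simp [det4_eq]
  have z2 : det4 u 0 u' v' = 0 := by simp [det4_eq]
  have z3 : det4 u v 0 v' = 0 := by simp [det4_eq]
  have z4 : det4 u v u' 0 = 0 := by simp [det4_eq]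
  rw [z1] at d1
  rw [z2] at d2
  rw [z3] at d3
  rw [z4] at d4
  simpa [h] using And.intro d1 (And.intro d2 (And.intro d3 d4))

/-- Transverse planes meet only at the origin, so a common point would force both weights `1 - w`
and `w` to vanish, although their sum is `1`. -/
lemma rayDisjoint_planeCircle {u v u' v' : R4} (h : det4 u v u' v' ≠ 0) (N N' : ℕ) :
    RayDisjoint (planeCircle N u v) (planeCircle N' u' v') := by
  intro s t w _ he
  simp only [planeCircle, smul_add, smul_smul] at he
  obtain ⟨h1, h2, h3, h4⟩ := eq_zero_of_det4_ne_zero h he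
  have e1 := Real.sin_sq_add_cos_sq (N * s)
  have e2 := Real.sin_sq_add_cos_sq (N' * t)
  have f1 : (1 - w) ^ 2 = 0 := by
    linear_combination (1 - w) * Real.cos (N * s) * h1 + (1 - w) * Real.sin (N * s) * h2
      - (1 - w) ^ 2 * e1
  have f2 : w ^ 2 = 0 := by
    linear_combination w * Real.cos (N' * t) * h3 + w * Real.sin (N' * t) * h4 - w ^ 2 * e2
  have g1 := pow_eq_zero_iff (two_ne_zero) |>.1 f1
  have g2 := pow_eq_zero_iff (two_ne_zero) |>.1 f2
  linarith

lemma orthonormal_pair_iff {u v : R4} :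
    Orthonormal ℝ ![u, v] ↔ ‖u‖ = 1 ∧ ‖v‖ = 1 ∧ inner ℝ u v = 0 := by
  constructor
  · intro h
    exact ⟨h.1 0, h.1 1, h.2 (by decide : (0 : Fin 2) ≠ 1)⟩
  · rintro ⟨h1, h2, h3⟩
    rw [orthonormal_iff_ite]
    simp [Fin.forall_fin_two, h1, h2, h3, real_inner_comm u v]

lemma linkingKernel_of_orthonormal {a b : R4} (ha : ‖a‖ = 1) (hb : ‖b‖ = 1)
    (hab : inner ℝ a b = 0) : linkingKernel a b = 1 / 2 := by
  rw [linkingKernel_eq]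
  have hq : ∀ u : ℝ, 0 < (1 - u) ^ 2 + u ^ 2 := fun u => by nlinarith [sq_nonneg (2 * u - 1)]
  have hn : ∀ u : ℝ, ‖(1 - u) • a - u • b‖ ^ 4 = ((1 - u) ^ 2 + u ^ 2) ^ 2 := fun u => by
    have : ‖(1 - u) • a - u • b‖ ^ 2 = (1 - u) ^ 2 + u ^ 2 := by
      rw [norm_sub_sq_real, norm_smul, norm_smul, ha, hb, inner_smul_left, inner_smul_right, hab]
      simp
    rw [← this]; ring
  -- This is the primitive `-1 / (2 (1 + r ^ 2))` of `r / (1 + r ^ 2) ^ 2`, read in `r = u / (1 -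
  -- u)`.
  have hd : ∀ u ∈ uIcc (0 : ℝ) 1, HasDerivAt (fun u : ℝ => -((1 - u) ^ 2) / (2 * ((1 - u) ^ 2 + u ^ 2)))
      (u * (1 - u) / ((1 - u) ^ 2 + u ^ 2) ^ 2) u := fun u _ => by
    have h1 : HasDerivAt (fun u : ℝ => (1 - u) ^ 2) (-(2 * (1 - u))) u := by
      refine (((hasDerivAt_id u).const_sub 1).pow 2).congr_deriv ?_
      simp
    have h2 : HasDerivAt (fun u : ℝ => u ^ 2) (2 * u) u := by
      simpa using hasDerivAt_pow 2 u
    have hne := (hq u).ne'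
    refine (h1.neg.div ((h1.add h2).const_mul 2) (mul_ne_zero two_ne_zero hne)).congr_deriv ?_
    simp only [Pi.add_apply, Pi.neg_apply]
    field_simp
    ring
  simp only [hn]
  rw [intervalIntegral.integral_eq_sub_of_hasDerivAt hd]
  · norm_num
  · refine Continuous.intervalIntegrable ?_ _ _
    exact Continuous.div (by fun_prop) (by fun_prop) fun u => pow_ne_zero 2 (hq u).ne'

lemma det4_sq_of_orthonormal {a b c d : R4} (h : Orthonormal ℝ ![a, b, c, d]) :
    det4 a b c d ^ 2 = 1 := by
  have hM : (Matrix.of fun i j : Fin 4 => (![a, b, c, d] i) j) *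
      (Matrix.of fun i j : Fin 4 => (![a, b, c, d] i) j).transpose = 1 := by
    ext i j
    rw [orthonormal_iff_ite] at h
    have := h i j
    rw [inner_eq_coord] at this
    simp only [Matrix.mul_apply, Matrix.transpose_apply, Matrix.of_apply, Fin.sum_univ_four,
      Matrix.one_apply]
    exact this
  have := congrArg Matrix.det hM
  rw [Matrix.det_mul, Matrix.det_transpose, Matrix.det_one] at this
  rw [sq]
  exact this

lemma det4_rotate_left (a b p q : R4) (N S C : ℝ) :
    det4 (C • a + S • b) (-(N * S) • a + (N * C) • b) p q = N * (S ^ 2 + C ^ 2) * det4 a b p q := by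
  simp only [det4_eq, PiLp.add_apply, PiLp.smul_apply, smul_eq_mul]; ring

lemma det4_rotate_right (a b p q : R4) (N S C : ℝ) :
    det4 p q (C • a + S • b) (-(N * S) • a + (N * C) • b) = N * (S ^ 2 + C ^ 2) * det4 p q a b := by
  simp only [det4_eq, PiLp.add_apply, PiLp.smul_apply, smul_eq_mul]; ring

/-- The integrand is the constant `N N' det / 2`; the area `4π²` of the torus of parameters and the
factor `1 / (2π²)` absorb the `1 / 2`. -/
lemma linkingNumber_planeCircle_of_orthonormal {a b c d : R4} (h : Orthonormal ℝ ![a, b, c, d])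
    (N N' : ℕ) : linkingNumber (planeCircle N a b) (planeCircle N' c d) =
      N * N' * det4 a b c d := by
  have haa : ‖a‖ = 1 := h.1 0
  have hbb : ‖b‖ = 1 := h.1 1
  have hcc : ‖c‖ = 1 := h.1 2
  have hdd : ‖d‖ = 1 := h.1 3
  have hab : inner ℝ a b = 0 := h.2 (by decide : (0 : Fin 4) ≠ 1)
  have hac : inner ℝ a c = 0 := h.2 (by decide : (0 : Fin 4) ≠ 2)
  have had : inner ℝ a d = 0 := h.2 (by decide : (0 : Fin 4) ≠ 3)
  have hbc : inner ℝ b c = 0 := h.2 (by decide : (1 : Fin 4) ≠ 2)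
  have hbd : inner ℝ b d = 0 := h.2 (by decide : (1 : Fin 4) ≠ 3)
  have hcd : inner ℝ c d = 0 := h.2 (by decide : (2 : Fin 4) ≠ 3)
  have hnorm : ∀ {p q : R4}, ‖p‖ = 1 → ‖q‖ = 1 → inner ℝ p q = 0 → ∀ θ : ℝ,
      ‖Real.cos θ • p + Real.sin θ • q‖ = 1 := by
    intro p q hp hq hpq θ
    have : ‖Real.cos θ • p + Real.sin θ • q‖ ^ 2 = 1 := by
      rw [norm_add_sq_real, norm_smul, norm_smul, hp, hq, inner_smul_left, inner_smul_right, hpq]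
      simp
    nlinarith [norm_nonneg (Real.cos θ • p + Real.sin θ • q)]
  have hk : ∀ s t, linkingKernel (planeCircle N a b s) (planeCircle N' c d t) = 1 / 2 := fun s t =>
    linkingKernel_of_orthonormal (hnorm haa hbb hab _) (hnorm hcc hdd hcd _) (by
      simp [planeCircle, inner_add_left, inner_add_right, inner_smul_left, inner_smul_right,
        hac, had, hbc, hbd])
  have hdet : ∀ s t, det4 (planeCircle N a b s) (deriv (planeCircle N a b) s)
      (planeCircle N' c d t) (deriv (planeCircle N' c d) t) = N * N' * det4 a b c d := fun s t => by
    rw [(hasDerivAt_planeCircle N a b s).deriv, (hasDerivAt_planeCircle N' c d t).deriv]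
    have e1 := Real.sin_sq_add_cos_sq (N * s)
    have e2 := Real.sin_sq_add_cos_sq (N' * t)
    simp only [planeCircle]
    generalize Real.sin (N * s) = S at *
    generalize Real.cos (N * s) = C at *
    generalize Real.sin (N' * t) = S' at *
    generalize Real.cos (N' * t) = C' at *
    rw [det4_rotate_left, det4_rotate_right, e1, e2]
    ring
  simp only [linkingNumber, hk, hdet]
  simp
  field_simp

/-- The linking number of circles in transverse planes. -/
theorem linkingNumber_planeCircle {u v u' v' : R4} (huv : Orthonormal ℝ ![u, v])
    (h : det4 u v u' v' ≠ 0) (N N' : ℕ) :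
    linkingNumber (planeCircle N u v) (planeCircle N' u' v') =
      N * N' * intersectionSign u v u' v' := by
  obtain ⟨hu, hv, huv'⟩ := orthonormal_pair_iff.1 huv
  -- Gram–Schmidt: `(u, v, u', v')` is completed to an orthonormal frame `(u, v, c, d)`. The change
  -- of basis is triangular with positive diagonal `1, 1, ‖w‖, ‖z‖`, so the sign of the determinant
  -- is preserved.
  set w : R4 := u' - inner ℝ u u' • u - inner ℝ v u' • v with hw
  have hw0 : w ≠ 0 := by
    intro h0
    have e : (inner ℝ u u') • u + (inner ℝ v u') • v = (1 : ℝ) • u' + (0 : ℝ) • v' := by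
      rw [hw] at h0
      rw [← sub_eq_zero, ← neg_eq_zero, ← h0]
      module
    simpa using (eq_zero_of_det4_ne_zero h e).2.2.1
  have hwn : 0 < ‖w‖ := norm_pos_iff.2 hw0
  have huw : inner ℝ u w = 0 := by
    rw [hw]; simp [inner_sub_right, inner_smul_right, huv', hu]
  have hvw : inner ℝ v w = 0 := by
    rw [hw]; simp [inner_sub_right, inner_smul_right, real_inner_comm, huv', hv]
  set c : R4 := ‖w‖⁻¹ • w with hc
  have hcn : ‖c‖ = 1 := by rw [hc, norm_smul, norm_inv, norm_norm, inv_mul_cancel₀ hwn.ne']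
  have huc : inner ℝ u c = 0 := by rw [hc, inner_smul_right, huw, mul_zero]
  have hvc : inner ℝ v c = 0 := by rw [hc, inner_smul_right, hvw, mul_zero]
  have hu' : u' = inner ℝ u u' • u + inner ℝ v u' • v + ‖w‖ • c := by
    rw [hc, smul_smul, mul_inv_cancel₀ hwn.ne', one_smul, hw]; module
  set z : R4 := v' - inner ℝ u v' • u - inner ℝ v v' • v - inner ℝ c v' • c with hz
  have hD : det4 u v u' v' = ‖w‖ * det4 u v c z := by
    rw [hz]
    conv_lhs => rw [hu']
    simp only [det4_eq, PiLp.sub_apply, PiLp.add_apply, PiLp.smul_apply, smul_eq_mul]; ring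
  have hz0 : z ≠ 0 := by
    intro h0
    rw [h0] at hD
    exact h (by rw [hD]; simp [det4_eq])
  have hzn : 0 < ‖z‖ := norm_pos_iff.2 hz0
  have huz : inner ℝ u z = 0 := by
    rw [hz]; simp [inner_sub_right, inner_smul_right, huv', hu, huc]
  have hvz : inner ℝ v z = 0 := by
    rw [hz]; simp [inner_sub_right, inner_smul_right, real_inner_comm u v, huv', hv, hvc]
  have hcz : inner ℝ c z = 0 := by
    rw [hz]
    simp [inner_sub_right, inner_smul_right, real_inner_comm u c, real_inner_comm v c, huc, hvc,
      hcn]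
  set d : R4 := ‖z‖⁻¹ • z with hd
  have hdn : ‖d‖ = 1 := by rw [hd, norm_smul, norm_inv, norm_norm, inv_mul_cancel₀ hzn.ne']
  have hud : inner ℝ u d = 0 := by rw [hd, inner_smul_right, huz, mul_zero]
  have hvd : inner ℝ v d = 0 := by rw [hd, inner_smul_right, hvz, mul_zero]
  have hcd : inner ℝ c d = 0 := by rw [hd, inner_smul_right, hcz, mul_zero]
  have hv' : v' = inner ℝ u v' • u + inner ℝ v v' • v + inner ℝ c v' • c + ‖z‖ • d := by
    have e : ‖z‖ • d = z := by rw [hd, smul_smul, mul_inv_cancel₀ hzn.ne', one_smul]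
    rw [e, hz]; module
  have hon : Orthonormal ℝ ![u, v, c, d] := by
    rw [orthonormal_iff_ite]
    simp [Fin.forall_fin_succ, hu, hv, hcn, hdn, huv', huc, hud, hvc, hvd, hcd,
      real_inner_comm u v, real_inner_comm u c, real_inner_comm u d, real_inner_comm v c,
      real_inner_comm v d, real_inner_comm c d]
  have hsq := det4_sq_of_orthonormal hon
  have hD' : det4 u v u' v' = ‖w‖ * ‖z‖ * det4 u v c d := by
    rw [hD]
    have : z = ‖z‖ • d := by rw [hd, smul_smul, mul_inv_cancel₀ hzn.ne', one_smul]
    conv_lhs => rw [this]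
    simp only [det4_eq, PiLp.smul_apply, smul_eq_mul]; ring
  have hsign : intersectionSign u v u' v' = det4 u v c d := by
    have hpos := mul_pos hwn hzn
    rw [intersectionSign, hD']
    rcases mul_self_eq_one_iff.1 ((sq _).symm.trans hsq) with h1 | h1
    · rw [h1, mul_one, Real.sign_of_pos hpos]
    · rw [h1, mul_neg_one, Real.sign_of_neg (neg_neg_of_pos hpos)]
  rw [hsign, ← linkingNumber_planeCircle_of_orthonormal hon]
  symm
  refine linkingNumber_eq_of_segment_right (isLoop_planeCircle _ _ _) (isLoop_planeCircle _ _ _)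
    (isLoop_planeCircle _ _ _) fun τ hτ => ?_
  have e : (fun s => planeCircle N' u' v' s + τ • (planeCircle N' c d s - planeCircle N' u' v' s))
      = planeCircle N' (u' + τ • (c - u')) (v' + τ • (d - v')) := by
    ext1 s
    simp only [planeCircle]
    module
  rw [e]
  refine rayDisjoint_planeCircle ?_ N N'
  -- Along the segment from `(u', v')` to `(c, d)` the diagonal entries stay positive, so the planes
  -- stay transverse.
  have hdet : det4 u v (u' + τ • (c - u')) (v' + τ • (d - v')) =
      ((1 - τ) * ‖w‖ + τ) * ((1 - τ) * ‖z‖ + τ) * det4 u v c d := by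
    conv_lhs => rw [hu', hv']
    simp only [det4_eq, PiLp.sub_apply, PiLp.add_apply, PiLp.smul_apply, smul_eq_mul]; ring
  have hp : ∀ r : ℝ, 0 < r → (1 - τ) * r + τ ≠ 0 := fun r hr => by
    rcases eq_or_lt_of_le hτ.1 with h0 | h0
    · rw [← h0]; simpa using hr.ne'
    · have := mul_nonneg (sub_nonneg.2 hτ.2) hr.le
      linarith
  rw [hdet]
  refine mul_ne_zero (mul_ne_zero (hp _ hwn) (hp _ hzn)) ?_
  intro h0
  rw [h0] at hsq
  norm_num at hsq

/-! ### Harmonic functions on an end -/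

open InnerProductSpace in
-- Locally `f` is the real part of a holomorphic function, and so is the composite.
lemma InnerProductSpace.HarmonicAt.comp_analyticAt {f : ℂ → ℝ} {φ : ℂ → ℂ} {z : ℂ}
    (hf : HarmonicAt f (φ z)) (hφ : AnalyticAt ℂ φ z) : HarmonicAt (f ∘ φ) z := by
  obtain ⟨ε, hε, hball⟩ := Metric.isOpen_iff.1 (isOpen_setOfPred_harmonicAt (f := f)) (φ z) hf
  obtain ⟨g, hg, hgf⟩ := HarmonicOnNhd.exists_analyticOnNhd_ball_re_eq (fun _ hy => hball hy)
  have h1 : AnalyticAt ℂ (g ∘ φ) z := (hg _ (Metric.mem_ball_self hε)).comp hφ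
  refine (harmonicAt_congr_nhds ?_).1 h1.harmonicAt_re
  filter_upwards [hφ.continuousAt (Metric.ball_mem_nhds _ hε)] with w hw
  exact hgf hw

/-- Gradient estimate for harmonic functions. -/
lemma norm_fderiv_le_of_harmonicOnNhd {f : ℂ → ℝ} {z : ℂ} {r m : ℝ} (hr : 0 < r) (hm : 0 < m)
    (hf : InnerProductSpace.HarmonicOnNhd f (Metric.ball z r))
    (hb : ∀ w ∈ Metric.ball z r, |f w| ≤ m) : ‖fderiv ℝ f z‖ ≤ 2 * Real.exp 2 * m / r := by
  obtain ⟨g, hg, hgf⟩ := hf.exists_analyticOnNhd_ball_re_eq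
  have hz : z ∈ Metric.ball z r := Metric.mem_ball_self hr
  have hgd := (hg z hz).differentiableAt
  -- Only the real part of `g` is bounded, and the exponential turns this into `e⁻¹ ≤ |q| ≤ e`.
  -- Cauchy's estimate on the circle of radius `r / 2` gives `|q'| ≤ 2e / r`; dividing by `|q| ≥
  -- e⁻¹` produces the constant `2e²`.
  set q : ℂ → ℂ := fun w => Complex.exp (g w / m) with hq
  have hqn : ∀ w ∈ Metric.ball z r, ‖q w‖ = Real.exp (f w / m) := fun w hw => by
    rw [hq, Complex.norm_exp, ← hgf hw]
    congr 1
    simp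
  have hqd : DifferentiableOn ℂ q (Metric.ball z r) := fun w hw =>
    (((hg w hw).differentiableAt.div_const _).cexp).differentiableWithinAt
  have hsub : Metric.closedBall z (r / 2) ⊆ Metric.ball z r :=
    Metric.closedBall_subset_ball (by linarith)
  have hcauchy : ‖deriv q z‖ ≤ Real.exp 1 / (r / 2) := by
    refine Complex.norm_deriv_le_of_forall_mem_sphere_norm_le (by linarith) ?_ fun w hw => ?_
    · exact (hqd.mono hsub).diffContOnCl_ball subset_rfl
    · have hw' := hsub (Metric.sphere_subset_closedBall hw)
      rw [hqn w hw', Real.exp_le_exp, div_le_one hm]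
      exact (le_abs_self _).trans (hb w hw')
  have hqz : deriv q z = q z * (deriv g z / m) := by
    have := ((hgd.hasDerivAt.div_const (m : ℂ)).cexp).deriv
    exact this
  have hlow : Real.exp (-1) ≤ ‖q z‖ := by
    rw [hqn z hz, Real.exp_le_exp, le_div_iff₀ hm]
    have := (abs_le.1 (hb z hz)).1
    linarith
  have hdg : ‖deriv g z‖ ≤ 2 * Real.exp 2 * m / r := by
    rw [hqz, norm_mul, norm_div, Complex.norm_real, Real.norm_of_nonneg hm.le] at hcauchy
    have h1 : Real.exp (-1) * (‖deriv g z‖ / m) ≤ Real.exp 1 / (r / 2) :=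
      (mul_le_mul_of_nonneg_right hlow (by positivity)).trans hcauchy
    have h2 : Real.exp 2 = Real.exp 1 * Real.exp 1 := by rw [← Real.exp_add]; norm_num
    rw [Real.exp_neg, inv_mul_le_iff₀ (Real.exp_pos 1), div_le_iff₀ hm] at h1
    calc ‖deriv g z‖ ≤ _ := h1
      _ = 2 * Real.exp 2 * m / r := by rw [h2]; field_simp
  have hfd : HasFDerivAt f (Complex.reCLM.comp
      ((ContinuousLinearMap.toSpanSingleton ℂ (deriv g z)).restrictScalars ℝ)) z := by
    have h1 := hgd.hasDerivAt.hasFDerivAt.restrictScalars ℝ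
    have h2 := (Complex.reCLM.hasFDerivAt (x := g z)).comp z h1
    refine h2.congr_of_eventuallyEq ?_
    filter_upwards [Metric.ball_mem_nhds z hr] with w hw
    exact (hgf hw).symm
  rw [hfd.fderiv]
  refine ContinuousLinearMap.opNorm_le_bound _ (by positivity) fun w => ?_
  calc ‖(w • deriv g z).re‖ ≤ ‖w • deriv g z‖ := Complex.abs_re_le_norm _
    _ = ‖deriv g z‖ * ‖w‖ := by rw [norm_smul, mul_comm]
    _ ≤ _ := by gcongr

/-! ### Vector-valued harmonic maps on exterior domains -/

lemma isOpen_annulus (ρ : ℝ) : IsOpen (annulus ρ) := isOpen_lt continuous_const continuous_norm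

/-- A map to `ℝ⁴` with harmonic coordinates. -/
def HasHarmonicCoords (G : ℂ → R4) (U : Set ℂ) : Prop :=
  ∀ e : R4, InnerProductSpace.HarmonicOnNhd (fun z => inner ℝ e (G z)) U

lemma HasHarmonicCoords.contDiffAt {G : ℂ → R4} {U : Set ℂ} (h : HasHarmonicCoords G U)
    {z : ℂ} (hz : z ∈ U) : ContDiffAt ℝ ∞ G z := by
  rw [contDiffAt_euclidean]
  intro i
  have := (HarmonicAt.analyticAt (h (EuclideanSpace.single i 1) z hz)).contDiffAt (n := ∞)
  simpa [EuclideanSpace.inner_single_left] using this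

/-- The scalar estimate is applied to the component of `G` in the direction of the derivative
itself, so the constant is the same as for functions. -/
lemma HasHarmonicCoords.norm_fderiv_le {G : ℂ → R4} {z : ℂ} {r m : ℝ} (hr : 0 < r) (hm : 0 < m)
    (hG : HasHarmonicCoords G (Metric.ball z r))
    (hb : ∀ w ∈ Metric.ball z r, ‖G w‖ ≤ m) : ‖fderiv ℝ G z‖ ≤ 2 * Real.exp 2 * m / r := by
  have hd : DifferentiableAt ℝ G z :=
    (hG.contDiffAt (Metric.mem_ball_self hr)).differentiableAt (by simp)
  refine ContinuousLinearMap.opNorm_le_bound _ (by positivity) fun w => ?_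
  set x := fderiv ℝ G z w with hx
  rcases eq_or_ne x 0 with h0 | h0
  · rw [h0, norm_zero]; positivity
  set e : R4 := ‖x‖⁻¹ • x with he
  have hxn : ‖x‖ ≠ 0 := norm_ne_zero_iff.2 h0
  have hen : ‖e‖ = 1 := by rw [he, norm_smul, norm_inv, norm_norm, inv_mul_cancel₀ hxn]
  have h1 := norm_fderiv_le_of_harmonicOnNhd hr hm (hG e) fun w hw => by
    calc |inner ℝ e (G w)| ≤ ‖e‖ * ‖G w‖ := abs_real_inner_le_norm _ _
      _ ≤ m := by rw [hen, one_mul]; exact hb w hw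
  have h2 : fderiv ℝ (fun z => inner ℝ e (G z)) z w = inner ℝ e x := by
    have := ((innerSL ℝ e).hasFDerivAt.comp z hd.hasFDerivAt).fderiv
    change fderiv ℝ (innerSL ℝ e ∘ G) z w = _
    rw [this]
    rfl
  have h3 : inner ℝ e x = ‖x‖ := by
    rw [he, inner_smul_left, real_inner_self_eq_norm_sq]
    simp only [conj_trivial]
    field_simp
  rw [← h3, ← h2]
  exact (le_abs_self _).trans (ContinuousLinearMap.le_of_opNorm_le _ h1 w)

/-- A harmonic map on an exterior domain which is `o(|z| ^ N)` has gradient `o(|z| ^ (N - 1))`. -/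
lemma HasHarmonicCoords.exists_bound {H : ℂ → R4} {ρ : ℝ} {N : ℕ}
    (hH : HasHarmonicCoords H (annulus ρ))
    (ho : H =o[Bornology.cobounded ℂ] fun z => ‖z‖ ^ N) {δ : ℝ} (hδ : 0 < δ) :
    ∃ r₁, 0 < r₁ ∧ ρ < r₁ ∧ ∀ z : ℂ, r₁ ≤ ‖z‖ →
      ‖H z‖ ≤ δ * ‖z‖ ^ N ∧ ∀ w, ‖fderiv ℝ H z w‖ * ‖z‖ ≤ δ * ‖z‖ ^ N * ‖w‖ := by
  -- The gradient estimate is used on the ball of radius `‖z‖ / 2`, where the norm is at most `2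
  -- ‖z‖`: this gives the factor `2 ^ N`, and the radius gives the other `2`.
  set C := 2 * Real.exp 2 * (2 * 2 ^ N) with hC
  have hCpos : 0 < C := by positivity
  set η := min δ (δ / C) with hη
  have hηpos : 0 < η := lt_min hδ (by positivity)
  have h1 := ho.def hηpos
  rw [← comap_norm_atTop, eventually_comap] at h1
  obtain ⟨r, hr⟩ : ∃ r : ℝ, ∀ z : ℂ, r ≤ ‖z‖ → ‖H z‖ ≤ η * ‖‖z‖ ^ N‖ := by
    obtain ⟨r, hr⟩ := eventually_atTop.1 h1
    exact ⟨r, fun z hz => hr ‖z‖ hz z rfl⟩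
  -- Twice the thresholds, so that the ball of radius `‖z‖ / 2` about `z` stays in the domain and in
  -- the region where the bound on `H` holds.
  refine ⟨max 1 (max (2 * r) (2 * |ρ| + 1)), by positivity, ?_, fun z hz => ?_⟩
  · exact lt_max_of_lt_right (lt_max_of_lt_right (by linarith [le_abs_self ρ, abs_nonneg ρ]))
  · have hz1 : 1 ≤ ‖z‖ := (le_max_left _ _).trans hz
    have hz2 : 2 * r ≤ ‖z‖ := (le_max_left _ _).trans ((le_max_right _ _).trans hz)
    have hz3 : 2 * |ρ| + 1 ≤ ‖z‖ := (le_max_right _ _).trans ((le_max_right _ _).trans hz)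
    have hzr : r ≤ ‖z‖ := by
      rcases le_total 0 r with h | h <;> linarith
    constructor
    · refine (hr z hzr).trans ?_
      rw [Real.norm_of_nonneg (by positivity)]
      gcongr
      exact min_le_left _ _
    · intro w
      have hball : ∀ w ∈ Metric.ball z (‖z‖ / 2), ‖z‖ / 2 < ‖w‖ ∧ ‖w‖ ≤ 2 * ‖z‖ := fun w hw => by
        rw [Metric.mem_ball, dist_eq_norm] at hw
        have h2 := norm_sub_norm_le z w
        have h3 := norm_sub_norm_le w z
        rw [norm_sub_rev] at h2
        constructor <;> linarith
      have hg := HasHarmonicCoords.norm_fderiv_le (z := z) (r := ‖z‖ / 2)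
        (m := η * (2 * ‖z‖) ^ N) (G := H) (by linarith) (by positivity)
        (fun e w hw => hH e w (by
          have := (hball w hw).1
          show ρ < ‖w‖
          linarith [le_abs_self ρ, abs_nonneg ρ]))
        (fun w hw => by
          have := hball w hw
          refine (hr w (by linarith)).trans ?_
          rw [Real.norm_of_nonneg (by positivity)]
          gcongr
          exact this.2)
      have h4 : 2 * Real.exp 2 * (η * (2 * ‖z‖) ^ N) / (‖z‖ / 2) * ‖z‖ = (η * C) * ‖z‖ ^ N := by
        rw [hC, mul_pow]
        field_simp
      have h5 : η * C ≤ δ := by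
        rw [← le_div_iff₀ hCpos]; exact min_le_right _ _
      calc ‖fderiv ℝ H z w‖ * ‖z‖ ≤ (2 * Real.exp 2 * (η * (2 * ‖z‖) ^ N) / (‖z‖ / 2) * ‖w‖) * ‖z‖ := by
            gcongr
            exact ContinuousLinearMap.le_of_opNorm_le _ hg w
        _ = (η * C) * ‖z‖ ^ N * ‖w‖ := by rw [← h4]; ring
        _ ≤ _ := by gcongr

/-! ### The ends of a minimal surface have harmonic coordinates -/

/-- Read in a chart the parametrization is holomorphic, and harmonicity survives a holomorphic
change of variable. -/
lemma hasHarmonicCoords_comp {M : Type*} [TopologicalSpace M] [ChartedSpace ℂ M]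
    [IsManifold 𝓘(ℂ) ω M] {F : M → R4} (hmin : IsMinimalImmersion F) {E : ℂ → M} {U : Set ℂ}
    (hU : IsOpen U) (hE : MDifferentiableOn 𝓘(ℂ) 𝓘(ℂ) E U) : HasHarmonicCoords (F ∘ E) U := by
  intro x z hz
  set e := chartAt ℂ (E z) with he
  have hcont : ContinuousAt E z := (hE z hz).continuousWithinAt.continuousAt (hU.mem_nhds hz)
  have hsrc : ∀ᶠ w in 𝓝 z, w ∈ U ∧ E w ∈ e.source :=
    (hU.eventually_mem hz).and (hcont.eventually (e.open_source.mem_nhds (mem_chart_source ℂ (E z))))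
  have hdiff : ∀ᶠ w in 𝓝 z, DifferentiableAt ℂ (e ∘ E) w := by
    filter_upwards [hsrc] with w hw
    have h1 : MDifferentiableAt 𝓘(ℂ) 𝓘(ℂ) E w := (hE w hw.1).mdifferentiableAt (hU.mem_nhds hw.1)
    have h2 : MDifferentiableAt 𝓘(ℂ) 𝓘(ℂ) e (E w) :=
      mdifferentiableAt_atlas (I := 𝓘(ℂ)) (chart_mem_atlas ℂ (E z)) hw.2
    exact mdifferentiableAt_iff_differentiableAt.1 (h2.comp w h1)
  have han : AnalyticAt ℂ (e ∘ E) z := by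
    rw [Complex.analyticAt_iff_eventually_differentiableAt]
    exact hdiff
  have hharm := (hmin e (chart_mem_atlas ℂ (E z))).1 (e (E z))
    (e.map_source (mem_chart_source ℂ (E z)))
  have h3 : InnerProductSpace.HarmonicAt (innerSL ℝ x ∘ (F ∘ e.symm)) ((e ∘ E) z) :=
    hharm.comp_CLM _
  refine (InnerProductSpace.harmonicAt_congr_nhds ?_).1 (h3.comp_analyticAt han)
  filter_upwards [hsrc] with w hw
  simp [e.left_inv hw.2]

/-! ### Asymptotics of a harmonic end -/

/-- The inclusion of `ℂ` in `ℝ⁴` as the plane with oriented basis `(u, v)`. -/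
noncomputable def planeMap (u v : R4) : ℂ →L[ℝ] R4 :=
  Complex.reCLM.smulRight u + Complex.imCLM.smulRight v

lemma planeMap_apply (u v : R4) (z : ℂ) : planeMap u v z = z.re • u + z.im • v := rfl

lemma inner_planeMap {u v : R4} (h : Orthonormal ℝ ![u, v]) (z w : ℂ) :
    inner ℝ (planeMap u v z) (planeMap u v w) = z.re * w.re + z.im * w.im := by
  obtain ⟨hu, hv, huv⟩ := orthonormal_pair_iff.1 h
  simp only [planeMap_apply, inner_add_left, inner_add_right, inner_smul_left, inner_smul_right,
    real_inner_self_eq_norm_sq, hu, hv, huv, real_inner_comm u v, conj_trivial]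
  ring

lemma norm_planeMap {u v : R4} (h : Orthonormal ℝ ![u, v]) (z : ℂ) : ‖planeMap u v z‖ = ‖z‖ := by
  have : ‖planeMap u v z‖ ^ 2 = ‖z‖ ^ 2 := by
    rw [← real_inner_self_eq_norm_sq, inner_planeMap h, Complex.sq_norm, Complex.normSq_apply]
  exact (sq_eq_sq₀ (norm_nonneg _) (norm_nonneg _)).1 this

lemma planeMap_exp (N : ℕ) (u v : R4) (t : ℝ) :
    planeMap u v (Complex.exp (t * Complex.I) ^ N) = planeCircle N u v t := by
  rw [← Complex.exp_nat_mul, planeMap_apply, planeCircle]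
  have : (N : ℂ) * (t * Complex.I) = ((N * t : ℝ) : ℂ) * Complex.I := by push_cast; ring
  rw [this, Complex.exp_ofReal_mul_I_re, Complex.exp_ofReal_mul_I_im]

/-- A map `G : {|z| > ρ} → ℝ⁴` with harmonic coordinates which is asymptotic to `z ^ N` in the plane
with oriented orthonormal basis `(u, v)`. -/
structure IsHarmonicEnd (G : ℂ → R4) (ρ : ℝ) (N : ℕ) (u v : R4) : Prop where
  radius_pos : 0 < ρ
  order_pos : 1 ≤ N
  harmonic : HasHarmonicCoords G (annulus ρ)
  orthonormal : Orthonormal ℝ ![u, v]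
  asymptotic : (fun z : ℂ => G z - planeMap u v (z ^ N)) =o[Bornology.cobounded ℂ] fun z => ‖z‖ ^ N

lemma IsEnd.isHarmonicEnd {M : Type*} [TopologicalSpace M] [ChartedSpace ℂ M]
    [IsManifold 𝓘(ℂ) ω M] {F : M → R4} (hmin : IsMinimalImmersion F) {E : ℂ → M} {ρ : ℝ} {N : ℕ}
    {u v : R4} (h : IsEnd F E ρ N u v) : IsHarmonicEnd (F ∘ E) ρ N u v :=
  ⟨h.radius_pos, h.order_pos, hasHarmonicCoords_comp hmin (isOpen_annulus ρ) h.holomorphic,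
    h.orthonormal, h.asymptotic⟩

/-- `G` and its derivative are close to `z ^ N` and to its derivative for `|z| ≥ r₁`. -/
structure IsCloseBeyond (G : ℂ → R4) (N : ℕ) (u v : R4) (δ r₁ : ℝ) : Prop where
  pos : 0 < r₁
  close : ∀ z : ℂ, r₁ ≤ ‖z‖ → ‖G z - planeMap u v (z ^ N)‖ ≤ δ * ‖z‖ ^ N
  fderiv_close : ∀ z : ℂ, r₁ ≤ ‖z‖ → ∀ ξ : ℂ,
    ‖fderiv ℝ G z (ξ * z) - planeMap u v (N * ξ * z ^ N)‖ ≤ δ * ‖z‖ ^ N * ‖ξ‖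

section
variable {G : ℂ → R4} {ρ δ r₁ : ℝ} {N : ℕ} {u v : R4}

lemma hasHarmonicCoords_planeMap_pow (u v : R4) (N : ℕ) (U : Set ℂ) :
    HasHarmonicCoords (fun z => planeMap u v (z ^ N)) U := by
  intro e z _
  -- The component along `e` is the real part of `(⟨e, u⟩ - i ⟨e, v⟩) z ^ N`.
  have han : AnalyticAt ℂ (fun z : ℂ => (inner ℝ e u - inner ℝ e v * Complex.I : ℂ) * z ^ N) z := by
    fun_prop
  convert! han.harmonicAt_re using 2 with w
  simp [planeMap_apply, inner_add_right, inner_smul_right]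
  ring

lemma IsHarmonicEnd.differentiableAt (h : IsHarmonicEnd G ρ N u v) {z : ℂ} (hz : ρ < ‖z‖) :
    DifferentiableAt ℝ G z := (h.harmonic.contDiffAt hz).differentiableAt (by simp)

/-- The difference with the model is harmonic and `o(|z| ^ N)`, so its derivative is `o(|z| ^ (N -
1))`. Testing on `ξ z` restores the homogeneity `|z| ^ N`. -/
lemma IsHarmonicEnd.exists_isCloseBeyond (h : IsHarmonicEnd G ρ N u v) (hδ : 0 < δ) :
    ∃ r₁, ρ < r₁ ∧ IsCloseBeyond G N u v δ r₁ := by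
  have hH : HasHarmonicCoords (fun z => G z - planeMap u v (z ^ N)) (annulus ρ) := by
    intro e z hz
    have := (h.harmonic e z hz).sub (hasHarmonicCoords_planeMap_pow u v N (annulus ρ) e z hz)
    convert this using 2 with w
    simp [inner_sub_right]
  obtain ⟨r₁, h0, h1, h2⟩ := hH.exists_bound h.asymptotic hδ
  refine ⟨r₁, h1, h0, fun z hz => (h2 z hz).1, fun z hz ξ => ?_⟩
  have hzpos : 0 < ‖z‖ := h0.trans_le hz
  have h3 := (h2 z hz).2 (ξ * z)
  have hd : HasFDerivAt (fun z : ℂ => planeMap u v (z ^ N)) ((planeMap u v).comp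
      ((ContinuousLinearMap.toSpanSingleton ℂ ((N : ℂ) * z ^ (N - 1))).restrictScalars ℝ)) z :=
    (planeMap u v).hasFDerivAt.comp z ((hasDerivAt_pow N z).hasFDerivAt.restrictScalars ℝ)
  have h4 : fderiv ℝ (fun z => G z - planeMap u v (z ^ N)) z (ξ * z) =
      fderiv ℝ G z (ξ * z) - planeMap u v (N * ξ * z ^ N) := by
    have hs : fderiv ℝ (fun z => G z - planeMap u v (z ^ N)) z = _ :=
      ((h.differentiableAt (h1.trans_le hz)).hasFDerivAt.sub hd).fderiv
    rw [hs]
    simp only [sub_apply, ContinuousLinearMap.comp_apply,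
      ContinuousLinearMap.coe_restrictScalars', ContinuousLinearMap.toSpanSingleton_apply,
      smul_eq_mul]
    congr 2
    obtain ⟨n, rfl⟩ : ∃ n, N = n + 1 := ⟨N - 1, by have := h.order_pos; omega⟩
    simp only [Nat.add_sub_cancel]
    ring
  rw [h4, norm_mul, ← mul_assoc] at h3
  exact le_of_mul_le_mul_right h3 hzpos

lemma IsCloseBeyond.norm_le (h : IsCloseBeyond G N u v δ r₁) (ho : Orthonormal ℝ ![u, v])
    {z : ℂ} (hz : r₁ ≤ ‖z‖) : |‖G z‖ - ‖z‖ ^ N| ≤ δ * ‖z‖ ^ N := by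
  have := abs_norm_sub_norm_le (G z) (planeMap u v (z ^ N))
  rw [norm_planeMap ho, norm_pow] at this
  exact this.trans (h.close z hz)

/-- With `p` the model point and `m = |z| ^ N`, the main term is `⟨p, N p⟩ = N m²`. With `δ = 1 /
10` the errors are at most `(N / 10 + 1 / 10 + 1 / 100) m²`. -/
lemma IsCloseBeyond.inner_fderiv_pos (h : IsCloseBeyond G N u v (1 / 10) r₁)
    (ho : Orthonormal ℝ ![u, v]) (hN : 1 ≤ N) {z : ℂ} (hz : r₁ ≤ ‖z‖) :
    0 < inner ℝ (G z) (fderiv ℝ G z z) := by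
  have hzpos : 0 < ‖z‖ := h.pos.trans_le hz
  have h1 := h.close z hz
  have h2 := h.fderiv_close z hz 1
  rw [one_mul, mul_one, norm_one, mul_one] at h2
  set m := ‖z‖ ^ N with hm
  have hmpos : 0 < m := by positivity
  set p := planeMap u v (z ^ N) with hp
  have hpn : ‖p‖ = m := by rw [hp, norm_planeMap ho, norm_pow]
  have hq : planeMap u v (N * z ^ N) = (N : ℝ) • p := by
    rw [hp, ← map_smul]; simp
  rw [hq] at h2
  set a := G z - p with ha
  set b := fderiv ℝ G z z - (N : ℝ) • p with hb
  have e1 : G z = p + a := by rw [ha]; abel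
  have e2 : fderiv ℝ G z z = (N : ℝ) • p + b := by rw [hb]; abel
  have hN' : (1 : ℝ) ≤ N := by exact_mod_cast hN
  have i1 := abs_le.1 (abs_real_inner_le_norm p b)
  have i2 := abs_le.1 (abs_real_inner_le_norm a p)
  have i3 := abs_le.1 (abs_real_inner_le_norm a b)
  rw [e1, e2, inner_add_left, inner_add_right, inner_add_right, inner_smul_right, inner_smul_right,
    real_inner_self_eq_norm_sq, hpn]
  rw [hpn] at i1 i2
  have j1 : m * ‖b‖ ≤ 1 / 10 * m ^ 2 := by nlinarith
  have j2 : ‖a‖ * m ≤ 1 / 10 * m ^ 2 := by nlinarith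
  have j3 : ‖a‖ * ‖b‖ ≤ 1 / 10 * m * (1 / 10 * m) :=
    mul_le_mul h1 h2 (norm_nonneg _) (by positivity)
  have j4 : (N : ℝ) * inner ℝ a p ≥ -(N * (1 / 10 * m ^ 2)) := by nlinarith
  nlinarith [sq_pos_of_pos hmpos]

end

/-! ### The curves cut out by large spheres -/

lemma norm_mul_exp {r : ℝ} (hr : 0 ≤ r) (t : ℝ) : ‖(r : ℂ) * Complex.exp (t * Complex.I)‖ = r := by
  rw [norm_mul, Complex.norm_exp_ofReal_mul_I, mul_one, Complex.norm_real, Real.norm_of_nonneg hr]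

section
variable {G : ℂ → R4} {ρ δ r₁ : ℝ} {N : ℕ} {u v : R4}

lemma IsHarmonicEnd.hasDerivAt_ray (h : IsHarmonicEnd G ρ N u v) {r : ℝ} (hr : ρ < r) (t : ℝ) :
    HasDerivAt (fun r : ℝ => ‖G (r * Complex.exp (t * Complex.I))‖ ^ 2)
      (2 / r * inner ℝ (G (r * Complex.exp (t * Complex.I)))
        (fderiv ℝ G (r * Complex.exp (t * Complex.I)) (r * Complex.exp (t * Complex.I)))) r := by
  have hr0 : 0 < r := h.radius_pos.trans hr
  have hd := (h.differentiableAt (z := r * Complex.exp (t * Complex.I))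
    (by rwa [norm_mul_exp hr0.le])).hasFDerivAt
  have h1 : HasDerivAt (fun r : ℝ => (r : ℂ) * Complex.exp (t * Complex.I))
      (Complex.exp (t * Complex.I)) r := by
    simpa using (Complex.ofRealCLM.hasDerivAt (x := r)).mul_const (Complex.exp (t * Complex.I))
  refine (hd.comp_hasDerivAt r h1).norm_sq.congr_deriv ?_
  have e : (r : ℂ) * Complex.exp (t * Complex.I) = r • Complex.exp (t * Complex.I) := by simp
  conv_rhs => rw [e, map_smul, inner_smul_right]
  rw [← e]
  simp only [Function.comp_apply]
  field_simp

lemma IsHarmonicEnd.strictMonoOn_ray (h : IsHarmonicEnd G ρ N u v)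
    (hc : IsCloseBeyond G N u v (1 / 10) r₁) (hr : ρ < r₁) (t : ℝ) :
    StrictMonoOn (fun r : ℝ => ‖G (r * Complex.exp (t * Complex.I))‖ ^ 2) (Ici r₁) := by
  refine strictMonoOn_of_deriv_pos (convex_Ici r₁)
    (fun r hr' => (h.hasDerivAt_ray (hr.trans_le hr') t).continuousAt.continuousWithinAt)
    fun r hr' => ?_
  rw [interior_Ici] at hr'
  have hr'' : r₁ < r := hr'
  have hr0 : 0 < r := hc.pos.trans hr''
  rw [(h.hasDerivAt_ray (hr.trans hr'') t).deriv]
  have := hc.inner_fderiv_pos h.orthonormal h.order_pos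
    (z := r * Complex.exp (t * Complex.I)) (by rw [norm_mul_exp hr0.le]; exact hr''.le)
  positivity

/-- `rad R t` is the only radius `r ≥ r₁` for which `G (r exp (i t))` has norm `R`. -/
structure IsRadius (G : ℂ → R4) (r₁ B : ℝ) (rad : ℝ → ℝ → ℝ) : Prop where
  lt : ∀ R, B < R → ∀ t : ℝ, r₁ < rad R t
  norm_eq : ∀ R, B < R → ∀ t : ℝ, ‖G (rad R t * Complex.exp (t * Complex.I))‖ = R
  unique : ∀ R, B < R → ∀ t r : ℝ, r₁ ≤ r → ‖G (r * Complex.exp (t * Complex.I))‖ = R → r = rad R t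

lemma IsHarmonicEnd.exists_isRadius (h : IsHarmonicEnd G ρ N u v)
    (hc : IsCloseBeyond G N u v (1 / 10) r₁) (hr : ρ < r₁) :
    ∃ rad, IsRadius G r₁ (2 * r₁ ^ N) rad := by
  have hpos := hc.pos
  have hex : ∀ R, 2 * r₁ ^ N < R → ∀ t : ℝ,
      ∃ r, r₁ < r ∧ ‖G (r * Complex.exp (t * Complex.I))‖ = R := by
    intro R hR t
    have hR0 : 0 < R := lt_trans (by positivity) hR
    have hcont : ContinuousOn (fun r : ℝ => ‖G (r * Complex.exp (t * Complex.I))‖) (Ici r₁) := by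
      intro r hr'
      have hrr : ρ < r := hr.trans_le hr'
      have h1 := (h.differentiableAt (z := r * Complex.exp (t * Complex.I))
        (by rwa [norm_mul_exp (h.radius_pos.trans hrr).le])).continuousAt
      have h2 : ContinuousAt (fun r : ℝ => (r : ℂ) * Complex.exp (t * Complex.I)) r := by fun_prop
      exact (ContinuousAt.comp (f := fun r : ℝ => (r : ℂ) * Complex.exp (t * Complex.I)) h1
        h2).norm.continuousWithinAt
    have hlow : ‖G (r₁ * Complex.exp (t * Complex.I))‖ < R := by
      have := hc.norm_le h.orthonormal (z := r₁ * Complex.exp (t * Complex.I))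
        (by rw [norm_mul_exp hpos.le])
      rw [norm_mul_exp hpos.le] at this
      have := (abs_le.1 this).2
      have : 0 < r₁ ^ N := by positivity
      linarith
    -- Since `b ≥ 1` and `‖G‖ ≥ (9 / 10) b ^ N ≥ (9 / 10) b`, the choice `b ≥ 2 R` overshoots `R`.
    -- At `r₁` the norm is at most `(11 / 10) r₁ ^ N`, below the threshold `2 r₁ ^ N < R`.
    set b := max (max r₁ 1) (2 * R) with hb
    have hb1 : 1 ≤ b := (le_max_right _ _).trans (le_max_left _ _)
    have hbr : r₁ ≤ b := (le_max_left _ _).trans (le_max_left _ _)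
    have hhigh : R ≤ ‖G (b * Complex.exp (t * Complex.I))‖ := by
      have := hc.norm_le h.orthonormal (z := b * Complex.exp (t * Complex.I))
        (by rwa [norm_mul_exp (hpos.le.trans hbr)])
      rw [norm_mul_exp (hpos.le.trans hbr)] at this
      have h1 := (abs_le.1 this).1
      have h2 : b ≤ b ^ N := le_self_pow₀ hb1 (by have := h.order_pos; omega)
      have h3 : 2 * R ≤ b := le_max_right _ _
      linarith
    obtain ⟨r, hr', hrR⟩ := intermediate_value_Icc hbr (hcont.mono Icc_subset_Ici_self)
      ⟨hlow.le, hhigh⟩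
    refine ⟨r, lt_of_le_of_ne hr'.1 ?_, hrR⟩
    rintro rfl
    exact hlow.ne hrR
  choose! rad hrad using hex
  refine ⟨rad, fun R hR t => (hrad R hR t).1, fun R hR t => (hrad R hR t).2,
    fun R hR t r hr' he => ?_⟩
  refine (h.strictMonoOn_ray hc hr t).injOn hr' (hrad R hR t).1.le ?_
  simp only [he, (hrad R hR t).2]

lemma IsRadius.periodic {B : ℝ} {rad : ℝ → ℝ → ℝ} (hrad : IsRadius G r₁ B rad) {R : ℝ}
    (hR : B < R) : Function.Periodic (rad R) (2 * Real.pi) := by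
  intro t
  refine hrad.unique R hR t _ (hrad.lt R hR _).le ?_
  have : Complex.exp (t * Complex.I) = Complex.exp (((t + 2 * Real.pi : ℝ) : ℂ) * Complex.I) := by
    push_cast
    rw [add_mul, Complex.exp_add, Complex.exp_two_pi_mul_I, mul_one]
  rw [this]
  exact hrad.norm_eq R hR _

lemma IsHarmonicEnd.contDiffAt_polar (h : IsHarmonicEnd G ρ N u v) {r t : ℝ} (hr : ρ < r) :
    ContDiffAt ℝ ∞ (fun p : ℝ × ℝ => G (p.2 * Complex.exp (p.1 * Complex.I))) (t, r) := by
  have h1 : ContDiffAt ℝ ∞ G ((r : ℂ) * Complex.exp (t * Complex.I)) :=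
    h.harmonic.contDiffAt (by
      show ρ < _
      rwa [norm_mul_exp (h.radius_pos.trans hr).le])
  have h2 : ContDiff ℝ ∞ (fun p : ℝ × ℝ => (p.2 : ℂ) * Complex.exp (p.1 * Complex.I)) := by
    have e1 : ContDiff ℝ ∞ (fun p : ℝ × ℝ => (p.2 : ℂ)) := Complex.ofRealCLM.contDiff.comp contDiff_snd
    have e2 : ContDiff ℝ ∞ (fun p : ℝ × ℝ => (p.1 : ℂ)) := Complex.ofRealCLM.contDiff.comp contDiff_fst
    exact e1.mul ((e2.mul contDiff_const).cexp)
  exact ContDiffAt.comp (t, r) h1 h2.contDiffAt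

/-- The radial derivative of `‖G‖²` is positive, so the implicit function theorem gives a smooth
local solution, which by uniqueness beyond `r₁` is `rad`. Joint regularity in `(R, t)` is what later
allows `R` to vary. -/
lemma IsRadius.contDiffAt {B : ℝ} {rad : ℝ → ℝ → ℝ} (hrad : IsRadius G r₁ B rad)
    (h : IsHarmonicEnd G ρ N u v) (hc : IsCloseBeyond G N u v (1 / 10) r₁) (hr : ρ < r₁) {R : ℝ}
    (hR : B < R) (hR0 : 0 ≤ B) (t : ℝ) : ContDiffAt ℝ ∞ (Function.uncurry rad) (R, t) := by
  set r := rad R t with hr'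
  have hlt : r₁ < r := hrad.lt R hR t
  have hr0 : 0 < r := hc.pos.trans hlt
  set f : (ℝ × ℝ) × ℝ → ℝ := fun p => ‖G (p.2 * Complex.exp (p.1.2 * Complex.I))‖ ^ 2 - p.1.1 ^ 2
    with hf
  have cdf : ContDiffAt ℝ ∞ f ((R, t), r) := by
    have h1 : ContDiffAt ℝ ∞ (fun p : (ℝ × ℝ) × ℝ => G (p.2 * Complex.exp (p.1.2 * Complex.I)))
        ((R, t), r) :=
      ContDiffAt.comp (f := fun p : (ℝ × ℝ) × ℝ => (p.1.2, p.2)) ((R, t), r)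
        (h.contDiffAt_polar (t := t) (hr.trans hlt)) (by fun_prop)
    exact (h1.norm_sq ℝ).sub (by fun_prop)
  have hd1 : HasDerivAt (fun s => f ((R, t), s)) _ r :=
    (h.hasDerivAt_ray (hr.trans hlt) t).sub_const (R ^ 2)
  have hder : (fderiv ℝ f ((R, t), r)) (0, 1) ≠ 0 := by
    have h2 : HasDerivAt (fun s : ℝ => (((R, t), s) : (ℝ × ℝ) × ℝ)) (0, 1) r :=
      (hasDerivAt_const r (R, t)).prodMk (hasDerivAt_id r)
    have h3 := (cdf.differentiableAt (by simp)).hasFDerivAt.comp_hasDerivAt r h2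
    rw [h3.unique hd1]
    have := hc.inner_fderiv_pos h.orthonormal h.order_pos
      (z := r * Complex.exp (t * Complex.I)) (by rw [norm_mul_exp hr0.le]; exact hlt.le)
    positivity
  have hinv : (fderiv ℝ f ((R, t), r) ∘L .inr ℝ (ℝ × ℝ) ℝ).IsInvertible := by
    refine ⟨ContinuousLinearEquiv.unitsEquivAut ℝ (Units.mk0 _ hder), ?_⟩
    ext
    simp
  have hfu : f ((R, t), r) = 0 := by
    simp only [hf]
    rw [hrad.norm_eq R hR t, sub_self]
  have hψ := cdf.contDiffAt_implicitFunction (by simp) hinv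
  refine hψ.congr_of_eventuallyEq ?_
  have hψ0 := cdf.implicitFunction_apply_self (by simp) hinv
  have e1 := cdf.eventually_apply_implicitFunction (by simp) hinv
  have e2 : ∀ᶠ x in 𝓝 (R, t), r₁ < cdf.implicitFunction (by simp) hinv x :=
    hψ.continuousAt.eventually (lt_mem_nhds (by rw [hψ0]; exact hlt))
  have e3 : ∀ᶠ x : ℝ × ℝ in 𝓝 (R, t), B < x.1 := continuousAt_fst.eventually (lt_mem_nhds hR)
  filter_upwards [e1, e2, e3] with x h1 h2 h3
  symm
  refine hrad.unique x.1 h3 x.2 _ h2.le ?_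
  rw [hfu] at h1
  exact (sq_eq_sq₀ (norm_nonneg _) (hR0.trans h3.le)).1 (sub_eq_zero.1 h1)

end

/-- An end of a minimal surface, with the radius function of its intersections with the spheres of
radius `R > B`. -/
structure IsEndWithRadius (G : ℂ → R4) (ρ : ℝ) (N : ℕ) (u v : R4) (r₁ B : ℝ) (rad : ℝ → ℝ → ℝ) :
    Prop where
  isHarmonicEnd : IsHarmonicEnd G ρ N u v
  isCloseBeyond : IsCloseBeyond G N u v (1 / 10) r₁
  lt : ρ < r₁
  nonneg : 0 ≤ B
  isRadius : IsRadius G r₁ B rad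

lemma IsHarmonicEnd.exists_isEndWithRadius {G : ℂ → R4} {ρ : ℝ} {N : ℕ} {u v : R4}
    (h : IsHarmonicEnd G ρ N u v) : ∃ r₁ B rad, IsEndWithRadius G ρ N u v r₁ B rad := by
  obtain ⟨r₁, hr, hc⟩ := h.exists_isCloseBeyond (δ := 1 / 10) (by norm_num)
  obtain ⟨rad, hrad⟩ := h.exists_isRadius hc hr
  have := hc.pos
  exact ⟨r₁, _, rad, h, hc, hr, by positivity, hrad⟩

lemma eq_planeMap_deriv (N : ℕ) (u v : R4) (t : ℝ) :
    deriv (planeCircle N u v) t =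
      planeMap u v (N * Complex.I * Complex.exp (t * Complex.I) ^ N) := by
  rw [(hasDerivAt_planeCircle N u v t).deriv, ← Complex.exp_nat_mul, planeMap_apply]
  have : (N : ℂ) * (t * Complex.I) = ((N * t : ℝ) : ℂ) * Complex.I := by push_cast; ring
  rw [this]
  have h1 := Complex.exp_ofReal_mul_I_re (N * t)
  have h2 := Complex.exp_ofReal_mul_I_im (N * t)
  generalize Complex.exp (((N * t : ℝ) : ℂ) * Complex.I) = w at *
  have e : (N : ℂ) * Complex.I * w = ((N : ℝ) : ℂ) * (Complex.I * w) := by push_cast; ring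
  rw [e, Complex.re_ofReal_mul, Complex.im_ofReal_mul]
  simp [h1, h2]

/-- Here `p + a` is the point of the curve and the other vector its velocity, `β` being `r' / r`.
Tangency to the sphere makes `N β m²` equal to error terms, so `|β| ≤ (21 / 10) δ (|β| + 1)`, and
the term in `|β|` is absorbed on the left. -/
lemma abs_le_of_inner_eq_zero {p q a b : R4} {N β m δ : ℝ} (hN : 1 ≤ N) (hδ0 : 0 < δ)
    (hδ : δ ≤ 1 / 10) (hmpos : 0 < m) (hpn : ‖p‖ = m) (hqn : ‖q‖ = m) (hpq : inner ℝ p q = 0)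
    (ha : ‖a‖ ≤ δ * m) (hb : ‖b‖ ≤ δ * m * (|β| + 1))
    (horth : inner ℝ (p + a) ((N * β) • p + N • q + b) = 0) : |β| ≤ 5 * δ := by
  simp only [inner_add_left, inner_add_right, inner_smul_right, real_inner_self_eq_norm_sq, hpn,
    hpq] at horth
  have i1 := abs_real_inner_le_norm p b
  have i2 := abs_real_inner_le_norm a p
  have i3 := abs_real_inner_le_norm a q
  have i4 := abs_real_inner_le_norm a b
  rw [hpn] at i1 i2
  rw [hqn] at i3
  have hk : N * β * m ^ 2 = -(inner ℝ p b + N * β * inner ℝ a p + N * inner ℝ a q + inner ℝ a b) := by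
    linear_combination horth
  have hk1 : N * |β| * m ^ 2 ≤ ‖b‖ * m + N * |β| * (‖a‖ * m) + N * (‖a‖ * m) + ‖a‖ * ‖b‖ := by
    calc N * |β| * m ^ 2 = |N * β * m ^ 2| := by
          rw [abs_mul, abs_mul, abs_of_pos (by positivity : 0 < m ^ 2), abs_of_nonneg (zero_le_one.trans hN)]
      _ ≤ |inner ℝ p b| + |N * β * inner ℝ a p| + |N * inner ℝ a q| + |inner ℝ a b| := by
          rw [hk, abs_neg]
          refine (abs_add_le _ _).trans (add_le_add_left ((abs_add_le _ _).trans
            (add_le_add_left (abs_add_le _ _) _)) _)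
      _ ≤ _ := by
          rw [abs_mul, abs_mul, abs_of_nonneg (zero_le_one.trans hN), abs_mul, abs_of_nonneg (zero_le_one.trans hN), mul_comm ‖b‖]
          gcongr
  have hβ0 := abs_nonneg β
  have k1 : ‖b‖ * m ≤ δ * m * (|β| + 1) * m := by gcongr
  have k2 : ‖a‖ * m ≤ δ * m * m := by gcongr
  have k3 : ‖a‖ * ‖b‖ ≤ (δ * m) * (δ * m * (|β| + 1)) :=
    mul_le_mul ha hb (norm_nonneg _) (by positivity)
  have k4 : N * |β| * (‖a‖ * m) ≤ N * |β| * (δ * m * m) := by gcongr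
  have k5 : N * (‖a‖ * m) ≤ N * (δ * m * m) := by gcongr
  have k6 : N * |β| * m ^ 2 ≤ (δ * (|β| + 1) + N * |β| * δ + N * δ + δ * δ * (|β| + 1)) * m ^ 2 := by
    linarith
  have k7 := le_of_mul_le_mul_right k6 (by positivity : 0 < m ^ 2)
  have k8 : δ * (|β| + 1) ≤ N * (δ * (|β| + 1)) := le_mul_of_one_le_left (by positivity) hN
  have k9 : δ * δ * (|β| + 1) ≤ N * (1 / 10 * δ * (|β| + 1)) := by
    refine le_trans ?_ (le_mul_of_one_le_left (by positivity) hN)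
    gcongr
  have k10 : N * |β| ≤ N * (21 / 10 * δ * (|β| + 1)) := by linarith
  have k11 := le_of_mul_le_mul_left k10 (by linarith)
  nlinarith

namespace IsEndWithRadius

variable {G : ℂ → R4} {ρ r₁ B δ r₂ : ℝ} {N : ℕ} {u v : R4} {rad : ℝ → ℝ → ℝ}

lemma norm_endCurve (h : IsEndWithRadius G ρ N u v r₁ B rad) {R : ℝ} (hR : B < R) (t : ℝ) :
    ‖endCurve G (rad R) t‖ = R := h.isRadius.norm_eq R hR t

lemma contDiff_rad (h : IsEndWithRadius G ρ N u v r₁ B rad) {R : ℝ} (hR : B < R) :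
    ContDiff ℝ ∞ (rad R) := by
  rw [contDiff_iff_contDiffAt]
  intro t
  exact ContDiffAt.comp (f := fun t : ℝ => (R, t)) t
    (h.isRadius.contDiffAt h.isHarmonicEnd h.isCloseBeyond h.lt hR h.nonneg t) (by fun_prop)

lemma contDiff_endCurve (h : IsEndWithRadius G ρ N u v r₁ B rad) {R : ℝ} (hR : B < R) :
    ContDiff ℝ ∞ (endCurve G (rad R)) := by
  rw [contDiff_iff_contDiffAt]
  intro t
  exact ContDiffAt.comp (f := fun t : ℝ => (t, rad R t)) t
    (h.isHarmonicEnd.contDiffAt_polar (h.lt.trans (h.isRadius.lt R hR t)))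
    (contDiffAt_id.prodMk (h.contDiff_rad hR).contDiffAt)

lemma isLoop (h : IsEndWithRadius G ρ N u v r₁ B rad) {R : ℝ} (hR : B < R) :
    IsLoop (endCurve G (rad R)) := by
  refine ⟨by exact_mod_cast contDiff_infty.1 (h.contDiff_endCurve hR) 2, fun t => ?_⟩
  simp only [endCurve, h.isRadius.periodic hR t]
  congr 2
  push_cast
  rw [add_mul, Complex.exp_add, Complex.exp_two_pi_mul_I, mul_one]

lemma continuousAt_endCurve (h : IsEndWithRadius G ρ N u v r₁ B rad) {R : ℝ} (hR : B < R) (t : ℝ) :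
    ContinuousAt (Function.uncurry fun R t => endCurve G (rad R) t) (R, t) := by
  have h1 := (h.isRadius.contDiffAt h.isHarmonicEnd h.isCloseBeyond h.lt hR h.nonneg t).continuousAt
  have h2 := (h.isHarmonicEnd.contDiffAt_polar (t := t)
    (h.lt.trans (h.isRadius.lt R hR t))).continuousAt
  exact ContinuousAt.comp (f := fun p : ℝ × ℝ => (p.2, Function.uncurry rad p)) (x := (R, t)) h2
    (continuousAt_snd.prodMk h1)

lemma eventually_le_rad (h : IsEndWithRadius G ρ N u v r₁ B rad) (r₂ : ℝ) :
    ∀ᶠ R in atTop, ∀ t, r₂ ≤ rad R t := by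
  filter_upwards [eventually_gt_atTop B, eventually_ge_atTop (2 * |r₂| ^ N)] with R hR hR' t
  have hlt := h.isRadius.lt R hR t
  have hpos := h.isCloseBeyond.pos.trans hlt
  have h1 := h.isCloseBeyond.norm_le h.isHarmonicEnd.orthonormal
    (z := rad R t * Complex.exp (t * Complex.I)) (by rw [norm_mul_exp hpos.le]; exact hlt.le)
  rw [h.isRadius.norm_eq R hR t, norm_mul_exp hpos.le] at h1
  have h2 := (abs_le.1 h1).2
  have h3 : 0 < rad R t ^ N := by positivity
  have h4 : |r₂| ^ N < rad R t ^ N := by linarith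
  exact (le_abs_self _).trans (lt_of_pow_lt_pow_left₀ N hpos.le h4).le

/-- The velocity of `z = r exp (i t)` is `ξ z` with `ξ = r' / r + i`, the form in which
`IsCloseBeyond` controls the derivative of `G`. -/
lemma hasDerivAt_endCurve (h : IsEndWithRadius G ρ N u v r₁ B rad) {R : ℝ} (hR : B < R) (t : ℝ) :
    HasDerivAt (endCurve G (rad R))
      (fderiv ℝ G (rad R t * Complex.exp (t * Complex.I))
        (((deriv (rad R) t / rad R t : ℝ) + Complex.I) *
          (rad R t * Complex.exp (t * Complex.I)))) t := by
  have hlt := h.isRadius.lt R hR t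
  have hpos := h.isCloseBeyond.pos.trans hlt
  have hd := (h.isHarmonicEnd.differentiableAt (z := rad R t * Complex.exp (t * Complex.I))
    (by rw [norm_mul_exp hpos.le]; exact h.lt.trans hlt)).hasFDerivAt
  have hr : HasDerivAt (fun t => (rad R t : ℂ)) (deriv (rad R) t : ℝ) t :=
    ((h.contDiff_rad hR).differentiable (by simp) t).hasDerivAt.ofReal_comp
  have ht : HasDerivAt (fun t : ℝ => Complex.exp (t * Complex.I))
      (Complex.exp (t * Complex.I) * Complex.I) t := by
    have h1 : HasDerivAt (fun t : ℝ => (t : ℂ) * Complex.I) Complex.I t := by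
      simpa using (Complex.ofRealCLM.hasDerivAt (x := t)).mul_const Complex.I
    exact h1.cexp
  refine (hd.comp_hasDerivAt t (hr.mul ht)).congr_deriv ?_
  congr 1
  have : (rad R t : ℂ) ≠ 0 := by exact_mod_cast hpos.ne'
  push_cast
  field_simp

/-- The closeness to the model circle of the curve cut out by a sphere. -/
lemma norm_endCurve_sub_le (h : IsEndWithRadius G ρ N u v r₁ B rad)
    (hc : IsCloseBeyond G N u v δ r₂) (hδ0 : 0 < δ) (hδ : δ ≤ 1 / 10) {R : ℝ} (hR : B < R) {t : ℝ}
    (hr₂ : r₂ ≤ rad R t) :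
    ‖endCurve G (rad R) t - R • planeCircle N u v t‖ ≤ 4 * δ * R ∧
      ‖deriv (endCurve G (rad R)) t - R • deriv (planeCircle N u v) t‖ ≤ 16 * N * δ * R := by
  have ho := h.isHarmonicEnd.orthonormal
  have hN : (1 : ℝ) ≤ N := by exact_mod_cast h.isHarmonicEnd.order_pos
  have hRpos : 0 < R := h.nonneg.trans_lt hR
  have hpos : 0 < rad R t := h.isCloseBeyond.pos.trans (h.isRadius.lt R hR t)
  set z : ℂ := rad R t * Complex.exp (t * Complex.I) with hz
  have hzn : ‖z‖ = rad R t := norm_mul_exp hpos.le t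
  have hz₂ : r₂ ≤ ‖z‖ := by rwa [hzn]
  set m := ‖z‖ ^ N with hm
  have hmpos : 0 < m := by rw [hm, hzn]; positivity
  have hmz : z ^ N = (m : ℝ) * Complex.exp (t * Complex.I) ^ N := by
    rw [hz, mul_pow, hm, hzn]; push_cast; rfl
  set β := deriv (rad R) t / rad R t with hβ
  set ξ : ℂ := (β : ℝ) + Complex.I with hξ
  have hGz : endCurve G (rad R) t = G z := rfl
  have hGn : ‖G z‖ = R := h.isRadius.norm_eq R hR t
  have hder := h.hasDerivAt_endCurve hR t
  have hmR := abs_le.1 (hc.norm_le ho hz₂)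
  rw [hGn, ← hm] at hmR
  have hm2 : m ≤ 2 * R := by nlinarith
  set D := fderiv ℝ G z (ξ * z) with hD
  have hξn : ‖ξ‖ ≤ |β| + 1 := by
    refine (norm_add_le _ _).trans ?_
    simp
  -- the error terms
  have ha := hc.close z hz₂
  have hb := (hc.fderiv_close z hz₂ ξ).trans
    (mul_le_mul_of_nonneg_left hξn (by positivity : 0 ≤ δ * ‖z‖ ^ N))
  rw [← hm] at ha hb
  set p := planeMap u v (z ^ N) with hp
  set q := planeMap u v (Complex.I * z ^ N) with hq
  have hpn : ‖p‖ = m := by rw [hp, norm_planeMap ho, norm_pow]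
  have hqn : ‖q‖ = m := by rw [hq, norm_planeMap ho, norm_mul, norm_pow]; simp [hm]
  have hpq : inner ℝ p q = 0 := by
    rw [hp, hq, inner_planeMap ho]
    simp
    ring
  have hξpq : planeMap u v (N * ξ * z ^ N) = (N * β) • p + (N : ℝ) • q := by
    rw [hp, hq, ← map_smul, ← map_smul, ← map_add, hξ]
    congr 1
    simp
    ring
  rw [hξpq] at hb
  set a := G z - p with ha'
  set b := D - ((N * β) • p + (N : ℝ) • q) with hb'
  have eG : G z = p + a := by rw [ha']; abel
  have eD : D = (N * β) • p + (N : ℝ) • q + b := by rw [hb']; abel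
  have horth : inner ℝ (G z) D = 0 := by
    have h1 := hder.norm_sq
    have h2 : HasDerivAt (fun s => ‖endCurve G (rad R) s‖ ^ 2) 0 t := by
      have : (fun s => ‖endCurve G (rad R) s‖ ^ 2) = fun _ => R ^ 2 := by
        ext s; rw [h.norm_endCurve hR s]
      rw [this]
      exact hasDerivAt_const t _
    have h3 := h1.unique h2
    have h4 : (2 : ℝ) * inner ℝ (G z) D = 0 := h3
    linarith
  have hβ5 : |β| ≤ 5 * δ := by
    rw [eG, eD] at horth
    exact abs_le_of_inner_eq_zero hN hδ0 hδ hmpos hpn hqn hpq ha hb horth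
  have hpm : p = m • planeCircle N u v t := by
    rw [hp, hmz, ← planeMap_exp, ← map_smul]; simp
  have hqm : (N : ℝ) • q = m • deriv (planeCircle N u v) t := by
    rw [hq, hmz, eq_planeMap_deriv, ← map_smul, ← map_smul]
    congr 1
    simp
    ring
  have hpc : ‖planeCircle N u v t‖ = 1 := by
    rw [← planeMap_exp, norm_planeMap ho, norm_pow, Complex.norm_exp_ofReal_mul_I, one_pow]
  have hdc : ‖deriv (planeCircle N u v) t‖ = N := by
    rw [eq_planeMap_deriv, norm_planeMap ho, norm_mul, norm_pow, Complex.norm_exp_ofReal_mul_I]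
    simp
  have hmR' : |m - R| ≤ δ * m := by rw [abs_le]; constructor <;> linarith
  constructor
  · have : endCurve G (rad R) t - R • planeCircle N u v t = a + (m - R) • planeCircle N u v t := by
      rw [hGz, eG, hpm]; module
    rw [this]
    refine (norm_add_le _ _).trans ?_
    rw [norm_smul, hpc, Real.norm_eq_abs, mul_one]
    nlinarith
  · have hD' : deriv (endCurve G (rad R)) t = D := hder.deriv
    have : D - R • deriv (planeCircle N u v) t =
        b + (N * β) • p + (m - R) • deriv (planeCircle N u v) t := by
      rw [eD, hqm]; module
    rw [hD', this]
    refine (norm_add₃_le).trans ?_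
    rw [norm_smul, norm_smul, hpn, hdc, Real.norm_eq_abs, Real.norm_eq_abs, abs_mul, Nat.abs_cast]
    have hβ0 := abs_nonneg β
    -- `|β| ≤ 5 δ ≤ 1 / 2`. The three errors add up to at most `(15 / 2) N δ m`, and `m ≤ 2 R`.
    have k1 : ‖b‖ ≤ δ * m * (3 / 2) := hb.trans (by gcongr; linarith)
    have k2 : N * |β| * m ≤ N * (5 * δ) * m := by gcongr
    have k3 : |m - R| * N ≤ δ * m * N := by gcongr
    have k4 : δ * m * (3 / 2) ≤ N * (δ * m * (3 / 2)) := le_mul_of_one_le_left (by positivity) hN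
    have k5 : N * δ * m ≤ N * δ * (2 * R) := by gcongr
    have k6 : 0 ≤ N * δ * R := by positivity
    linarith

/-- The curves cut out by large spheres are close to circles, with their derivatives. -/
theorem eventually_close (h : IsEndWithRadius G ρ N u v r₁ B rad) {η : ℝ} (hη : 0 < η) :
    ∀ᶠ R in atTop, ∀ t, ‖endCurve G (rad R) t - R • planeCircle N u v t‖ ≤ η * R ∧
      ‖deriv (endCurve G (rad R)) t - R • deriv (planeCircle N u v) t‖ ≤ η * R := by
  have hN : (1 : ℝ) ≤ N := by exact_mod_cast h.isHarmonicEnd.order_pos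
  set δ := min (1 / 10) (η / (16 * N)) with hδ
  have hδ0 : 0 < δ := lt_min (by norm_num) (by positivity)
  have hδη : 16 * N * δ ≤ η := by
    have : δ ≤ η / (16 * N) := min_le_right _ _
    rwa [le_div_iff₀ (by positivity), mul_comm] at this
  obtain ⟨r₂, -, hc⟩ := h.isHarmonicEnd.exists_isCloseBeyond hδ0
  filter_upwards [h.eventually_le_rad r₂, eventually_gt_atTop B] with R h1 h2 t
  have hR0 : 0 < R := h.nonneg.trans_lt h2
  obtain ⟨h3, h4⟩ := h.norm_endCurve_sub_le hc hδ0 (min_le_left _ _) h2 (h1 t)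
  refine ⟨h3.trans ?_, h4.trans ?_⟩
  · gcongr
    nlinarith
  · gcongr

end IsEndWithRadius

/-! ### Pushing a curve off itself -/

/-- The determinant of the projections of two vectors to the plane `(u, v)`. -/
noncomputable def planeCross (u v a b : R4) : ℝ :=
  inner ℝ u a * inner ℝ v b - inner ℝ v a * inner ℝ u b

lemma abs_planeCross_le {u v : R4} (hu : ‖u‖ = 1) (hv : ‖v‖ = 1) (a b : R4) :
    |planeCross u v a b| ≤ 2 * (‖a‖ * ‖b‖) := by
  have h : ∀ x y : R4, ‖x‖ = 1 → |inner ℝ x y| ≤ ‖y‖ := fun x y hx => by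
    simpa [hx] using abs_real_inner_le_norm x y
  rw [planeCross, two_mul]
  refine (abs_sub _ _).trans (add_le_add ?_ ?_)
  · rw [abs_mul]
    exact mul_le_mul (h u a hu) (h v b hv) (abs_nonneg _) (norm_nonneg _)
  · rw [abs_mul]
    exact mul_le_mul (h v a hv) (h u b hu) (abs_nonneg _) (norm_nonneg _)

lemma planeCross_planeCircle {u v : R4} (h : Orthonormal ℝ ![u, v]) (N : ℕ) (s t : ℝ) :
    planeCross u v (planeCircle N u v t) (deriv (planeCircle N u v) s) =
      N * Real.cos (N * (s - t)) := by
  obtain ⟨hu, hv, huv⟩ := orthonormal_pair_iff.1 h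
  rw [(hasDerivAt_planeCircle N u v s).deriv, planeCross, planeCircle]
  simp only [inner_add_right, inner_smul_right, real_inner_self_eq_norm_sq, hu, hv, huv,
    real_inner_comm u v, mul_sub, Real.cos_sub]
  ring

/-- The curve `c` is close to the circle of radius `R` of the plane `(u, v)`, covered `N` times. -/
structure IsNearCircle (c : ℝ → R4) (N : ℕ) (u v : R4) (R : ℝ) : Prop where
  orthonormal : Orthonormal ℝ ![u, v]
  order_pos : 1 ≤ N
  pos : 0 < R
  isLoop : IsLoop c
  norm_eq : ∀ t, ‖c t‖ = R
  close : ∀ t, ‖c t - R • planeCircle N u v t‖ ≤ 1 / 10 * R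
  deriv_close : ∀ t, ‖deriv c t - R • deriv (planeCircle N u v) t‖ ≤ 1 / 10 * R

namespace IsNearCircle

variable {c : ℝ → R4} {N : ℕ} {u v : R4} {R : ℝ}

lemma norm_planeCircle {u v : R4} (h : Orthonormal ℝ ![u, v]) (N : ℕ) (t : ℝ) :
    ‖planeCircle N u v t‖ = 1 := by
  rw [← planeMap_exp, norm_planeMap h, norm_pow, Complex.norm_exp_ofReal_mul_I, one_pow]

lemma norm_deriv_planeCircle {u v : R4} (h : Orthonormal ℝ ![u, v]) (N : ℕ) (t : ℝ) :
    ‖deriv (planeCircle N u v) t‖ = N := by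
  rw [eq_planeMap_deriv, norm_planeMap h, norm_mul, norm_pow, Complex.norm_exp_ofReal_mul_I]
  simp

/-- The angle `N (s - t)` is at most `1 / 2`, so its cosine is at least `7 / 8`. The main term `(7 /
8) N R²` dominates the two errors, each at most `N R² / 5`. -/
lemma planeCross_deriv_pos (h : IsNearCircle c N u v R) {s t : ℝ} (hst : |s - t| ≤ 1 / (2 * N)) :
    0 < planeCross u v (c t) (deriv c s) := by
  obtain ⟨hu, hv, -⟩ := orthonormal_pair_iff.1 h.orthonormal
  have hN : (1 : ℝ) ≤ N := by exact_mod_cast h.order_pos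
  have hR := h.pos
  set p := planeCircle N u v t with hp
  set q := deriv (planeCircle N u v) s with hq
  have e : planeCross u v (c t) (deriv c s) = R ^ 2 * planeCross u v p q
      + R * planeCross u v (c t - R • p) q + planeCross u v (c t) (deriv c s - R • q) := by
    simp only [planeCross, inner_sub_right, inner_smul_right]
    ring
  have h1 := abs_planeCross_le hu hv (c t - R • p) q
  have h2 := abs_planeCross_le hu hv (c t) (deriv c s - R • q)
  rw [hq, norm_deriv_planeCircle h.orthonormal, ← hq] at h1
  rw [h.norm_eq] at h2
  have h3 : ‖c t - R • p‖ * N ≤ 1 / 10 * R * N := by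
    gcongr
    exact h.close t
  have h4 : R * ‖deriv c s - R • q‖ ≤ R * (1 / 10 * R) := by
    gcongr
    exact h.deriv_close s
  have h5 : 7 / 8 ≤ Real.cos (N * (s - t)) := by
    have h6 : |N * (s - t)| ≤ 1 / 2 := by
      rw [abs_mul, Nat.abs_cast]
      calc N * |s - t| ≤ N * (1 / (2 * N)) := by gcongr
        _ = 1 / 2 := by field_simp
    have h7 := Real.one_sub_sq_div_two_le_cos (x := N * (s - t))
    have h8 : (N * (s - t)) ^ 2 ≤ (1 / 2) ^ 2 := sq_le_sq' (by linarith [(abs_le.1 h6).1])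
      (abs_le.1 h6).2
    linarith
  rw [e, hp, hq, planeCross_planeCircle h.orthonormal, ← hp, ← hq]
  have h9 := (abs_le.1 h1).1
  have h10 := (abs_le.1 h2).1
  have h11 : R * planeCross u v (c t - R • p) q ≥ R * -(2 * (1 / 10 * R * N)) := by
    gcongr
    linarith
  have h12 : R ^ 2 * (N * Real.cos (N * (s - t))) ≥ R ^ 2 * (N * (7 / 8)) := by gcongr
  have h13 : R ^ 2 * 1 ≤ R ^ 2 * N := by gcongr
  have h14 : 0 < R ^ 2 := by positivity
  nlinarith

/-- As a function of `s` the cross product vanishes at `s = t` and increases strictly on the window.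
-/
lemma planeCross_ne_zero (h : IsNearCircle c N u v R) {s t : ℝ} (hst : |s - t| ≤ 1 / (2 * N))
    (hne : s ≠ t) : planeCross u v (c t) (c s) ≠ 0 := by
  set d : ℝ := 1 / (2 * N) with hd
  have hd0 : 0 ≤ d := by positivity
  have hder : ∀ s, HasDerivAt (fun s => planeCross u v (c t) (c s))
      (planeCross u v (c t) (deriv c s)) s := fun s => by
    have hi : ∀ x : R4, HasDerivAt (fun s => inner ℝ x (c s)) (inner ℝ x (deriv c s)) s := fun x =>
      (innerSL ℝ x).hasFDerivAt.comp_hasDerivAt s (h.isLoop.hasDerivAt s)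
    exact ((hi v).const_mul _).sub ((hi u).const_mul _)
  have hmono : StrictMonoOn (fun s => planeCross u v (c t) (c s)) (Icc (t - d) (t + d)) := by
    refine strictMonoOn_of_deriv_pos (convex_Icc _ _)
      (fun s _ => (hder s).continuousAt.continuousWithinAt) fun s hs => ?_
    rw [interior_Icc] at hs
    rw [(hder s).deriv]
    exact h.planeCross_deriv_pos (abs_le.2 ⟨by linarith [hs.1], by linarith [hs.2]⟩)
  have ht : t ∈ Icc (t - d) (t + d) := ⟨by linarith, by linarith⟩
  have hs : s ∈ Icc (t - d) (t + d) := by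
    have := abs_le.1 hst
    exact ⟨by linarith [this.1], by linarith [this.2]⟩
  have hz : planeCross u v (c t) (c t) = 0 := by rw [planeCross]; ring
  intro h0
  exact hne (hmono.injOn hs ht (by simp only [h0, hz]))

/-- Near the diagonal, a curve close to a circle does not meet its push-offs. -/
lemma ne_of_abs_sub_le (h : IsNearCircle c N u v R) {Y : R4} (hY : Y ≠ 0) (huY : inner ℝ u Y = 0)
    (hvY : inner ℝ v Y = 0) {s t : ℝ} (hst : |s - t| ≤ 1 / (2 * N)) {x : ℝ} :
    (1 - x) • c s ≠ x • (c t + Y) := by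
  intro he
  have hu := congrArg (inner ℝ u) he
  have hv := congrArg (inner ℝ v) he
  simp only [inner_smul_right, inner_add_right, huY, hvY, add_zero] at hu hv
  rcases eq_or_ne s t with rfl | hne
  -- At `s = t` the projection of `c s` to the plane is nonzero; this forces `x = 1 / 2`, and then
  -- `Y = 0`.
  · have hp : inner ℝ u (c s) ≠ 0 ∨ inner ℝ v (c s) ≠ 0 := by
      by_contra! h0
      have h1 := h.close s
      have h2 : inner ℝ (planeCircle N u v s) (c s - R • planeCircle N u v s) = -R := by
        rw [inner_sub_right, inner_smul_right, real_inner_self_eq_norm_sq,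
          norm_planeCircle h.orthonormal]
        simp [planeCircle, inner_add_left, inner_smul_left, h0.1, h0.2]
      have h3 := abs_real_inner_le_norm (planeCircle N u v s) (c s - R • planeCircle N u v s)
      rw [h2, norm_planeCircle h.orthonormal, one_mul, abs_neg, abs_of_pos h.pos] at h3
      linarith [h.pos]
    have hx : x = 1 / 2 := by
      rcases hp with hp | hp
      · have := mul_right_cancel₀ hp hu
        linarith
      · have := mul_right_cancel₀ hp hv
        linarith
    rw [hx] at he
    apply hY
    have : (1 / 2 : ℝ) • Y = (1 / 2 : ℝ) • (c s + Y) - (1 - 1 / 2 : ℝ) • c s := by module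
    rw [← he, sub_self] at this
    simpa using this
  · have hc := h.planeCross_ne_zero hst hne
    -- `Y` disappears in the projection to the plane, and crossing the projected equation with each
    -- of the two points kills one weight at a time.
    have h0 : (1 - x) * planeCross u v (c t) (c s) = 0 := by
      rw [planeCross]
      linear_combination inner ℝ u (c t) * hv - inner ℝ v (c t) * hu
    have h1 : x * planeCross u v (c t) (c s) = 0 := by
      rw [planeCross]
      linear_combination inner ℝ u (c s) * hv - inner ℝ v (c s) * hu
    have h2 := (mul_eq_zero.1 h0).resolve_right hc
    have h3 := (mul_eq_zero.1 h1).resolve_right hc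
    linarith

/-- Away from the diagonal, an embedded curve does not meet its small push-offs. -/
lemma ne_of_two_mul_lt (h : IsNearCircle c N u v R) {Y : R4} {s t : ℝ}
    (hst : 2 * ‖Y‖ < ‖c s - c t‖) {x : ℝ} (hx : x ∈ Icc (0 : ℝ) 1) :
    (1 - x) • c s ≠ x • (c t + Y) := by
  intro he
  have hray : SameRay ℝ (c s) (c t + Y) := by
    rcases eq_or_lt_of_le hx.1 with h0 | h0
    · left
      rw [← h0] at he
      simpa using he
    rcases eq_or_lt_of_le hx.2 with h1 | h1
    · right; left
      rw [h1] at he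
      simpa using he.symm
    · exact Or.inr (Or.inr ⟨1 - x, x, by linarith, h0, he⟩)
  -- Vectors on one ray are as far apart as their norms, so `‖c s - (c t + Y)‖ = |R - ‖c t + Y‖| ≤
  -- ‖Y‖` and `‖c s - c t‖ ≤ 2 ‖Y‖`.
  have h1 := hray.norm_sub
  have h2 := abs_norm_sub_norm_le (c t) (c t + Y)
  rw [h.norm_eq] at h1 h2
  have h3 : c t - (c t + Y) = -Y := by abel
  rw [h3, norm_neg] at h2
  have h4 : c s - c t = (c s - (c t + Y)) + Y := by abel
  have h5 := norm_add_le (c s - (c t + Y)) Y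
  rw [← h4, h1] at h5
  linarith

lemma rayDisjoint (h : IsNearCircle c N u v R) {Y : R4} (hY : Y ≠ 0) (huY : inner ℝ u Y = 0)
    (hvY : inner ℝ v Y = 0) (hfar : ∀ s ∈ Icc (0 : ℝ) (2 * Real.pi), ∀ θ ∈ Icc (1 / (2 * N) : ℝ)
      (2 * Real.pi - 1 / (2 * N)), 2 * ‖Y‖ < ‖c s - c (s + θ)‖) :
    RayDisjoint c fun t => c t + Y := by
  intro s t x hx
  obtain ⟨s', hs', hse⟩ := h.isLoop.periodic.exists_mem_Ico₀ (by positivity) s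
  -- The period for `t` starts at `s' - 1 / (2N)`: then `t'` is either in the window about `s'` or
  -- at distance at least `1 / (2N)` from it modulo `2π`.
  obtain ⟨t', ht', hte⟩ := h.isLoop.periodic.exists_mem_Ico (by positivity) t (s' - 1 / (2 * N))
  simp only
  rw [hse, hte]
  by_cases hcase : t' ≤ s' + 1 / (2 * N)
  · exact h.ne_of_abs_sub_le hY huY hvY (abs_le.2 ⟨by linarith, by linarith [ht'.1]⟩)
  · refine h.ne_of_two_mul_lt ?_ hx
    have := hfar s' (Ico_subset_Icc_self hs') (t' - s') ⟨by linarith, by linarith [ht'.2]⟩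
    rwa [add_sub_cancel] at this

end IsNearCircle

/-! ### Orthogonal complements of planes -/

lemma mem_plane_orthogonal_iff {u v Y : R4} :
    Y ∈ (plane u v)ᗮ ↔ inner ℝ u Y = 0 ∧ inner ℝ v Y = 0 := by
  rw [plane, Submodule.mem_orthogonal]
  constructor
  · intro h
    exact ⟨h u (Submodule.subset_span (by simp)), h v (Submodule.subset_span (by simp))⟩
  · rintro ⟨h1, h2⟩ x hx
    obtain ⟨a, b, rfl⟩ := Submodule.mem_span_pair.1 hx
    simp [inner_add_left, inner_smul_left, h1, h2]

/-- Polar coordinates present the punctured disc of the orthogonal plane as the image of the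
connected set `(0, η) × ℝ`. -/
lemma exists_polar_basis {u v : R4} (h : Orthonormal ℝ ![u, v]) :
    ∃ w₁ w₂ : R4, Orthonormal ℝ ![w₁, w₂] ∧ ∀ Y : R4, (Y ∈ (plane u v)ᗮ ↔
      ∃ r θ : ℝ, 0 ≤ r ∧ Y = r • (Real.cos θ • w₁ + Real.sin θ • w₂)) := by
  have hfin : Module.finrank ℝ (plane u v)ᗮ = 2 := by
    have h1 := Submodule.finrank_add_finrank_orthogonal (plane u v)
    have h2 : Module.finrank ℝ (plane u v) = 2 := by
      have := finrank_span_eq_card h.linearIndependent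
      have hr : range ![u, v] = {u, v} := by
        ext x
        simp [eq_comm, or_comm]
      rw [hr, Fintype.card_fin] at this
      exact this
    rw [h2, finrank_euclideanSpace, Fintype.card_fin] at h1
    omega
  let b := (stdOrthonormalBasis ℝ (plane u v)ᗮ).reindex (finCongr hfin)
  have hb := b.orthonormal
  have hw : Orthonormal ℝ ![(b 0 : R4), (b 1 : R4)] := by
    rw [orthonormal_pair_iff]
    exact ⟨hb.1 0, hb.1 1, hb.2 (by decide : (0 : Fin 2) ≠ 1)⟩
  refine ⟨b 0, b 1, hw, fun Y => ⟨fun hY => ?_, ?_⟩⟩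
  · have hsum := b.sum_repr ⟨Y, hY⟩
    rw [Fin.sum_univ_two] at hsum
    have hs : b.repr ⟨Y, hY⟩ 0 • (b 0 : R4) + b.repr ⟨Y, hY⟩ 1 • (b 1 : R4) = Y :=
      congrArg Subtype.val hsum
    set z : ℂ := ⟨b.repr ⟨Y, hY⟩ 0, b.repr ⟨Y, hY⟩ 1⟩ with hz
    refine ⟨‖z‖, z.arg, norm_nonneg _, ?_⟩
    rw [smul_add, smul_smul, smul_smul, Complex.norm_mul_cos_arg, Complex.norm_mul_sin_arg]
    exact hs.symm
  · rintro ⟨r, θ, -, rfl⟩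
    exact Submodule.smul_mem _ _ (Submodule.add_mem _ (Submodule.smul_mem _ _ (b 0).2)
      (Submodule.smul_mem _ _ (b 1).2))

/-! ### The writhe of one end -/

namespace IsEndWithRadius

variable {G : ℂ → R4} {ρ r₁ B : ℝ} {N : ℕ} {u v : R4} {rad : ℝ → ℝ → ℝ}

lemma isNearCircle (h : IsEndWithRadius G ρ N u v r₁ B rad) {R : ℝ} (hR : B < R)
    (hc : ∀ t, ‖endCurve G (rad R) t - R • planeCircle N u v t‖ ≤ 1 / 10 * R ∧
      ‖deriv (endCurve G (rad R)) t - R • deriv (planeCircle N u v) t‖ ≤ 1 / 10 * R) :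
    IsNearCircle (endCurve G (rad R)) N u v R :=
  ⟨h.isHarmonicEnd.orthonormal, h.isHarmonicEnd.order_pos, h.nonneg.trans_lt hR, h.isLoop hR,
    h.norm_endCurve hR, fun t => (hc t).1, fun t => (hc t).2⟩

lemma endCurve_ne (h : IsEndWithRadius G ρ N u v r₁ B rad) {R₀ R : ℝ} (hR : B < R) (hR₀ : R₀ ≤ R)
    (hinj : InjOn G {z | ρ < ‖z‖ ∧ R₀ ≤ ‖G z‖}) (s : ℝ) {θ : ℝ} (h0 : 0 < θ)
    (h1 : θ < 2 * Real.pi) : endCurve G (rad R) s ≠ endCurve G (rad R) (s + θ) := by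
  intro he
  have hpos : ∀ t, 0 < rad R t := fun t => h.isCloseBeyond.pos.trans (h.isRadius.lt R hR t)
  have hmem : ∀ t : ℝ, (rad R t : ℂ) * Complex.exp (t * Complex.I) ∈
      {z | ρ < ‖z‖ ∧ R₀ ≤ ‖G z‖} := fun t => by
    refine ⟨?_, ?_⟩
    · rw [norm_mul_exp (hpos t).le]; exact h.lt.trans (h.isRadius.lt R hR t)
    · rw [h.isRadius.norm_eq R hR t]; exact hR₀
  have hz := hinj (hmem s) (hmem (s + θ)) he
  have hn := congrArg norm hz
  rw [norm_mul_exp (hpos _).le, norm_mul_exp (hpos _).le] at hn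
  rw [hn] at hz
  have hne : (rad R (s + θ) : ℂ) ≠ 0 := by exact_mod_cast (hpos _).ne'
  have hexp := mul_left_cancel₀ hne hz
  obtain ⟨n, hn⟩ := Complex.exp_eq_exp_iff_exists_int.1 hexp
  have him : s = s + θ + n * (2 * Real.pi) := by
    have := congrArg Complex.im hn
    simpa using this
  have hθ : θ = -n * (2 * Real.pi) := by linarith
  have hpi := Real.pi_pos
  rw [hθ] at h0 h1
  have k0 : (0 : ℝ) < -n := by
    by_contra! hcon
    nlinarith
  have k1 : (-n : ℝ) < 1 := by
    by_contra! hcon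
    nlinarith
  have k0' : (0 : ℤ) < -n := by exact_mod_cast k0
  have k1' : (-n : ℤ) < 1 := by exact_mod_cast k1
  omega

/-- Small push-offs of the curves cut out by nearby spheres are disjoint from them. -/
lemma eventually_rayDisjoint (h : IsEndWithRadius G ρ N u v r₁ B rad) {R₀ R₁ : ℝ} (hB : B ≤ R₁)
    (hR₀ : R₀ ≤ R₁) (hinj : InjOn G {z | ρ < ‖z‖ ∧ R₀ ≤ ‖G z‖})
    (hnear : ∀ R, R₁ < R → IsNearCircle (endCurve G (rad R)) N u v R) {R : ℝ} (hR : R₁ < R) :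
    ∃ η > 0, ∀ᶠ R' in 𝓝 R, ∀ Y ∈ (plane u v)ᗮ, Y ≠ 0 → ‖Y‖ < η →
      RayDisjoint (endCurve G (rad R')) fun t => endCurve G (rad R') t + Y := by
  have hN : (1 : ℝ) ≤ N := by exact_mod_cast h.isHarmonicEnd.order_pos
  set d : ℝ := 1 / (2 * N) with hd
  have hd0 : 0 < d := by positivity
  -- The second parameter stands for `‖Y‖`. Compactness in `(s, θ)` gives one bound for all
  -- directions of `Y` and all spheres of radius near `R`.
  have hK : ∀ᶠ p : ℝ × ℝ in 𝓝 (R, 0), ∀ x ∈ Icc (0 : ℝ) (2 * Real.pi) ×ˢ Icc d (2 * Real.pi - d),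
      2 * p.2 < ‖endCurve G (rad p.1) x.1 - endCurve G (rad p.1) (x.1 + x.2)‖ := by
    refine (isCompact_Icc.prod isCompact_Icc).eventually_forall_of_forall_eventually
      fun x hx => ?_
    have hBR := hB.trans_lt hR
    have c1 : ContinuousAt (fun q : (ℝ × ℝ) × ℝ × ℝ => endCurve G (rad q.1.1) q.2.1)
        ((R, 0), x) :=
      ContinuousAt.comp (f := fun q : (ℝ × ℝ) × ℝ × ℝ => (q.1.1, q.2.1)) (x := ((R, 0), x))
        (h.continuousAt_endCurve hBR x.1) (by fun_prop)
    have c2 : ContinuousAt (fun q : (ℝ × ℝ) × ℝ × ℝ => endCurve G (rad q.1.1) (q.2.1 + q.2.2))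
        ((R, 0), x) :=
      ContinuousAt.comp (f := fun q : (ℝ × ℝ) × ℝ × ℝ => (q.1.1, q.2.1 + q.2.2))
        (x := ((R, 0), x)) (h.continuousAt_endCurve hBR (x.1 + x.2)) (by fun_prop)
    refine ContinuousAt.eventually_lt (f := fun q : (ℝ × ℝ) × ℝ × ℝ => 2 * q.1.2) (by fun_prop)
      (c1.sub c2).norm ?_
    simp only [mul_zero, norm_pos_iff, sub_ne_zero]
    exact h.endCurve_ne hBR (hR₀.trans hR.le) hinj x.1 (hd0.trans_le hx.2.1)
      (by linarith [hx.2.2])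
  rw [nhds_prod_eq] at hK
  obtain ⟨pa, hpa, pb, hpb, hab⟩ := Filter.eventually_prod_iff.1 hK
  obtain ⟨η, hη, hball⟩ := Metric.eventually_nhds_iff.1 hpb
  refine ⟨η, hη, ?_⟩
  filter_upwards [hpa, lt_mem_nhds hR] with R' h1 h2 Y hY hY0 hYη
  obtain ⟨huY, hvY⟩ := mem_plane_orthogonal_iff.1 hY
  refine (hnear R' h2).rayDisjoint hY0 huY hvY fun s hs θ hθ => ?_
  exact hab h1 (hball (y := ‖Y‖) (by simpa using hYη)) (s, θ) ⟨hs, hθ⟩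

lemma continuousAt_endCurve_comp (h : IsEndWithRadius G ρ N u v r₁ B rad) {X : Type*}
    [TopologicalSpace X] {φ : X → ℝ} {x : X} (hφ : ContinuousAt φ x) (hx : B < φ x) (s : ℝ) :
    ContinuousAt (Function.uncurry fun q t => endCurve G (rad (φ q)) t) (x, s) := by
  have h1 : ContinuousAt (fun q : X × ℝ => (φ q.1, q.2)) (x, s) :=
    (ContinuousAt.comp (f := Prod.fst) (x := (x, s)) hφ continuousAt_fst).prodMk continuousAt_snd
  exact ContinuousAt.comp (f := fun q : X × ℝ => (φ q.1, q.2)) (x := (x, s))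
    (h.continuousAt_endCurve hx s) h1

end IsEndWithRadius

/-- The linking number of the curve `c` with its small push-offs in the directions orthogonal to the
plane `(u, v)` is `w`. -/
def HasPushOffLinking (c : ℝ → R4) (u v : R4) (w : ℝ) : Prop :=
  ∃ η > 0, ∀ Y ∈ (plane u v)ᗮ, Y ≠ 0 → ‖Y‖ < η →
    RayDisjoint c (fun t => c t + Y) ∧ linkingNumber c (fun t => c t + Y) = w

/-- A vector of the plane `(w₁, w₂)` in polar coordinates. -/
noncomputable def polarVector (w₁ w₂ : R4) (p : ℝ × ℝ) : R4 :=
  p.1 • (Real.cos p.2 • w₁ + Real.sin p.2 • w₂)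

lemma continuous_polarVector (w₁ w₂ : R4) : Continuous (polarVector w₁ w₂) := by
  unfold polarVector
  fun_prop

lemma norm_polarVector {w₁ w₂ : R4} (h : Orthonormal ℝ ![w₁, w₂]) {p : ℝ × ℝ} (hp : 0 ≤ p.1) :
    ‖polarVector w₁ w₂ p‖ = p.1 := by
  have h1 := IsNearCircle.norm_planeCircle h 1 p.2
  simp only [planeCircle, Nat.cast_one, one_mul] at h1
  rw [polarVector, norm_smul, h1, mul_one, Real.norm_of_nonneg hp]

lemma HasPushOffLinking.unique {c : ℝ → R4} {u v : R4} (ho : Orthonormal ℝ ![u, v]) {w w' : ℝ}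
    (h : HasPushOffLinking c u v w) (h' : HasPushOffLinking c u v w') : w = w' := by
  obtain ⟨w₁, w₂, hw, hpolar⟩ := exists_polar_basis ho
  obtain ⟨η, hη, hw1⟩ := h
  obtain ⟨η', hη', hw2⟩ := h'
  set r := min η η' / 2 with hr
  have hr0 : 0 < r := by positivity
  have hmin : r < min η η' := half_lt_self (lt_min hη hη')
  have hYn : ‖polarVector w₁ w₂ (r, 0)‖ = r := norm_polarVector hw hr0.le
  have hYm : polarVector w₁ w₂ (r, 0) ∈ (plane u v)ᗮ := (hpolar _).2 ⟨r, 0, hr0.le, rfl⟩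
  have hY0 : polarVector w₁ w₂ (r, 0) ≠ 0 := norm_pos_iff.1 (by rw [hYn]; exact hr0)
  rw [← (hw1 _ hYm hY0 (hYn.trans_lt (hmin.trans_le (min_le_left _ _)))).2,
    (hw2 _ hYm hY0 (hYn.trans_lt (hmin.trans_le (min_le_right _ _)))).2]

namespace IsEndWithRadius

variable {G : ℂ → R4} {ρ r₁ B : ℝ} {N : ℕ} {u v : R4} {rad : ℝ → ℝ → ℝ}

lemma eventually_linkingNumber_polarVector (h : IsEndWithRadius G ρ N u v r₁ B rad) (w₁ w₂ : R4)
    {q : ℝ × ℝ × ℝ} (hq : B < q.1)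
    (hdisj : RayDisjoint (endCurve G (rad q.1)) fun t =>
      endCurve G (rad q.1) t + polarVector w₁ w₂ q.2) :
    ∀ᶠ q' : ℝ × ℝ × ℝ in 𝓝 q, linkingNumber (endCurve G (rad q'.1))
      (fun t => endCurve G (rad q'.1) t + polarVector w₁ w₂ q'.2) =
        linkingNumber (endCurve G (rad q.1))
          (fun t => endCurve G (rad q.1) t + polarVector w₁ w₂ q.2) := by
  have hcont := h.continuousAt_endCurve_comp (φ := fun q : ℝ × ℝ × ℝ => q.1) (x := q)
    continuousAt_fst hq
  have hloops : ∀ᶠ q' : ℝ × ℝ × ℝ in 𝓝 q, IsLoop (endCurve G (rad q'.1)) := by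
    filter_upwards [continuousAt_fst.eventually (lt_mem_nhds hq)] with q' hq'
    exact h.isLoop hq'
  refine eventually_linkingNumber_eq (A := fun (q : ℝ × ℝ × ℝ) t => endCurve G (rad q.1) t)
    (B := fun q t => endCurve G (rad q.1) t + polarVector w₁ w₂ q.2) hcont (fun s => ?_) hloops ?_
    hdisj
  · have hY : ContinuousAt (fun p : (ℝ × ℝ × ℝ) × ℝ => polarVector w₁ w₂ p.1.2) (q, s) :=
      ((continuous_polarVector w₁ w₂).comp (continuous_snd.comp continuous_fst)).continuousAt
    exact (hcont s).add hY
  · filter_upwards [hloops] with q' hq'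
    exact hq'.add (isLoop_const _)

/-- The linking number is locally constant in the radius `R'` of the sphere and the polar
coordinates of `Y`, which range over a connected set. -/
lemma exists_eventually_hasPushOffLinking (h : IsEndWithRadius G ρ N u v r₁ B rad) {R₀ R₁ : ℝ}
    (hB : B ≤ R₁) (hR₀ : R₀ ≤ R₁) (hinj : InjOn G {z | ρ < ‖z‖ ∧ R₀ ≤ ‖G z‖})
    (hnear : ∀ R, R₁ < R → IsNearCircle (endCurve G (rad R)) N u v R) {R : ℝ} (hR : R₁ < R) :
    ∃ w, ∀ᶠ R' in 𝓝 R, HasPushOffLinking (endCurve G (rad R')) u v w := by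
  obtain ⟨w₁, w₂, hw, hpolar⟩ := exists_polar_basis h.isHarmonicEnd.orthonormal
  obtain ⟨η, hη, hev⟩ := h.eventually_rayDisjoint hB hR₀ hinj hnear hR
  obtain ⟨ε, hε, hball⟩ := Metric.eventually_nhds_iff_ball.1 (hev.and (lt_mem_nhds hR))
  have hYm : ∀ p : ℝ × ℝ, 0 < p.1 → polarVector w₁ w₂ p ∈ (plane u v)ᗮ ∧
      polarVector w₁ w₂ p ≠ 0 ∧ ‖polarVector w₁ w₂ p‖ = p.1 := fun p hp => by
    have hYn := norm_polarVector hw hp.le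
    exact ⟨(hpolar _).2 ⟨p.1, p.2, hp.le, rfl⟩, norm_pos_iff.1 (hYn ▸ hp), hYn⟩
  have hS : IsPreconnected (Metric.ball R ε ×ˢ Ioo 0 η ×ˢ (univ : Set ℝ)) :=
    ((convex_ball R ε).prod ((convex_Ioo 0 η).prod convex_univ)).isPreconnected
  have hf : ∀ q ∈ Metric.ball R ε ×ˢ Ioo 0 η ×ˢ (univ : Set ℝ), ∀ᶠ q' : ℝ × ℝ × ℝ in 𝓝 q,
      linkingNumber (endCurve G (rad q'.1))
        (fun t => endCurve G (rad q'.1) t + polarVector w₁ w₂ q'.2) =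
      linkingNumber (endCurve G (rad q.1))
        (fun t => endCurve G (rad q.1) t + polarVector w₁ w₂ q.2) := by
    rintro q ⟨hR', hp, -⟩
    obtain ⟨k1, k2, k3⟩ := hYm q.2 hp.1
    have hR'' := hball q.1 hR'
    exact h.eventually_linkingNumber_polarVector w₁ w₂ (hB.trans_lt hR''.2)
      (hR''.1 _ k1 k2 (k3.trans_lt hp.2))
  refine ⟨linkingNumber (endCurve G (rad R))
    (fun t => endCurve G (rad R) t + polarVector w₁ w₂ (η / 2, 0)), ?_⟩
  filter_upwards [Metric.ball_mem_nhds R hε] with R' hR'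
  refine ⟨η, hη, fun y hy hy0 hyη => ⟨(hball R' hR').1 y hy hy0 hyη, ?_⟩⟩
  obtain ⟨r, θ, hr, rfl⟩ := (hpolar y).1 hy
  have hr0 : 0 < r := lt_of_le_of_ne hr (by rintro rfl; simp at hy0)
  have hrη : r < η := (hYm (r, θ) hr0).2.2.symm.trans_lt hyη
  exact hS.eq_of_eventually_eq hf (x := (R', r, θ)) (y := (R, η / 2, 0))
    ⟨hR', ⟨hr0, hrη⟩, trivial⟩
    ⟨Metric.mem_ball_self hε, ⟨half_pos hη, half_lt_self hη⟩, trivial⟩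

/-- The linking number of a curve cut out by a large sphere with its small push-offs depends neither
on the sphere nor on the push-off. -/
theorem exists_writhe (h : IsEndWithRadius G ρ N u v r₁ B rad) {R₀ : ℝ}
    (hinj : InjOn G {z | ρ < ‖z‖ ∧ R₀ ≤ ‖G z‖}) :
    ∃ w : ℝ, ∀ᶠ R in atTop, HasPushOffLinking (endCurve G (rad R)) u v w := by
  obtain ⟨R₂, hR₂⟩ := eventually_atTop.1 (h.eventually_close (η := 1 / 10) (by norm_num))
  set R₁ := max R₂ (max B R₀) with hR₁
  have hB : B ≤ R₁ := (le_max_left _ _).trans (le_max_right _ _)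
  have hR₀ : R₀ ≤ R₁ := (le_max_right _ _).trans (le_max_right _ _)
  have hnear : ∀ R, R₁ < R → IsNearCircle (endCurve G (rad R)) N u v R := fun R hR =>
    h.isNearCircle (hB.trans_lt hR) (hR₂ R ((le_max_left _ _).trans hR.le))
  have hloc := fun R (hR : R₁ < R) =>
    h.exists_eventually_hasPushOffLinking hB hR₀ hinj hnear hR
  choose! W hW using hloc
  refine ⟨W (R₁ + 1), ?_⟩
  filter_upwards [eventually_gt_atTop R₁] with R hR
  -- Near `x`, both `W x` and `W y` are the push-off linking of the curve at radius `y`, so they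
  -- agree; the local values then glue along a half-line.
  have hconst : W (R₁ + 1) = W R := by
    refine (convex_Ioi R₁).isPreconnected.eq_of_eventually_eq (fun x hx => ?_)
      (show R₁ < R₁ + 1 by linarith) hR
    filter_upwards [hW x hx, lt_mem_nhds hx] with y hy hxy
    exact (hW y hxy).self_of_nhds.unique h.isHarmonicEnd.orthonormal hy
  rw [hconst]
  exact (hW R hR).self_of_nhds

/-! ### The linking number of two ends -/

/-- The linking number of the curves cut out by a large sphere on two ends with transverse planes
at infinity. -/
theorem eventually_linkingNumber {G' : ℂ → R4} {ρ' r₁' B' : ℝ} {N' : ℕ} {u' v' : R4}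
    {rad' : ℝ → ℝ → ℝ} (h : IsEndWithRadius G ρ N u v r₁ B rad)
    (h' : IsEndWithRadius G' ρ' N' u' v' r₁' B' rad') (hdet : det4 u v u' v' ≠ 0) :
    ∀ᶠ R in atTop, ∃ η > 0, ∀ Y, ‖Y‖ < η →
      RayDisjoint (endCurve G (rad R)) (fun t => endCurve G' (rad' R) t + Y) ∧
        linkingNumber (endCurve G (rad R)) (fun t => endCurve G' (rad' R) t + Y) =
          N * N' * intersectionSign u v u' v' := by
  have hl := isLoop_planeCircle N u v
  have hl' := isLoop_planeCircle N' u' v'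
  have hdisj := rayDisjoint_planeCircle hdet N N'
  obtain ⟨κ, hκ, hbound⟩ := hdisj.exists_bound hl hl'
  filter_upwards [h.eventually_close (η := κ / 4) (by positivity),
    h'.eventually_close (η := κ / 4) (by positivity), eventually_gt_atTop B,
    eventually_gt_atTop B'] with R h1 h2 h3 h4
  have hR : 0 < R := h.nonneg.trans_lt h3
  have hκR : 0 < κ * R := by positivity
  -- The rays of the model circles of radius `R` are `κ R` apart. The curves deviate by at most `κ R
  -- / 4` and the push adds less than `κ R / 2`.
  refine ⟨κ * R / 2, by positivity, fun Y hY => ?_⟩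
  have hc := contDiff_const (𝕜 := ℝ) (E := ℝ) (n := 2) (c := R)
  have hp : Function.Periodic (fun _ : ℝ => R) (2 * Real.pi) := fun _ => rfl
  obtain ⟨k1, k2⟩ := linkingNumber_eq_of_close (hl.smul hc hp) (hl'.smul hc hp) (h.isLoop h3)
    ((h'.isLoop h4).add (isLoop_const Y)) (κ := κ * R)
    (fun s t x hx => by
      have : (1 - x) • R • planeCircle N u v s - x • R • planeCircle N' u' v' t =
          R • ((1 - x) • planeCircle N u v s - x • planeCircle N' u' v' t) := by module
      rw [this, norm_smul, Real.norm_of_nonneg hR.le, mul_comm]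
      exact mul_le_mul_of_nonneg_left (hbound s t x hx) hR.le)
    (fun s => by linarith [(h1 s).1])
    (fun t => by
      have : endCurve G' (rad' R) t + Y - R • planeCircle N' u' v' t =
        (endCurve G' (rad' R) t - R • planeCircle N' u' v' t) + Y := by abel
      rw [this]
      refine (norm_add_le _ _).trans_lt ?_
      linarith [(h2 t).1])
  refine ⟨k1, ?_⟩
  rw [k2, linkingNumber_smul_right (hl.smul hc hp) hl' (hdisj.smul_left fun _ => hR) hc hp
    fun _ => hR, linkingNumber_smul_left hl hl' hdisj hc hp fun _ => hR]
  exact linkingNumber_planeCircle h.isHarmonicEnd.orthonormal hdet N N'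

end IsEndWithRadius

/-! ### The link at infinity -/

/-- The radial projection to a sphere of the pushed curve does not change linking numbers. -/
lemma rayDisjoint_pushOff {a c : ℝ → R4} (ha : IsLoop a) (hc : IsLoop c) {R ε : ℝ} {X : R4}
    (hR : 0 < R) (h : RayDisjoint a fun t => c t + ε • X) :
    (∀ s t, a s ≠ pushOff R ε X c t) ∧
      linkingNumber a (pushOff R ε X c) = linkingNumber a fun t => c t + ε • X := by
  have hne : ∀ t, c t + ε • X ≠ 0 := fun t h0 => by
    refine h 0 t 1 (by simp) ?_
    simp only [h0]
    simp
  have hl : IsLoop fun t => c t + ε • X := hc.add (isLoop_const _)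
  have hpos : ∀ t, 0 < R / ‖c t + ε • X‖ := fun t => div_pos hR (norm_pos_iff.2 (hne t))
  refine ⟨fun s t he => ?_, ?_⟩
  · refine h.smul_right hpos s t (1 / 2) ⟨by norm_num, by norm_num⟩ ?_
    rw [he, pushOff]
    norm_num
  · refine linkingNumber_smul_right ha hl h ?_ (fun t => ?_) hpos
    · exact contDiff_const.div (hl.contDiff.norm ℝ hne) fun t => norm_ne_zero_iff.2 (hne t)
    · simp only [hc.periodic t]

lemma mul_exp_arg (z : ℂ) : (‖z‖ : ℂ) * Complex.exp (z.arg * Complex.I) = z :=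
  Complex.norm_mul_exp_arg_mul_I z

section
variable {ι : Type} {S : Set R4} {G : ι → ℂ → R4} {ρ r₁ B : ι → ℝ} {N : ι → ℕ} {u v : ι → R4}
  {rad : ι → ℝ → ℝ → ℝ}

lemma parametrizesLink_rad
    (h : ∀ i, IsEndWithRadius (G i) (ρ i) (N i) (u i) (v i) (r₁ i) (B i) (rad i))
    (hS : ∀ i z, ρ i < ‖z‖ → G i z ∈ S) {R : ℝ} (hR : ∀ i, B i < R)
    (hS' : ∀ x ∈ S, ‖x‖ = R → ∃ i z, r₁ i ≤ ‖z‖ ∧ G i z = x) :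
    ParametrizesLink S G ρ R fun i => rad i R where
  smooth i := (h i).contDiff_rad (hR i)
  periodic i := (h i).isRadius.periodic (hR i)
  radius_lt i t := (h i).lt.trans ((h i).isRadius.lt R (hR i) t)
  link_eq := by
    ext x
    simp only [mem_inter_iff, mem_sphere_zero_iff_norm, mem_iUnion, mem_range]
    constructor
    · rintro ⟨hx, hxR⟩
      obtain ⟨i, z, hz, rfl⟩ := hS' x hx hxR
      refine ⟨i, z.arg, ?_⟩
      have := (h i).isRadius.unique R (hR i) z.arg ‖z‖ hz (by rw [mul_exp_arg]; exact hxR)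
      rw [endCurve, ← this, mul_exp_arg]
    · rintro ⟨i, t, rfl⟩
      have hlt := (h i).lt.trans ((h i).isRadius.lt R (hR i) t)
      refine ⟨hS i _ ?_, (h i).norm_endCurve (hR i) t⟩
      rwa [norm_mul_exp ((h i).isHarmonicEnd.radius_pos.trans hlt).le]

/-- The writhe quantifies over all parametrizations of the link; points of norm `R` lie beyond `r₁`,
where the radius is unique, so there is only one. -/
lemma ParametrizesLink.eq_rad {R : ℝ} {r : ι → ℝ → ℝ} (hr : ParametrizesLink S G ρ R r)
    (h : ∀ i, IsEndWithRadius (G i) (ρ i) (N i) (u i) (v i) (r₁ i) (B i) (rad i))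
    (hR : ∀ i, B i < R) (hbd : ∀ i z, ρ i < ‖z‖ → ‖G i z‖ = R → r₁ i ≤ ‖z‖) :
    r = fun i => rad i R := by
  ext i t
  have hlt := hr.radius_lt i t
  have hn := norm_mul_exp ((h i).isHarmonicEnd.radius_pos.trans hlt).le t
  have hmem : endCurve (G i) (r i) t ∈ S ∩ Metric.sphere (0 : R4) R := by
    rw [hr.link_eq]
    exact mem_iUnion.2 ⟨i, mem_range_self t⟩
  have hnorm : ‖G i (r i t * Complex.exp (t * Complex.I))‖ = R :=
    mem_sphere_zero_iff_norm.1 hmem.2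
  refine (h i).isRadius.unique R (hR i) t _ ?_ hnorm
  have := hbd i _ (by rwa [hn]) hnorm
  rwa [hn] at this

/-- The writhe at infinity in terms of the linking numbers of the ends. -/
theorem hasWritheAtInfinity_sum [Fintype ι]
    (h : ∀ i, IsEndWithRadius (G i) (ρ i) (N i) (u i) (v i) (r₁ i) (B i) (rad i))
    (hS : ∀ i z, ρ i < ‖z‖ → G i z ∈ S)
    (hS' : ∀ᶠ R in atTop, ∀ x ∈ S, ‖x‖ = R → ∃ i z, r₁ i ≤ ‖z‖ ∧ G i z = x)
    (hbd : ∀ᶠ R in atTop, ∀ i z, ρ i < ‖z‖ → ‖G i z‖ = R → r₁ i ≤ ‖z‖) (l : ι → ι → ℝ)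
    (hl : ∀ i j, ∀ᶠ R in atTop, ∃ η > 0, ∀ Y ∈ (plane (u j) (v j))ᗮ, Y ≠ 0 → ‖Y‖ < η →
      RayDisjoint (endCurve (G i) (rad i R)) (fun t => endCurve (G j) (rad j R) t + Y) ∧
        linkingNumber (endCurve (G i) (rad i R)) (fun t => endCurve (G j) (rad j R) t + Y) =
          l i j) :
    HasWritheAtInfinity S G ρ (fun i => plane (u i) (v i)) (∑ i, ∑ j, l i j) := by
  have hl' := eventually_all.2 fun i => eventually_all.2 fun j => hl i j
  have hB : ∀ᶠ R in atTop, ∀ i, B i < R := eventually_all.2 fun i => eventually_gt_atTop (B i)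
  filter_upwards [hS', hbd, hl', hB, eventually_gt_atTop 0] with R h1 h2 h3 h4 h5
  refine ⟨⟨_, parametrizesLink_rad h hS h4 h1⟩, fun r hr X hX => ?_⟩
  rw [hr.eq_rad h h4 h2]
  have hev : ∀ i j, ∀ᶠ ε : ℝ in 𝓝[>] 0, RayDisjoint (endCurve (G i) (rad i R))
      (fun t => endCurve (G j) (rad j R) t + ε • X j) ∧
        linkingNumber (endCurve (G i) (rad i R))
          (fun t => endCurve (G j) (rad j R) t + ε • X j) = l i j := by
    intro i j
    obtain ⟨η, hη, hY⟩ := h3 i j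
    have hXpos : 0 < ‖X j‖ := norm_pos_iff.2 (hX j).1
    filter_upwards [Ioo_mem_nhdsGT (div_pos hη hXpos)] with ε hε
    refine hY _ (Submodule.smul_mem _ _ (hX j).2) (smul_ne_zero hε.1.ne' (hX j).1) ?_
    rw [norm_smul, Real.norm_of_nonneg hε.1.le]
    exact (lt_div_iff₀ hXpos).1 hε.2
  filter_upwards [eventually_all.2 fun i => eventually_all.2 fun j => hev i j] with ε hε
  have hpush := fun i j => rayDisjoint_pushOff ((h i).isLoop (h4 i)) ((h j).isLoop (h4 j)) h5
    (hε i j).1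
  refine ⟨fun i j => (hpush i j).1, ?_⟩
  exact Finset.sum_congr rfl fun i _ => Finset.sum_congr rfl fun j _ =>
    (hpush i j).2.trans (hε i j).2

end

/-! ### The ends of a properly immersed surface -/

lemma det4_ne_zero_of_isCompl {u v u' v' : R4} (h : Orthonormal ℝ ![u, v])
    (h' : Orthonormal ℝ ![u', v']) (hc : IsCompl (plane u v) (plane u' v')) :
    det4 u v u' v' ≠ 0 := by
  intro h0
  obtain ⟨x, hx0, hx⟩ := Matrix.exists_vecMul_eq_zero_iff.2 h0
  have hsum : x 0 • u + x 1 • v + x 2 • u' + x 3 • v' = 0 := by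
    ext j
    have := congrFun hx j
    simpa [Matrix.vecMul, dotProduct, Fin.sum_univ_four] using this
  have hpair : ∀ {a b : R4}, Orthonormal ℝ ![a, b] → ∀ {α β : ℝ}, α • a + β • b = 0 →
      α = 0 ∧ β = 0 := fun hab α β he => LinearIndependent.pair_iff.1 hab.linearIndependent α β he
  have hmem : x 0 • u + x 1 • v ∈ plane u v := Submodule.mem_span_pair.2 ⟨_, _, rfl⟩
  have hmem' : x 0 • u + x 1 • v ∈ plane u' v' := by
    refine Submodule.mem_span_pair.2 ⟨-x 2, -x 3, ?_⟩
    rw [← sub_eq_zero, ← neg_eq_zero, ← hsum]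
    module
  have hz := Submodule.disjoint_def.1 hc.disjoint _ hmem hmem'
  obtain ⟨e0, e1⟩ := hpair h hz
  rw [hz, zero_add] at hsum
  obtain ⟨e2, e3⟩ := hpair h' hsum
  refine hx0 (funext fun j => ?_)
  fin_cases j <;> assumption

lemma HasEnds.eventually_norm_lt {M : Type*} [TopologicalSpace M] [ChartedSpace ℂ M] {F : M → R4}
    (hF : Continuous F) {k : ℕ} {E : Fin k → ℂ → M} {ρ : Fin k → ℝ} {N : Fin k → ℕ}
    {u v : Fin k → R4} (h : HasEnds F E ρ N u v) {r : ℝ} (hr : ∀ i, ρ i < r) :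
    ∀ᶠ R in atTop, ∀ p, R ≤ ‖F p‖ → ∃ i, ∃ z, r < ‖z‖ ∧ E i z = p := by
  obtain ⟨C, hC⟩ := ((h.compact r hr).image hF).isBounded.exists_norm_le
  filter_upwards [eventually_gt_atTop C] with R hR p hp
  by_contra! hcon
  have hmem : p ∈ (⋃ i, E i '' annulus r)ᶜ := by
    rw [mem_compl_iff, mem_iUnion]
    rintro ⟨i, z, hz, hzp⟩
    exact hcon i z hz hzp
  linarith [hC _ (mem_image_of_mem F hmem)]

/-- Nothing is assumed about `E i` near `|z| = ρ i`, so the bound comes from the compact core: a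
point of large norm is `E j w` with `|w| > r`, and disjointness and injectivity identify it with `E
i z`. -/
lemma HasEnds.eventually_lt_norm {M : Type*} [TopologicalSpace M] [ChartedSpace ℂ M] {F : M → R4}
    (hF : Continuous F) {k : ℕ} {E : Fin k → ℂ → M} {ρ : Fin k → ℝ} {N : Fin k → ℕ}
    {u v : Fin k → R4} (h : HasEnds F E ρ N u v) {r : ℝ} (hr : ∀ i, ρ i < r) :
    ∀ᶠ R in atTop, ∀ i z, ρ i < ‖z‖ → ‖F (E i z)‖ = R → r < ‖z‖ := by
  filter_upwards [h.eventually_norm_lt hF hr] with R hR i z hz hzR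
  obtain ⟨j, w, hw, hwz⟩ := hR (E i z) hzR.ge
  have hwj : w ∈ annulus (ρ j) := (hr j).trans hw
  rcases eq_or_ne i j with rfl | hij
  · rwa [(h.isEnd i).injective hz hwj hwz.symm]
  · exact absurd hwz (disjoint_left.1 (h.disjoint i j hij) (mem_image_of_mem _ hz)
      |> fun hn he => hn (he ▸ mem_image_of_mem _ hwj))

lemma intersectionSign_comm (u v u' v' : R4) :
    intersectionSign u v u' v' = intersectionSign u' v' u v := by
  rw [intersectionSign, intersectionSign]
  congr 1
  simp only [det4_eq]
  ring

lemma sum_sum_diag_add_offDiag {k : ℕ} (w : Fin k → ℝ) (a : Fin k → Fin k → ℝ)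
    (ha : ∀ i j, a i j = a j i) :
    ∑ i, ∑ j, (if i = j then w i else a i j) =
      ∑ i, w i + 2 * ∑ i, ∑ j ∈ Finset.univ.filter (fun j => i < j), a i j := by
  have hsplit : ∀ i j, (if i = j then w i else a i j) = (if i = j then w i else 0)
      + ((if i < j then a i j else 0) + (if j < i then a j i else 0)) := fun i j => by
    rcases lt_trichotomy i j with hij | hij | hij
    · simp [hij, hij.ne, hij.not_gt]
    · simp [hij]
    · simp [hij, hij.ne', hij.not_gt, ha i j]
  have hswap : ∑ i, ∑ j, (if j < i then a j i else 0) = ∑ i, ∑ j, (if i < j then a i j else 0) :=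
    Finset.sum_comm
  simp only [hsplit, Finset.sum_add_distrib, hswap, Finset.sum_ite_eq, Finset.mem_univ, if_true,
    Finset.sum_filter]
  ring

theorem mainTheorem8 {M : Type*} [TopologicalSpace M] [T2Space M] [ChartedSpace ℂ M]
    [IsManifold 𝓘(ℂ) ω M] (F : M → R4)
    (hmin : IsMinimalImmersion F) (hproper : IsProperMap F) (hemb : EmbeddedOutsideBall F)
    (k : ℕ) (E : Fin k → ℂ → M) (ρ : Fin k → ℝ) (N : Fin k → ℕ) (u v : Fin k → R4)
    (hends : HasEnds F E ρ N u v)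
    (htrans : ∀ i j, i ≠ j → IsCompl (plane (u i) (v i)) (plane (u j) (v j))) :
    ∃ (w : ℝ) (wE : Fin k → ℝ),
      HasSurfaceWrithe F E ρ u v w ∧
      (∀ i, HasEndWrithe F (E i) (ρ i) (u i) (v i) (wE i)) ∧
      w = (∑ i, wE i) +
        2 * ∑ i, ∑ j ∈ Finset.univ.filter (fun j => i < j),
          (N i : ℝ) * (N j : ℝ) * intersectionSign (u i) (v i) (u j) (v j) := by
  have hF := hproper.continuous
  choose r₁ B rad h using fun i =>
    ((hends.isEnd i).isHarmonicEnd hmin).exists_isEndWithRadius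
  obtain ⟨R₀, hR₀⟩ := hemb
  have hinj : ∀ i, InjOn (F ∘ E i) {z | ρ i < ‖z‖ ∧ R₀ ≤ ‖(F ∘ E i) z‖} :=
    fun i z hz z' hz' he => (hends.isEnd i).injective hz.1 hz'.1 (hR₀ hz.2 hz'.2 he)
  choose wE hwE using fun i => (h i).exists_writhe (hinj i)
  obtain ⟨r, hr⟩ : ∃ r, ∀ i, r₁ i ≤ r :=
    (eventually_all.2 fun i => eventually_ge_atTop (r₁ i)).exists
  have hρr : ∀ i, ρ i < r := fun i => (h i).lt.trans_le (hr i)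
  have hbd := hends.eventually_lt_norm hF hρr
  -- The matrix of linking numbers has the writhes of the ends on its diagonal and the symmetric
  -- terms `N_i N_j σ(i, j)` elsewhere.
  have hoff := sum_sum_diag_add_offDiag wE
    (fun i j => (N i : ℝ) * (N j : ℝ) * intersectionSign (u i) (v i) (u j) (v j))
    fun i j => by rw [intersectionSign_comm, mul_comm (N i : ℝ)]
  refine ⟨_, wE, ?_, fun i => ?_, hoff⟩
  · refine hasWritheAtInfinity_sum h (fun i z _ => mem_range_self _) ?_ ?_ _ fun i j => ?_
    · filter_upwards [hends.eventually_norm_lt hF hρr] with R hR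
      rintro _ ⟨p, rfl⟩ hp
      obtain ⟨i, z, hz, rfl⟩ := hR p hp.ge
      exact ⟨i, z, (hr i).trans hz.le, rfl⟩
    · filter_upwards [hbd] with R hR i z hz hzR
      exact (hr i).trans (hR i z hz hzR).le
    · rcases eq_or_ne i j with rfl | hij
      · simp only [if_true]
        exact hwE i
      · have hdet := det4_ne_zero_of_isCompl (h i).isHarmonicEnd.orthonormal
          (h j).isHarmonicEnd.orthonormal (htrans i j hij)
        filter_upwards [(h i).eventually_linkingNumber (h j) hdet] with R hR
        obtain ⟨η, hη, hY⟩ := hR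
        refine ⟨η, hη, fun Y _ _ hYη => ?_⟩
        rw [if_neg hij]
        exact hY Y hYη
  -- A single end is the same statement for a link with one component.
  · have := hasWritheAtInfinity_sum (ι := Unit) (S := F '' (E i '' annulus (ρ i)))
      (fun _ => h i) (fun _ z hz => mem_image_of_mem F (mem_image_of_mem (E i) hz)) ?_ ?_
      (fun _ _ => wE i) (fun _ _ => hwE i)
    · simp only [Finset.univ_unique, Finset.sum_const, Finset.card_singleton, one_smul] at this
      exact this
    · filter_upwards [hbd] with R hR
      rintro _ ⟨_, ⟨z, hz, rfl⟩, rfl⟩ hp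
      exact ⟨(), z, (hr i).trans (hR i z hz hp).le, rfl⟩
    · filter_upwards [hbd] with R hR _ z hz hzR
      exact (hr i).trans (hR i z hz hzR).le
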